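/- An instance $\mathcal I=(X,D,\mathrm{dom},N)$ of the consistency problem for AtMost-NValue constraints consists of a finite set $X$ of $n$ variables, a finite totally ordered set $D$ of values, a non-empty domain $\mathrm{dom}(x)\subseteq D$ for each $x\in X$, and an integer $N$. It is consistent if there is a map $\alpha:X\to D$ with $\alpha(x)\in\mathrm{dom}(x)$ for all $x\in X$ that takes at most $N$ different values. A hole of $\mathrm{dom}(x)$ is a pair $(u,w)$ of elements of $\mathrm{dom}(x)$ such that some $v\in D\setminus \mathrm{dom}(x)$ satisfies $u<v<w$ and no $v'\in \mathrm{dom}(x)$ satisfies $u<v'<w$. The parameter $k$ is the total number of holes in the domains of all variables. Instances are given, together with $k$, by a succinct description: values are named by their rank in $D$, and each domain is listed as the left and right endpoints of its intervals (its inclusion-wise maximal hole-free subsets). The size of $\mathcal I$ is $|\mathcal I|=n+|D|+k$. **Theorem.** The consistency problem for AtMost-NValue constraints, parameterized by the number $k$ of holes, admits a linear-time reduction to a problem kernel with $O(k^2)$ variables and $O(k^2)$ domain values. That is, there are an algorithm (a program of a random access machine) and a constant $c$ such that, on every instance $\mathcal I=(X,D,\mathrm{dom},N)$ with $k$ holes,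 the algorithm halts after at most $c\,(|\mathcal I|+1)$ steps, using only words that hold integers of absolute value at most $c\,(|\mathcal I|+|N|+1)$, and outputs an AtMost-NValue instance $\mathcal I'=(X',D',\mathrm{dom}',N')$, with $k'$ holes, such that $\mathcal I'$ is consistent if and only if $\mathcal I$ is consistent, $|X'|\le c\,k^2$, $|D'|\le c\,k^2$, $k'\le c\,k^2$ and $|N'|\le c\,k^2+1$. -/

import Mathlib

namespace NValueKernel

/-! ### `AtMost-NValue` instances -/

/-- The holes of a subset `A` of a totally ordered set `α`: the pairs `(u, w)` of elements of `A`
with some element of `α` outside `A`, and no element of `A`, strictly between them. -/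
def holes {α : Type} [LinearOrder α] [Fintype α] (A : Finset α) : Finset (α × α) :=
  (A ×ˢ A).filter fun p =>
    (∃ v : α, v ∉ A ∧ p.1 < v ∧ v < p.2) ∧ ¬ ∃ v' ∈ A, p.1 < v' ∧ v' < p.2

/-- An instance of the consistency problem for `AtMost-NValue` constraints: `n` variables, a totally
ordered set `D` of `d` values, a nonempty domain for each variable, and an integer `N`.
Variables are named `0, …, n - 1`, and values are named by their rank `0, …, d - 1` in `D`. -/
structure Instance where
  n : ℕ
  d : ℕ
  dom : Fin n → Finset (Fin d)
  dom_nonempty : ∀ x, (dom x).Nonempty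
  N : ℤ

/-- Some instantiation of the variables uses at most `N` different values. -/
def Instance.Consistent (I : Instance) : Prop :=
  ∃ a : Fin I.n → Fin I.d, (∀ x, a x ∈ I.dom x) ∧ ((Finset.univ.image a).card : ℤ) ≤ I.N

/-- The parameter `k`: the total number of holes in the domains of the variables. -/
def Instance.numHoles (I : Instance) : ℕ := ∑ x, (holes (I.dom x)).card

/-- The size `n + |D| + k` of an instance in succinct description. -/
def Instance.size (I : Instance) : ℕ := I.n + I.d + I.numHoles

/-- The intervals of a domain `A`, each given as its pair of endpoints: the
inclusion-wise maximal ranges `[l, r]` contained in `A`. -/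
def intervals {d : ℕ} (A : Finset (Fin d)) : Finset (Fin d ×ₗ Fin d) :=
  Finset.univ.filter fun p =>
    (ofLex p).1 ≤ (ofLex p).2 ∧ Finset.Icc (ofLex p).1 (ofLex p).2 ⊆ A ∧
      ∀ l r : Fin d, Finset.Icc (ofLex p).1 (ofLex p).2 ⊆ Finset.Icc l r →
        Finset.Icc l r ⊆ A → l = (ofLex p).1 ∧ r = (ofLex p).2

/-- The succinct description of a domain: the number of its intervals, followed by the left and
right endpoint of each interval, from left to right. -/
def encodeDom {d : ℕ} (A : Finset (Fin d)) : List ℤ :=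
  ((intervals A).card : ℤ) ::
    ((intervals A).sort (· ≤ ·)).flatMap fun p => [((ofLex p).1.val : ℤ), ((ofLex p).2.val : ℤ)]

/-- An instance together with its parameter, as a sequence of integers:
`N`, `n`, `|D|`, `k`, and then the succinct descriptions of the `n` domains. -/
def Instance.encode (I : Instance) : List ℤ :=
  [I.N, (I.n : ℤ), (I.d : ℤ), (I.numHoles : ℤ)] ++
    (List.finRange I.n).flatMap fun x => encodeDom (I.dom x)

/-! ### Random access machine

A word random access machine with structured control. It has registers and a fixed finite number
of memory banks (those named in the program), all of them addressed by integers and holding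
integers. -/

/-- The contents of the registers and of the memory banks. -/
structure State where
  reg : ℕ → ℤ
  mem : ℕ → ℤ → ℤ

/-- Arithmetic expressions: constants, registers, sums, differences, and the content of the
cell of memory bank `b` whose address is the value of an expression. -/
inductive Expr where
  | const (z : ℤ)
  | reg (r : ℕ)
  | add (e f : Expr)
  | sub (e f : Expr)
  | load (b : ℕ) (e : Expr)

def Expr.eval (s : State) : Expr → ℤ
  | .const z => z
  | .reg r => s.reg r
  | .add e f => e.eval s + f.eval s
  | .sub e f => e.eval s - f.eval s
  | .load b e => s.mem b (e.eval s)

/-- Every operation in an expression takes one time unit. -/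
def Expr.cost : Expr → ℕ
  | .const _ => 1
  | .reg _ => 1
  | .add e f => e.cost + f.cost + 1
  | .sub e f => e.cost + f.cost + 1
  | .load _ e => e.cost + 1

inductive Test where
  | lt (e f : Expr)
  | eq (e f : Expr)
  | not (a : Test)
  | and (a b : Test)

def Test.Holds (s : State) : Test → Prop
  | .lt e f => e.eval s < f.eval s
  | .eq e f => e.eval s = f.eval s
  | .not a => ¬ a.Holds s
  | .and a b => a.Holds s ∧ b.Holds s

def Test.cost : Test → ℕ
  | .lt e f => e.cost + f.cost + 1
  | .eq e f => e.cost + f.cost + 1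
  | .not a => a.cost + 1
  | .and a b => a.cost + b.cost + 1

inductive Program where
  | skip
  | assign (r : ℕ) (e : Expr)
  | store (b : ℕ) (e f : Expr)
  | seq (p q : Program)
  | ite (a : Test) (p q : Program)
  | while (a : Test) (p : Program)

/-- `r := z`. -/
def State.setReg (s : State) (r : ℕ) (z : ℤ) : State :=
  { s with reg := Function.update s.reg r z }

/-- The cell of bank `b` with address `i` receives the value `z`. -/
def State.setMem (s : State) (b : ℕ) (i z : ℤ) : State :=
  { s with mem := Function.update s.mem b (Function.update (s.mem b) i z) }

/-- `Exec w p s t s'`: with words that hold the integers of absolute value at most `w`, the program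
`p`, started in state `s`, halts in state `s'` after exactly `t` time units. A run that
writes a larger number, or writes to a larger address, has no outcome. -/
inductive Exec (w : ℕ) : Program → State → ℕ → State → Prop where
  | skip (s : State) : Exec w .skip s 1 s
  | assign (s : State) (r : ℕ) (e : Expr) (hw : (e.eval s).natAbs ≤ w) :
      Exec w (.assign r e) s (e.cost + 1) (s.setReg r (e.eval s))
  | store (s : State) (b : ℕ) (e f : Expr)
      (hi : (e.eval s).natAbs ≤ w) (hw : (f.eval s).natAbs ≤ w) :
      Exec w (.store b e f) s (e.cost + f.cost + 1) (s.setMem b (e.eval s) (f.eval s))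
  | seq {p q : Program} {s s₁ s₂ : State} {t₁ t₂ : ℕ}
      (hp : Exec w p s t₁ s₁) (hq : Exec w q s₁ t₂ s₂) :
      Exec w (.seq p q) s (t₁ + t₂) s₂
  | iteTrue {a : Test} {p q : Program} {s s₁ : State} {t : ℕ}
      (ha : a.Holds s) (hp : Exec w p s t s₁) :
      Exec w (.ite a p q) s (a.cost + t + 1) s₁
  | iteFalse {a : Test} {p q : Program} {s s₁ : State} {t : ℕ}
      (ha : ¬ a.Holds s) (hq : Exec w q s t s₁) :
      Exec w (.ite a p q) s (a.cost + t + 1) s₁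
  | whileTrue {a : Test} {p : Program} {s s₁ s₂ : State} {t₁ t₂ : ℕ}
      (ha : a.Holds s) (hp : Exec w p s t₁ s₁) (hq : Exec w (.while a p) s₁ t₂ s₂) :
      Exec w (.while a p) s (a.cost + t₁ + t₂ + 1) s₂
  | whileFalse {a : Test} {p : Program} {s : State} (ha : ¬ a.Holds s) :
      Exec w (.while a p) s (a.cost + 1) s

/-- The initial state: the input stands in bank `0` from address `0` on, all else is `0`. -/
def State.init (input : List ℤ) : State where
  reg := fun _ => 0
  mem := fun b i => if b = 0 ∧ 0 ≤ i then input.getD i.toNat 0 else 0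

/-- The sequence `output` stands in bank `1` from address `0` on. -/
def State.Outputs (s : State) (output : List ℤ) : Prop :=
  ∀ (i : ℕ) (h : i < output.length), s.mem 1 (i : ℤ) = output[i]

end NValueKernel

/-! Shift the values up by one to points `1, …, d` and add a free virtual point `0`. For a point `q`
let `nx q` be the least right end of a hole-free domain lying wholly beyond `q`, or `d + 1` if there
is none. Every solution has a point in `(q, nx q]` whenever `nx q ≤ d`. Membership in a domain with
holes changes only right after the last point before, or the last point of, one of its intervals;
these O(k) points are the seeds. Call reached the points in the closure of `0` and the seeds under
`nx`. A solution can be rounded up to reached points. Conversely, a set of reached points that meets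
`(q, nx q]` for every reached `q` with `nx q ≤ d` meets all hole-free domains. So the problem
becomes a piercing problem on reached points, with the domains with holes as side constraints
(`NextSpec.coverable_iff`).

The orbit of `0` under `nx` cuts the line into blocks. By monotonicity a reached point of a block is
a seed or the image of a reached point of the block before, so the number of reached points per
block grows only by seeds (`IsJump.blockCount_succ_le`). If two consecutive blocks contain no seed
and have equally many reached points, `nx` maps the reached points of the first bijectively onto
those of the second (`Removable.image_eq`). The second block is then a copy. It can be deleted, with
jumps into it prolonged by one further jump, and the optimum drops by exactly one
(`CopiedBlock.pierced_outside_iff`). In one direction one point of the copy is put back, in the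
other the chosen points of the copy are exchanged or dropped. All removable blocks are deleted from
the last to the first (`IsJump.pierced_badFrom`), so that a block and its predecessor are still
intact when its turn comes.

For the size, a surviving block other than the initial one has a seed in it or in its predecessor,
or has fewer reached points than its predecessor. A potential argument bounds the number of such
blocks by three times the number of seeds (`IsJump.card_not_removable_le`). Each block has at most
one reached point more than there are seeds, so O(k²) points survive (`IsJump.card_kept_le`).
Renaming them by rank gives the kernel: one interval for each kept point whose successor exists, and
the renamed domains with holes (`coverable_reduced_iff`).

Everything is computable by sweeps. The jumps come from one backward sweep. Reached points, block
numbers and counts come from one forward sweep, because jumps only go forward. Removability compares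
counts of adjacent blocks, and the prolonged jumps are found backwards. Each sweep is verified by a
loop invariant indexed by the iteration, which also bounds the time. -/

namespace NValueKernel

/-! ### Point systems and the deletion of a block -/

/-- A finite set `K` of points up to `d`, among them the virtual point `0`, with a monotone map `f`
that sends a point to a later one of `K`, or beyond `d`. -/
structure PointSystem (d : ℕ) (K : Finset ℕ) (f : ℕ → ℕ) : Prop where
  zero_mem : 0 ∈ K
  le : ∀ q ∈ K, q ≤ d
  lt : ∀ q ∈ K, q < f q
  mem : ∀ q ∈ K, f q ≤ d → f q ∈ K
  mono : ∀ q ∈ K, ∀ q' ∈ K, q ≤ q' → f q ≤ f q'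

/-- `N` points of `K`, besides the virtual point `0`, suffice to meet all `(q, f q]` with `q ∈ K`
and `f q ≤ d`, and all members of the family `O`. -/
def Pierced {ι : Type} (d : ℕ) (K : Finset ℕ) (f : ℕ → ℕ) (O : ι → ℕ → Prop) (N : ℤ) : Prop :=
  ∃ S ⊆ K, 0 ∈ S ∧ (S.card : ℤ) ≤ N + 1 ∧ (∀ q ∈ K, f q ≤ d → ∃ v ∈ S, q < v ∧ v ≤ f q) ∧
    ∀ x, ∃ v ∈ S, O x v

/-- `[β, γ)` is a copy of the preceding block `[α, β)`. -/
structure CopiedBlock (K : Finset ℕ) (f : ℕ → ℕ) (α β γ : ℕ) : Prop where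
  lt : α < β
  mem : α ∈ K
  map_left : f α = β
  le_map : γ ≤ f β
  mem_right : β ∈ K
  lt_right : β < γ
  map_lt : ∀ a ∈ K, α ≤ a → a < β → f a < γ
  surj : ∀ b ∈ K, β ≤ b → b < γ → ∃ a ∈ K, α ≤ a ∧ a < β ∧ f a = b

/-- The points of `K` outside `[β, γ)`. -/
def outside (K : Finset ℕ) (β γ : ℕ) : Finset ℕ := K.filter fun v => ¬ (β ≤ v ∧ v < γ)

/-- The map `f`, where it leads into `[β, γ)`, is applied twice. -/
def jumpOver (f : ℕ → ℕ) (β γ q : ℕ) : ℕ := if β ≤ f q ∧ f q < γ then f (f q) else f q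

section Deletion

variable {ι : Type} {d : ℕ} {K : Finset ℕ} {f : ℕ → ℕ} {O : ι → ℕ → Prop} {α β γ : ℕ}

theorem mem_outside {v : ℕ} : v ∈ outside K β γ ↔ v ∈ K ∧ ¬ (β ≤ v ∧ v < γ) := by
  simp [outside]

theorem CopiedBlock.le_map_of_le (hs : PointSystem d K f) (hb : CopiedBlock K f α β γ) {b : ℕ}
    (hbK : b ∈ K) (h : β ≤ b) : γ ≤ f b :=
  hb.le_map.trans (hs.mono _ hb.mem_right _ hbK h)

/-- A second jump suffices, since from `β` on every jump leads to `γ` or beyond. The delicate clause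
is monotonicity when `f q` falls into the deleted block and `f q'` lies beyond it. Then `q'` is
neither at most `α` nor in `[α, β)`, so it lies beyond the block, hence above `f q`, and
monotonicity of `f` applies to `f q ≤ q'`. -/
theorem PointSystem.jumpOver (hs : PointSystem d K f) (hb : CopiedBlock K f α β γ) (hγ : γ ≤ d + 1) :
    PointSystem d (outside K β γ) (jumpOver f β γ) where
  zero_mem := mem_outside.2 ⟨hs.zero_mem, by have := hb.lt; omega⟩
  le q hq := hs.le q (mem_outside.1 hq).1
  lt q hq := by
    have hq := (mem_outside.1 hq).1
    have h1 := hs.lt q hq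
    unfold NValueKernel.jumpOver
    split_ifs with h
    · have := hs.lt (f q) (hs.mem q hq (by omega)); omega
    · exact h1
  mem q hq hd := by
    have hq := (mem_outside.1 hq).1
    unfold NValueKernel.jumpOver at hd ⊢
    rw [mem_outside]
    split_ifs at hd ⊢ with h
    · have h2 := hs.mem q hq (by omega)
      refine ⟨hs.mem _ h2 hd, ?_⟩
      have := hb.le_map_of_le hs h2 h.1; omega
    · exact ⟨hs.mem _ hq hd, h⟩
  mono q hq q' hq' hle := by
    rw [mem_outside] at hq hq'
    have h1 := hs.mono q hq.1 q' hq'.1 hle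
    unfold NValueKernel.jumpOver
    split_ifs with h h' h'
    · exact hs.mono _ (hs.mem q hq.1 (by omega)) _ (hs.mem q' hq'.1 (by omega)) h1
    · have hα : α < q' := by
        by_contra hc
        have := hs.mono q' hq'.1 α hb.mem (by omega)
        rw [hb.map_left] at this
        have := hb.lt_right
        omega
      have : ¬ q' < β := fun hc => by
        have := hb.map_lt q' hq'.1 hα.le hc; omega
      exact hs.mono _ (hs.mem q hq.1 (by omega)) _ hq'.1 (by omega)
    · have := hs.lt (f q') (hs.mem q' hq'.1 (by omega)); omega
    · exact h1

/-- One point `z` of the deleted block is put back. A constraint of a deleted point before `z` is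
met by `z`. That of a deleted point `q ≥ z` is inherited from a preimage of `q`, whose prolonged
jump ends at `f q`. -/
theorem CopiedBlock.pierced_of_outside (hs : PointSystem d K f) (hb : CopiedBlock K f α β γ)
    (hγ : γ ≤ d + 1) {N : ℤ}
    (h : Pierced d (outside K β γ) (NValueKernel.jumpOver f β γ) O (N - 1)) :
    Pierced d K f O N := by
  obtain ⟨S, hSK, h0, hc, hR, hO⟩ := h
  have hSK' : ∀ v ∈ S, v ∈ K ∧ ¬ (β ≤ v ∧ v < γ) := fun v hv => mem_outside.1 (hSK hv)
  have hβγ := hb.lt_right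
  have hαβ := hb.lt
  -- `z` is the image of the last chosen point of the block `[α, β)`, if any
  obtain ⟨z, hzK, hzβ, hzγ, hz1, hz2⟩ : ∃ z ∈ K, β ≤ z ∧ z < γ ∧
      (∀ q ∈ K, α ≤ q → q < β → (∃ v ∈ S, q < v ∧ v < β) ∨ z ≤ f q) ∧
      ((∃ a ∈ S, α ≤ a ∧ a < β ∧ f a = z ∧ ∀ v ∈ S, v < β → v ≤ a) ∨
        (z = β ∧ ∀ v ∈ S, v < β → v < α)) := by
    by_cases hne : (S.filter fun v => α ≤ v ∧ v < β).Nonempty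
    · have hm := Finset.max'_mem _ hne
      set a := (S.filter fun v => α ≤ v ∧ v < β).max' hne with ha
      rw [Finset.mem_filter] at hm
      have haK := (hSK' a hm.1).1
      have hmax : ∀ v ∈ S, v < β → v ≤ a := by
        intro v hv hvβ
        by_cases hαv : α ≤ v
        · exact Finset.le_max' _ _ (Finset.mem_filter.2 ⟨hv, hαv, hvβ⟩)
        · omega
      have hfa := hb.map_lt a haK hm.2.1 hm.2.2
      have hfa' : β ≤ f a := hb.map_left ▸ hs.mono _ hb.mem _ haK hm.2.1
      refine ⟨f a, hs.mem a haK (by omega), hfa', hfa, ?_, Or.inl ⟨a, hm.1, hm.2.1, hm.2.2, rfl, hmax⟩⟩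
      intro q hq hαq hqβ
      by_cases hqa : q < a
      · exact Or.inl ⟨a, hm.1, hqa, hm.2.2⟩
      · exact Or.inr (hs.mono _ haK _ hq (by omega))
    · refine ⟨β, hb.mem_right, le_rfl, hβγ, ?_, Or.inr ⟨rfl, ?_⟩⟩
      · intro q hq hαq hqβ
        exact Or.inr (hb.map_left ▸ hs.mono _ hb.mem _ hq hαq)
      · intro v hv hvβ
        by_contra hcon
        exact hne ⟨v, Finset.mem_filter.2 ⟨hv, by omega, hvβ⟩⟩
  refine ⟨insert z S, ?_, Finset.mem_insert_of_mem h0, ?_, ?_, ?_⟩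
  · intro v hv
    rcases Finset.mem_insert.1 hv with rfl | hv
    · exact hzK
    · exact (hSK' v hv).1
  · have := Finset.card_insert_le z S
    omega
  · intro q hq hqd
    by_cases hqβ : q < β
    · by_cases hαq : α ≤ q
      · rcases hz1 q hq hαq hqβ with ⟨v, hv, h1, h2⟩ | h1
        · refine ⟨v, Finset.mem_insert_of_mem hv, h1, ?_⟩
          have := hs.mono _ hb.mem _ hq hαq
          rw [hb.map_left] at this
          omega
        · exact ⟨z, Finset.mem_insert_self _ _, by omega, h1⟩
      · -- before the block
        have hfq : f q ≤ β := hb.map_left ▸ hs.mono _ hq _ hb.mem (by omega)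
        by_cases hfqβ : f q < β
        · obtain ⟨v, hv, h1, h2⟩ := hR q (mem_outside.2 ⟨hq, by omega⟩)
            (by unfold NValueKernel.jumpOver; rw [if_neg (by omega)]; omega)
          unfold NValueKernel.jumpOver at h2
          rw [if_neg (by omega)] at h2
          exact ⟨v, Finset.mem_insert_of_mem hv, h1, h2⟩
        -- Here `f q = β`, so the prolonged constraint says nothing about `(q, β]`. Either the last
        -- chosen point of `[α, β)` lies in it, or `z = β` does.
        · rcases hz2 with ⟨a, ha, h1, h2, h3, h4⟩ | ⟨h1, h2⟩
          · exact ⟨a, Finset.mem_insert_of_mem ha, by omega, by omega⟩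
          · exact ⟨z, Finset.mem_insert_self _ _, by omega, by omega⟩
    · by_cases hqγ : q < γ
      · by_cases hqz : q < z
        · refine ⟨z, Finset.mem_insert_self _ _, hqz, ?_⟩
          have := hb.le_map_of_le hs hq (by omega)
          omega
        -- The preimage must have no chosen point between it and `β`. Then the chosen point in `(q',
        -- f q]` lies beyond the deleted block, hence after `q`. For `q = z` the last chosen point
        -- `a` is taken itself.
        · obtain ⟨q', hq', h1, h2, h3, h6⟩ : ∃ q' ∈ K, α ≤ q' ∧ q' < β ∧ f q' = q ∧
              ∀ v ∈ S, v < β → v ≤ q' := by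
            obtain ⟨q', hq', h1, h2, h3⟩ := hb.surj q hq (by omega) hqγ
            rcases hz2 with ⟨a, ha, g1, g2, g3, g4⟩ | ⟨g1, g2⟩
            · rcases eq_or_lt_of_le (not_lt.1 hqz) with h | h
              · exact ⟨a, (hSK' a ha).1, g1, g2, g3.trans h, g4⟩
              · refine ⟨q', hq', h1, h2, h3, fun v hv hvβ => (g4 v hv hvβ).trans ?_⟩
                by_contra hcon
                have := hs.mono _ hq' _ (hSK' a ha).1 (by omega)
                omega
            · exact ⟨q', hq', h1, h2, h3, fun v hv hvβ => (g2 v hv hvβ).le.trans h1⟩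
          have hjo : NValueKernel.jumpOver f β γ q' = f q := by
            unfold NValueKernel.jumpOver; rw [h3, if_pos (by omega)]
          obtain ⟨v, hv, h4, h5⟩ := hR q' (mem_outside.2 ⟨hq', by omega⟩) (by omega)
          rw [hjo] at h5
          refine ⟨v, Finset.mem_insert_of_mem hv, ?_, h5⟩
          have hv' := hSK' v hv
          have := h6 v hv
          omega
      · obtain ⟨v, hv, h1, h2⟩ := hR q (mem_outside.2 ⟨hq, by omega⟩) (by
          unfold NValueKernel.jumpOver; rw [if_neg (by have := hs.lt q hq; omega)]; exact hqd)
        unfold NValueKernel.jumpOver at h2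
        rw [if_neg (by have := hs.lt q hq; omega)] at h2
        exact ⟨v, Finset.mem_insert_of_mem hv, h1, h2⟩
  · intro x
    obtain ⟨v, hv, h1⟩ := hO x
    exact ⟨v, Finset.mem_insert_of_mem hv, h1⟩

/-- If at least two points of the deleted block are chosen, the last point of `[α, β)` replaces
them. Otherwise the only chosen one can simply be dropped. By `hO` the side constraints do not
distinguish points of `[α, f β]`, so a remaining chosen point there can stand in for a lost one. -/
theorem CopiedBlock.pierced_outside (hs : PointSystem d K f) (hb : CopiedBlock K f α β γ)
    (hγ : γ ≤ d + 1) (hO : ∀ x u v, α ≤ u → u ≤ f β → α ≤ v → v ≤ f β → O x u → O x v)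
    (hOd : ∀ x v, O x v → v ≤ d) {N : ℤ}
    (h : Pierced d K f O N) :
    Pierced d (outside K β γ) (NValueKernel.jumpOver f β γ) O (N - 1) := by
  obtain ⟨S, hSK, h0, hc, hR, hT⟩ := h
  have hβγ := hb.lt_right
  have hαβ := hb.lt
  have hβd := hs.le _ hb.mem_right
  have hfα := hb.map_left
  have hγβ := hb.le_map
  set B := S.filter fun v => β ≤ v ∧ v < γ with hB
  set S₀ := S.filter fun v => ¬ (β ≤ v ∧ v < γ) with hS₀
  have hcard : B.card + S₀.card = S.card := Finset.card_filter_add_card_filter_not _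
  have hS₀K : S₀ ⊆ outside K β γ := fun v hv => by
    rw [hS₀, Finset.mem_filter] at hv
    exact mem_outside.2 ⟨hSK hv.1, hv.2⟩
  have hmem₀ : ∀ v, v ∈ S₀ ↔ v ∈ S ∧ ¬ (β ≤ v ∧ v < γ) := fun v => by rw [hS₀, Finset.mem_filter]
  have hmemB : ∀ v, v ∈ B ↔ v ∈ S ∧ β ≤ v ∧ v < γ := fun v => by rw [hB, Finset.mem_filter]
  have h00 : 0 ∈ S₀ := (hmem₀ 0).2 ⟨h0, by omega⟩
  -- the image of a point of `[α, β)` lies in `[β, γ)`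
  have himg : ∀ a ∈ K, α ≤ a → a < β → β ≤ f a ∧ f a < γ ∧ f a ∈ K := fun a ha h1 h2 => by
    have h3 := hb.map_lt a ha h1 h2
    have h4 := hs.mono _ hb.mem _ ha h1
    exact ⟨by omega, h3, hs.mem a ha (by omega)⟩
  have hjump : ∀ q ∈ K, β ≤ f q → f q < γ → NValueKernel.jumpOver f β γ q = f (f q) :=
    fun q _ h1 h2 => if_pos ⟨h1, h2⟩
  -- constraints other than those of `[α, β)` and of points leading to `β`
  have hrest : ∀ q ∈ outside K β γ, ¬ (α ≤ q ∧ q < β) → f q ≠ β →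
      NValueKernel.jumpOver f β γ q ≤ d →
      ∃ v ∈ S₀, q < v ∧ v ≤ NValueKernel.jumpOver f β γ q := by
    intro q hq h1 h2 h3
    rw [mem_outside] at hq
    have hlt := hs.lt q hq.1
    have hn : ¬ (β ≤ f q ∧ f q < γ) := by
      rintro ⟨h4, h5⟩
      have := hs.mono q hq.1 α hb.mem
      omega
    unfold NValueKernel.jumpOver at h3 ⊢
    rw [if_neg hn] at h3 ⊢
    obtain ⟨v, hv, h4, h5⟩ := hR q hq.1 h3
    refine ⟨v, (hmem₀ v).2 ⟨hv, ?_⟩, h4, h5⟩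
    have := hs.mono q hq.1 α hb.mem
    omega
  by_cases h2 : 2 ≤ B.card
  · -- replace the points of `[β, γ)` by the last point of `[α, β)`
    have hne : (K.filter fun v => α ≤ v ∧ v < β).Nonempty :=
      ⟨α, Finset.mem_filter.2 ⟨hb.mem, le_rfl, hαβ⟩⟩
    have hm := Finset.max'_mem _ hne
    set z := (K.filter fun v => α ≤ v ∧ v < β).max' hne with hz
    rw [Finset.mem_filter] at hm
    have hmax : ∀ v ∈ K, α ≤ v → v < β → v ≤ z := fun v hv g1 g2 =>
      Finset.le_max' _ _ (Finset.mem_filter.2 ⟨hv, g1, g2⟩)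
    refine ⟨insert z S₀, ?_, Finset.mem_insert_of_mem h00, ?_, ?_, ?_⟩
    · intro v hv
      rcases Finset.mem_insert.1 hv with rfl | hv
      · exact mem_outside.2 ⟨hm.1, by omega⟩
      · exact hS₀K hv
    · have := Finset.card_insert_le z S₀
      omega
    · intro q hq hqd
      have hqK := (mem_outside.1 hq).1
      by_cases hqA : α ≤ q ∧ q < β
      · obtain ⟨g1, g2, g3⟩ := himg q hqK hqA.1 hqA.2
        rw [hjump q hqK g1 g2] at hqd ⊢
        have := hs.lt _ g3
        rcases eq_or_lt_of_le (hmax q hqK hqA.1 hqA.2) with rfl | hlt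
        -- For the last point `q` of `[α, β)`, its image is the last point of the deleted block, so
        -- a chosen point after it lies outside that block.
        · obtain ⟨v, hv, g4, g5⟩ := hR _ g3 hqd
          refine ⟨v, Finset.mem_insert_of_mem ((hmem₀ v).2 ⟨hv, ?_⟩), by omega, g5⟩
          rintro ⟨g6, g7⟩
          obtain ⟨a, ha, g8, g9, g10⟩ := hb.surj v (hSK hv) g6 g7
          have := hs.mono _ ha _ hqK (hmax a ha g8 g9)
          omega
        · exact ⟨z, Finset.mem_insert_self _ _, hlt, by omega⟩
      · by_cases hfq : f q = β
        · rw [hjump q hqK (by omega) (by omega), hfq] at hqd ⊢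
          have := hb.le_map
          refine ⟨z, Finset.mem_insert_self _ _, ?_, by omega⟩
          have h3 := hs.lt q hqK
          have h4 := (mem_outside.1 hq).2
          omega
        · obtain ⟨v, hv, h4⟩ := hrest q hq hqA hfq hqd
          exact ⟨v, Finset.mem_insert_of_mem hv, h4⟩
    · intro x
      obtain ⟨v, hv, h4⟩ := hT x
      by_cases hvB : β ≤ v ∧ v < γ
      · exact ⟨z, Finset.mem_insert_self _ _, hO x v z (by omega) (by omega) hm.2.1 (by omega) h4⟩
      · exact ⟨v, Finset.mem_insert_of_mem ((hmem₀ v).2 ⟨hv, hvB⟩), h4⟩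
  · -- at most one point in `[β, γ)`
    have huniq : ∀ b ∈ B, ∀ b' ∈ B, b = b' := fun b hb b' hb' =>
      Finset.card_le_one.1 (by omega) b hb b' hb'
    by_cases hA : ∃ a ∈ S, α ≤ a ∧ a < β
    · have hne : (S.filter fun v => α ≤ v ∧ v < β).Nonempty := by
        obtain ⟨a, ha, g1, g2⟩ := hA
        exact ⟨a, Finset.mem_filter.2 ⟨ha, g1, g2⟩⟩
      have hm := Finset.max'_mem _ hne
      set a := (S.filter fun v => α ≤ v ∧ v < β).max' hne with ha
      rw [Finset.mem_filter] at hm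
      have hmax : ∀ v ∈ S, α ≤ v → v < β → v ≤ a := fun v hv g1 g2 =>
        Finset.le_max' _ _ (Finset.mem_filter.2 ⟨hv, g1, g2⟩)
      have haK := hSK hm.1
      have ha0 : a ∈ S₀ := (hmem₀ a).2 ⟨hm.1, by omega⟩
      obtain ⟨k1, k2, k3⟩ := himg a haK hm.2.1 hm.2.2
      obtain ⟨b, hbS, k4, k5⟩ := hR a haK (by omega)
      have hbβ : β ≤ b := by
        by_contra hcon
        have := hmax b hbS (by omega) (by omega)
        omega
      have hbB : b ∈ B := (hmemB b).2 ⟨hbS, hbβ, by omega⟩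
      refine ⟨S₀, hS₀K, h00, ?_, ?_, ?_⟩
      · have := Finset.card_pos.2 ⟨b, hbB⟩
        omega
      · intro q hq hqd
        have hqK := (mem_outside.1 hq).1
        by_cases hqA : α ≤ q ∧ q < β
        · obtain ⟨g1, g2, g3⟩ := himg q hqK hqA.1 hqA.2
          rw [hjump q hqK g1 g2] at hqd ⊢
          have := hs.lt _ g3
          by_cases hqa : q < a
          · exact ⟨a, ha0, hqa, by omega⟩
          -- From `b ≤ f a ≤ f q` follows `f b ≤ f (f q)`. The chosen point in `(b, f b]` is outside
          -- the block, as `b` is the only chosen point there.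
          · have l1 := hs.mono a haK q hqK (by omega)
            have l2 := hs.mono b (hSK hbS) _ g3 (by omega)
            obtain ⟨v, hv, g4, g5⟩ := hR b (hSK hbS) (by omega)
            refine ⟨v, (hmem₀ v).2 ⟨hv, fun hvB => ?_⟩, by omega, by omega⟩
            have := huniq b hbB v ((hmemB v).2 ⟨hv, hvB⟩)
            omega
        · by_cases hfq : f q = β
          · rw [hjump q hqK (by omega) (by omega), hfq] at hqd ⊢
            have := hb.le_map
            refine ⟨a, ha0, ?_, by omega⟩
            have h3 := hs.lt q hqK
            have h4 := (mem_outside.1 hq).2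
            omega
          · exact hrest q hq hqA hfq hqd
      · intro x
        obtain ⟨v, hv, h4⟩ := hT x
        by_cases hvB : β ≤ v ∧ v < γ
        · exact ⟨a, ha0, hO x v a (by omega) (by omega) hm.2.1 (by omega) h4⟩
        · exact ⟨v, (hmem₀ v).2 ⟨hv, hvB⟩, h4⟩
    · -- then the only point in `[β, γ)` is `β`
      push Not at hA
      obtain ⟨b, hbS, k4, k5⟩ := hR α hb.mem (by omega)
      rw [hfα] at k5
      have hbβ : b = β := by
        have := hA b hbS (by omega)
        omega
      subst hbβ
      have hbB : b ∈ B := (hmemB b).2 ⟨hbS, le_rfl, hβγ⟩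
      have hnext : f b ≤ d → ∃ v ∈ S₀, γ ≤ v ∧ v ≤ f b := fun hd => by
        obtain ⟨v, hv, g4, g5⟩ := hR b hb.mem_right hd
        have hvB : ¬ (b ≤ v ∧ v < γ) := fun hvB => by
          have := huniq b hbB v ((hmemB v).2 ⟨hv, hvB⟩)
          omega
        exact ⟨v, (hmem₀ v).2 ⟨hv, hvB⟩, by omega, g5⟩
      refine ⟨S₀, hS₀K, h00, ?_, ?_, ?_⟩
      · have := Finset.card_pos.2 ⟨b, hbB⟩
        omega
      · intro q hq hqd
        have hqK := (mem_outside.1 hq).1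
        by_cases hqA : α ≤ q ∧ q < b
        · obtain ⟨g1, g2, g3⟩ := himg q hqK hqA.1 hqA.2
          rw [hjump q hqK g1 g2] at hqd ⊢
          have := hs.mono b hb.mem_right _ g3 g1
          obtain ⟨v, hv, g4, g5⟩ := hnext (by omega)
          exact ⟨v, hv, by omega, by omega⟩
        · by_cases hfq : f q = b
          · rw [hjump q hqK (by omega) (by omega), hfq] at hqd ⊢
            obtain ⟨v, hv, g4, g5⟩ := hnext hqd
            refine ⟨v, hv, ?_, g5⟩
            have h3 := hs.lt q hqK
            omega
          · exact hrest q hq hqA hfq hqd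
      · intro x
        obtain ⟨v, hv, h4⟩ := hT x
        by_cases hvB : b ≤ v ∧ v < γ
        -- The side constraint also holds at `f β`, and `hOd` then gives `f β ≤ d`. So the
        -- constraint of `β` is active and supplies a chosen point between the block and `f β`.
        · have hOb := hO x v (f b) (by omega) (by omega) (by omega) le_rfl h4
          obtain ⟨u, hu, g4, g5⟩ := hnext (hOd x _ hOb)
          exact ⟨u, hu, hO x v u (by omega) (by omega) (by omega) g5 h4⟩
        · exact ⟨v, (hmem₀ v).2 ⟨hv, hvB⟩, h4⟩

theorem CopiedBlock.pierced_outside_iff (hs : PointSystem d K f) (hb : CopiedBlock K f α β γ)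
    (hγ : γ ≤ d + 1) (hO : ∀ x u v, α ≤ u → u ≤ f β → α ≤ v → v ≤ f β → O x u → O x v)
    (hOd : ∀ x v, O x v → v ≤ d) {N : ℤ} :
    Pierced d (outside K β γ) (NValueKernel.jumpOver f β γ) O (N - 1) ↔ Pierced d K f O N :=
  ⟨hb.pierced_of_outside hs hγ, hb.pierced_outside hs hγ hO hOd⟩

end Deletion

/-! ### Greedy blocks -/

/-- `nx` maps every point up to `d` to a later one, monotonically; `d + 1` means that there is none. -/
structure IsJump (d : ℕ) (nx : ℕ → ℕ) : Prop where
  lt : ∀ q ≤ d, q < nx q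
  le : ∀ q ≤ d, nx q ≤ d + 1
  top : nx (d + 1) = d + 1
  mono : ∀ q q', q ≤ q' → q' ≤ d → nx q ≤ nx q'

/-- The points that are reached from `0` and the seeds. -/
inductive Reach (nx : ℕ → ℕ) (seed : ℕ → Prop) : ℕ → Prop
  | zero : Reach nx seed 0
  | seed {v : ℕ} : seed v → Reach nx seed v
  | step {v : ℕ} : Reach nx seed v → Reach nx seed (nx v)

/-- The first point of block `i`: the `i`-th point of the greedy orbit of `0`. -/
def pt (nx : ℕ → ℕ) (i : ℕ) : ℕ := nx^[i] 0

/-- The number of the block that contains `v`. -/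
def blk (nx : ℕ → ℕ) : ℕ → ℕ
  | 0 => 0
  | v + 1 => if pt nx (blk nx v + 1) ≤ v + 1 then blk nx v + 1 else blk nx v

open Classical in
/-- The number of elements of block `i` among `0, …, d` with the property `A`. -/
noncomputable def blockCount (d : ℕ) (nx : ℕ → ℕ) (A : ℕ → Prop) (i : ℕ) : ℕ :=
  ((Finset.range (d + 1)).filter fun v => A v ∧ blk nx v = i).card

/-- Block `i` is a copy of the preceding one: neither contains a seed, and they have equally many
reached points. -/
def Removable (d : ℕ) (nx : ℕ → ℕ) (seed : ℕ → Prop) (i : ℕ) : Prop :=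
  1 ≤ i ∧ i ≤ blk nx d ∧ blockCount d nx seed (i - 1) = 0 ∧ blockCount d nx seed i = 0 ∧
    blockCount d nx (Reach nx seed) i = blockCount d nx (Reach nx seed) (i - 1)

open Classical in
/-- The first point after `q` in the orbit of `q` that is not `bad`. -/
noncomputable def skipBad (d : ℕ) (nx : ℕ → ℕ) (bad : ℕ → Prop) (q : ℕ) : ℕ :=
  if _h : (q < nx q ∧ nx q ≤ d) ∧ bad (nx q) then skipBad d nx bad (nx q) else nx q
termination_by d + 1 - q

open Classical in
/-- The reached points up to `d` that are not `bad`. -/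
noncomputable def keptPoints (d : ℕ) (nx : ℕ → ℕ) (seed bad : ℕ → Prop) : Finset ℕ :=
  (Finset.range (d + 1)).filter fun v => Reach nx seed v ∧ ¬ bad v

open Classical in
/-- The number of removable blocks with number at least `j`. -/
noncomputable def removedFrom (d : ℕ) (nx : ℕ → ℕ) (seed : ℕ → Prop) (j : ℕ) : ℕ :=
  ((Finset.range (blk nx d + 1)).filter fun i => Removable d nx seed i ∧ j ≤ i).card

/-- `v` lies in a removable block with number at least `j`. -/
def BadFrom (d : ℕ) (nx : ℕ → ℕ) (seed : ℕ → Prop) (j v : ℕ) : Prop :=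
  Removable d nx seed (blk nx v) ∧ j ≤ blk nx v

section Blocks

variable {d : ℕ} {nx : ℕ → ℕ} {seed bad : ℕ → Prop}

theorem mem_keptPoints {v : ℕ} :
    v ∈ keptPoints d nx seed bad ↔ v ≤ d ∧ Reach nx seed v ∧ ¬ bad v := by
  simp [keptPoints]

/-! ### The greedy orbit and block numbers. -/

theorem pt_succ (i : ℕ) : pt nx (i + 1) = nx (pt nx i) := Function.iterate_succ_apply' _ _ _

theorem Reach.pt (i : ℕ) : Reach nx seed (pt nx i) := by
  induction i with
  | zero => exact .zero
  | succ i ih => rw [pt_succ]; exact .step ih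

theorem IsJump.le' (hj : IsJump d nx) {q : ℕ} (hq : q ≤ d + 1) : nx q ≤ d + 1 := by
  rcases Nat.lt_or_ge d q with h | h
  · have : q = d + 1 := by omega
    rw [this, hj.top]
  · exact hj.le q h

theorem IsJump.reach_le (hj : IsJump d nx) (hs : ∀ v, seed v → v ≤ d) {v : ℕ}
    (h : Reach nx seed v) : v ≤ d + 1 := by
  induction h with
  | zero => omega
  | seed h => exact (hs _ h).trans (Nat.le_succ d)
  | step _ ih => exact hj.le' ih

theorem IsJump.pt_le (hj : IsJump d nx) (i : ℕ) : pt nx i ≤ d + 1 := by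
  induction i with
  | zero => exact Nat.zero_le _
  | succ i ih => rw [pt_succ]; exact hj.le' ih

theorem IsJump.pt_lt_succ (hj : IsJump d nx) {i : ℕ} (h : pt nx i ≤ d) : pt nx i < pt nx (i + 1) := by
  rw [pt_succ]; exact hj.lt _ h

theorem IsJump.pt_mono (hj : IsJump d nx) : Monotone (pt nx) := by
  refine monotone_nat_of_le_succ fun i => ?_
  rcases Nat.lt_or_ge d (pt nx i) with h | h
  · have h1 : pt nx i = d + 1 := by have := hj.pt_le i; omega
    rw [pt_succ, h1, hj.top]
  · exact (hj.pt_lt_succ h).le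

/-- The recursion for `blk` advances by at most one block per point. This is enough because orbit
points up to `d` are strictly increasing. -/
theorem IsJump.le_blk_iff (hj : IsJump d nx) {v : ℕ} (hv : v ≤ d) (i : ℕ) :
    i ≤ blk nx v ↔ pt nx i ≤ v := by
  induction v generalizing i with
  | zero =>
    constructor
    · intro h
      have : i = 0 := by simpa [blk] using h
      subst this; exact le_rfl
    · intro h
      rcases Nat.eq_zero_or_pos i with rfl | hi
      · exact Nat.zero_le _
      · have h1 := hj.pt_lt_succ (i := 0) (Nat.zero_le _)
        have h2 := hj.pt_mono (show 0 + 1 ≤ i from hi)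
        omega
  | succ v ih =>
    have ih := ih (by omega)
    have h1 := ih (blk nx v + 1)
    unfold blk
    split_ifs with hc
    · constructor
      · intro h
        exact (hj.pt_mono h).trans hc
      · intro h
        by_contra hcon
        have h2 := hj.pt_lt_succ (hc.trans hv)
        have h3 := hj.pt_mono (show blk nx v + 1 + 1 ≤ i by omega)
        omega
    · constructor
      · intro h
        exact ((ih i).1 h).trans (by omega)
      · intro h
        by_contra hcon
        have := hj.pt_mono (show blk nx v + 1 ≤ i by omega)
        omega

theorem IsJump.blk_eq_iff (hj : IsJump d nx) {v : ℕ} (hv : v ≤ d) (i : ℕ) :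
    blk nx v = i ↔ pt nx i ≤ v ∧ v < pt nx (i + 1) := by
  rw [← not_le, ← hj.le_blk_iff hv, ← hj.le_blk_iff hv]
  omega

theorem IsJump.blk_mono (hj : IsJump d nx) {u v : ℕ} (huv : u ≤ v) (hv : v ≤ d) :
    blk nx u ≤ blk nx v :=
  (hj.le_blk_iff hv _).2 (((hj.le_blk_iff (huv.trans hv) _).1 le_rfl).trans huv)

theorem IsJump.blk_pt (hj : IsJump d nx) {i : ℕ} (h : pt nx i ≤ d) : blk nx (pt nx i) = i :=
  (hj.blk_eq_iff h i).2 ⟨le_rfl, hj.pt_lt_succ h⟩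

theorem IsJump.pt_le_of_le_blk (hj : IsJump d nx) {i : ℕ} (h : i ≤ blk nx d) : pt nx i ≤ d :=
  (hj.le_blk_iff le_rfl i).1 h

/-! ### Jumps that skip bad points. -/

theorem skipBad_of_bad {q : ℕ} (h1 : q < nx q) (h2 : nx q ≤ d) (h3 : bad (nx q)) :
    skipBad d nx bad q = skipBad d nx bad (nx q) := by
  rw [skipBad, dif_pos ⟨⟨h1, h2⟩, h3⟩]

theorem skipBad_of_not_bad {q : ℕ} (h : nx q ≤ d → ¬ bad (nx q)) : skipBad d nx bad q = nx q := by
  rw [skipBad, dif_neg fun hc => h hc.1.2 hc.2]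

theorem le_skipBad (hj : IsJump d nx) {q : ℕ} (hq : q ≤ d) : nx q ≤ skipBad d nx bad q := by
  by_cases h : nx q ≤ d ∧ bad (nx q)
  · rw [skipBad_of_bad (hj.lt q hq) h.1 h.2]
    have := hj.lt q hq
    exact (hj.lt _ h.1).le.trans (le_skipBad hj h.1)
  · rw [skipBad_of_not_bad fun h1 h2 => h ⟨h1, h2⟩]
termination_by d + 1 - q

theorem skipBad_le (hj : IsJump d nx) {q : ℕ} (hq : q ≤ d) : skipBad d nx bad q ≤ d + 1 := by
  by_cases h : nx q ≤ d ∧ bad (nx q)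
  · rw [skipBad_of_bad (hj.lt q hq) h.1 h.2]
    have := hj.lt q hq
    exact skipBad_le hj h.1
  · rw [skipBad_of_not_bad fun h1 h2 => h ⟨h1, h2⟩]
    exact hj.le q hq
termination_by d + 1 - q

/-- From the start of a block, only whole bad blocks are skipped. -/
theorem bad_of_lt_skipBad_pt (hj : IsJump d nx)
    (hbad : ∀ u v, u ≤ d → v ≤ d → blk nx u = blk nx v → bad u → bad v) {i : ℕ} (hi : pt nx i ≤ d)
    {v : ℕ} (h1 : pt nx (i + 1) ≤ v) (h2 : v < skipBad d nx bad (pt nx i)) : bad v := by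
  by_cases hb : nx (pt nx i) ≤ d ∧ bad (nx (pt nx i))
  · have hlt := hj.pt_lt_succ hi
    have hle := skipBad_le (bad := bad) hj hi
    rw [skipBad_of_bad (hj.lt _ hi) hb.1 hb.2, ← pt_succ (nx := nx)] at h2
    rw [← pt_succ (nx := nx)] at hb
    by_cases h3 : v < pt nx (i + 1 + 1)
    · have hv : v ≤ d := by have := hj.pt_le (i + 1 + 1); omega
      exact hbad _ _ hb.1 hv ((hj.blk_pt hb.1).trans ((hj.blk_eq_iff hv _).2 ⟨h1, h3⟩).symm) hb.2
    · exact bad_of_lt_skipBad_pt hj hbad hb.1 (by omega) h2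
  · rw [skipBad_of_not_bad fun h1 h2 => hb ⟨h1, h2⟩, ← pt_succ (nx := nx)] at h2
    omega
termination_by d + 1 - pt nx i

/-! ### Reached points of consecutive blocks. -/

/-- The reached points of a block are images of reached points of the preceding block, or seeds. -/
theorem IsJump.reach_block (hj : IsJump d nx) (hs : ∀ v, seed v → v ≤ d) {i b : ℕ}
    (hb : b ≤ d) (hr : Reach nx seed b) (hi : blk nx b = i + 1) :
    seed b ∨ ∃ a ≤ d, Reach nx seed a ∧ blk nx a = i ∧ nx a = b := by
  obtain ⟨h1, h2⟩ := (hj.blk_eq_iff hb _).1 hi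
  have hpi : pt nx i ≤ d := (hj.pt_mono (Nat.le_succ i)).trans (h1.trans hb)
  cases hr with
  | zero => simp [blk] at hi
  | seed h => exact Or.inl h
  | @step v h =>
    right
    have hvd : v ≤ d := by
      by_contra hcon
      have := hj.reach_le hs h
      have hv : v = d + 1 := by omega
      rw [hv, hj.top] at hb
      omega
    by_cases h3 : pt nx i ≤ v
    · refine ⟨v, hvd, h, (hj.blk_eq_iff hvd _).2 ⟨h3, ?_⟩, rfl⟩
      by_contra hcon
      have h4 := hj.mono _ _ (not_lt.1 hcon) hvd
      rw [← pt_succ (nx := nx)] at h4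
      omega
    -- A preimage before block `i` is mapped to at most `pt nx (i + 1)`, so `b` is the first point
    -- of its block, and `pt nx i` is a preimage in the right block.
    · have h4 := hj.mono v (pt nx i) (by omega) hpi
      rw [← pt_succ (nx := nx)] at h4
      exact ⟨pt nx i, hpi, .pt i, hj.blk_pt hpi, by rw [← pt_succ (nx := nx)]; omega⟩

theorem blockCount_eq_zero {A : ℕ → Prop} {i : ℕ} :
    blockCount d nx A i = 0 ↔ ∀ v ≤ d, A v → blk nx v ≠ i := by
  classical
  simp [blockCount, Finset.filter_eq_empty_iff]

/-- The reached points of the next block that are not seeds are covered by the image of this block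
under `nx`, and an image is no larger than its source. -/
theorem IsJump.blockCount_succ_le (hj : IsJump d nx) (hs : ∀ v, seed v → v ≤ d) (i : ℕ) :
    blockCount d nx (Reach nx seed) (i + 1) ≤
      blockCount d nx (Reach nx seed) i + blockCount d nx seed (i + 1) := by
  classical
  unfold blockCount
  refine le_trans (Finset.card_le_card (t := ((Finset.range (d + 1)).filter fun v =>
    Reach nx seed v ∧ blk nx v = i).image nx ∪ (Finset.range (d + 1)).filter fun v =>
      seed v ∧ blk nx v = i + 1) ?_) ((Finset.card_union_le _ _).trans
      (Nat.add_le_add_right Finset.card_image_le _))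
  intro b hb
  simp only [Finset.mem_filter, Finset.mem_range, Nat.lt_succ_iff, Finset.mem_union,
    Finset.mem_image] at hb ⊢
  rcases hj.reach_block hs hb.1 hb.2.1 hb.2.2 with h | ⟨a, h1, h2, h3, h4⟩
  · exact Or.inr ⟨hb.1, h, hb.2.2⟩
  · exact Or.inl ⟨a, ⟨h1, h2, h3⟩, h4⟩

/-- The points of a block are mapped exactly onto those of a removable successor. -/
theorem Removable.image_eq (hj : IsJump d nx) (hs : ∀ v, seed v → v ≤ d) {i : ℕ}
    (h : Removable d nx seed (i + 1)) :
    (∀ a ≤ d, Reach nx seed a → blk nx a = i → nx a ≤ d ∧ blk nx (nx a) = i + 1) ∧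
      ∀ b ≤ d, Reach nx seed b → blk nx b = i + 1 →
        ∃ a ≤ d, Reach nx seed a ∧ blk nx a = i ∧ nx a = b := by
  classical
  obtain ⟨-, -, -, h0, hc⟩ := h
  have hsurj : ∀ b ≤ d, Reach nx seed b → blk nx b = i + 1 →
        ∃ a ≤ d, Reach nx seed a ∧ blk nx a = i ∧ nx a = b := fun b hb hr hbi =>
    (hj.reach_block hs hb hr hbi).resolve_left fun hsd => blockCount_eq_zero.1 h0 b hb hsd hbi
  refine ⟨fun a ha hr hai => ?_, hsurj⟩
  rw [Nat.add_sub_cancel] at hc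
  unfold blockCount at hc
  have hsub : ((Finset.range (d + 1)).filter fun v => Reach nx seed v ∧ blk nx v = i + 1) ⊆
      ((Finset.range (d + 1)).filter fun v => Reach nx seed v ∧ blk nx v = i).image nx := by
    intro b hb
    simp only [Finset.mem_filter, Finset.mem_range, Nat.lt_succ_iff, Finset.mem_image] at hb ⊢
    obtain ⟨a, h1, h2, h3, h4⟩ := hsurj b hb.1 hb.2.1 hb.2.2
    exact ⟨a, ⟨h1, h2, h3⟩, h4⟩
  -- The reached points of the later block lie in the image of the earlier block. Equal counts force
  -- equality, so no image leaves the later block.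
  have heq := Finset.eq_of_subset_of_card_le hsub (Finset.card_image_le.trans hc.ge)
  have : nx a ∈ (Finset.range (d + 1)).filter fun v => Reach nx seed v ∧ blk nx v = i + 1 := by
    rw [heq]
    exact Finset.mem_image_of_mem _ (Finset.mem_filter.2 ⟨Finset.mem_range.2 (by omega), hr, hai⟩)
  rw [Finset.mem_filter, Finset.mem_range] at this
  exact ⟨by omega, this.2.2⟩

/-! ### Deleting the removable blocks one by one. -/

theorem IsJump.badFrom_congr (u v : ℕ) (h : blk nx u = blk nx v) (j : ℕ)
    (hb : BadFrom d nx seed j u) : BadFrom d nx seed j v := by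
  unfold BadFrom at *; rwa [← h]

/-- Bad blocks after `j` are skipped on both sides alike, by recursion along the orbit. If a jump
lands in block `j`, the next one leaves that block, so it is applied exactly twice. -/
theorem IsJump.skipBad_badFrom (hj : IsJump d nx) {j : ℕ} (hrem : Removable d nx seed j) {q : ℕ}
    (hq : q ≤ d) :
    skipBad d nx (BadFrom d nx seed j) q =
      jumpOver (skipBad d nx (BadFrom d nx seed (j + 1))) (pt nx j) (pt nx (j + 1)) q := by
  have hlt := hj.lt q hq
  have hpj : pt nx j ≤ d := hj.pt_le_of_le_blk hrem.2.1
  -- beyond the start of block `j`, the successor is beyond the block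
  have hbey : ∀ b ≤ d, pt nx j ≤ b → pt nx (j + 1) ≤ skipBad d nx (BadFrom d nx seed (j + 1)) b := by
    intro b hb h1
    have h2 := hj.mono _ _ h1 hb
    rw [← pt_succ (nx := nx)] at h2
    exact h2.trans (le_skipBad hj hb)
  by_cases h1 : nx q ≤ d ∧ BadFrom d nx seed (j + 1) (nx q)
  · have h2 : BadFrom d nx seed j (nx q) := ⟨h1.2.1, by have := h1.2.2; omega⟩
    rw [skipBad_of_bad hlt h1.1 h2, IsJump.skipBad_badFrom hj hrem h1.1]
    unfold jumpOver
    rw [skipBad_of_bad hlt h1.1 h1.2]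
  · have h3 : skipBad d nx (BadFrom d nx seed (j + 1)) q = nx q :=
      skipBad_of_not_bad fun h2 h3 => h1 ⟨h2, h3⟩
    by_cases h4 : nx q ≤ d ∧ blk nx (nx q) = j
    · have h5 : BadFrom d nx seed j (nx q) := by unfold BadFrom; rw [h4.2]; exact ⟨hrem, le_rfl⟩
      have h6 := (hj.blk_eq_iff h4.1 j).1 h4.2
      rw [skipBad_of_bad hlt h4.1 h5, IsJump.skipBad_badFrom hj hrem h4.1]
      unfold jumpOver
      rw [h3, if_pos h6, if_neg]
      have := hbey (nx q) h4.1 h6.1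
      omega
    · have h5 : nx q ≤ d → ¬ BadFrom d nx seed j (nx q) := fun h5 h6 => by
        unfold BadFrom at h1 h6
        rcases eq_or_lt_of_le h6.2 with h7 | h7
        · exact h4 ⟨h5, h7.symm⟩
        · exact h1 ⟨h5, h6.1, h7⟩
      rw [skipBad_of_not_bad h5]
      unfold jumpOver
      rw [h3, if_neg]
      rintro ⟨h6, h7⟩
      have : nx q ≤ d := by have := hj.pt_le (j + 1); omega
      exact h4 ⟨this, (hj.blk_eq_iff this _).2 ⟨h6, h7⟩⟩
termination_by d + 1 - q

theorem IsJump.keptPoints_badFrom (hj : IsJump d nx) {j : ℕ} (hrem : Removable d nx seed j) :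
    keptPoints d nx seed (BadFrom d nx seed j) =
      outside (keptPoints d nx seed (BadFrom d nx seed (j + 1))) (pt nx j) (pt nx (j + 1)) := by
  ext v
  rw [mem_outside, mem_keptPoints, mem_keptPoints, and_assoc, and_congr_right_iff]
  intro hv
  rw [and_assoc, and_congr_right_iff]
  intro _
  rw [← hj.blk_eq_iff hv]
  unfold BadFrom
  constructor
  · intro h
    exact ⟨fun h1 => h ⟨h1.1, by omega⟩, fun h1 => h (by rw [h1]; exact ⟨hrem, le_rfl⟩)⟩
  · rintro ⟨h1, h2⟩ ⟨h3, h4⟩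
    exact h1 ⟨h3, by omega⟩

theorem not_removable_badFrom {j : ℕ} (hrem : ¬ Removable d nx seed j) :
    BadFrom d nx seed j = BadFrom d nx seed (j + 1) := by
  ext v
  unfold BadFrom
  constructor
  · rintro ⟨h1, h2⟩
    refine ⟨h1, ?_⟩
    rcases eq_or_lt_of_le h2 with h | h
    · exact absurd (h ▸ h1) hrem
    · exact h
  · rintro ⟨h1, h2⟩
    exact ⟨h1, by omega⟩

/-- Jumps from block `i` land in block `i + 1`, which has not been deleted yet. So they are still
given by `nx`, and the correspondence of `Removable.image_eq` survives the deletion of later blocks.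
-/
theorem IsJump.copiedBlock (hj : IsJump d nx) (hs : ∀ v, seed v → v ≤ d) {i : ℕ}
    (hrem : Removable d nx seed (i + 1)) :
    CopiedBlock (keptPoints d nx seed (BadFrom d nx seed (i + 1 + 1)))
      (skipBad d nx (BadFrom d nx seed (i + 1 + 1))) (pt nx i) (pt nx (i + 1)) (pt nx (i + 1 + 1)) := by
  have hp1 : pt nx (i + 1) ≤ d := hj.pt_le_of_le_blk hrem.2.1
  have hp0 : pt nx i ≤ d := (hj.pt_mono (Nat.le_succ i)).trans hp1
  obtain ⟨him, hsurj⟩ := hrem.image_eq hj hs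
  have hkeep : ∀ v ≤ d, Reach nx seed v → blk nx v ≤ i + 1 →
      v ∈ keptPoints d nx seed (BadFrom d nx seed (i + 1 + 1)) := fun v hv hr hb =>
    mem_keptPoints.2 ⟨hv, hr, fun h => by have := h.2; omega⟩
  have hskip : ∀ a ≤ d, Reach nx seed a → blk nx a = i →
      skipBad d nx (BadFrom d nx seed (i + 1 + 1)) a = nx a := fun a ha hr hai =>
    skipBad_of_not_bad fun _ h => by have := h.2; have := (him a ha hr hai).2; omega
  refine ⟨hj.pt_lt_succ hp0, hkeep _ hp0 (.pt i) ?_, ?_, ?_, hkeep _ hp1 (.pt _) ?_,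
    hj.pt_lt_succ hp1, ?_, ?_⟩
  · rw [hj.blk_pt hp0]; omega
  · rw [hskip _ hp0 (.pt i) (hj.blk_pt hp0), pt_succ]
  · rw [pt_succ (i + 1)]; exact le_skipBad hj hp1
  · rw [hj.blk_pt hp1]
  · intro a ha h1 h2
    rw [mem_keptPoints] at ha
    have hai := (hj.blk_eq_iff ha.1 i).2 ⟨h1, h2⟩
    have h3 := him a ha.1 ha.2.1 hai
    rw [hskip a ha.1 ha.2.1 hai]
    exact ((hj.blk_eq_iff h3.1 _).1 h3.2).2
  · intro b hb h1 h2
    rw [mem_keptPoints] at hb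
    obtain ⟨a, h3, h4, h5, h6⟩ := hsurj b hb.1 hb.2.1 ((hj.blk_eq_iff hb.1 _).2 ⟨h1, h2⟩)
    have h7 := (hj.blk_eq_iff h3 i).1 h5
    exact ⟨a, hkeep a h3 h4 (by omega), h7.1, h7.2, by rw [hskip a h3 h4 h5, h6]⟩

/-- Descending induction on `j`: beyond the last block nothing is deleted and the axioms are those
of `IsJump`; each removable block is one application of `PointSystem.jumpOver`. -/
theorem IsJump.pointSystem (hj : IsJump d nx) (hs : ∀ v, seed v → v ≤ d) (j : ℕ) :
    PointSystem d (keptPoints d nx seed (BadFrom d nx seed j))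
      (skipBad d nx (BadFrom d nx seed j)) := by
  by_cases hjd : blk nx d < j
  · have hno : ∀ v ≤ d, ¬ BadFrom d nx seed j v := fun v hv h => by
      have := hj.blk_mono hv le_rfl
      have := h.2
      omega
    have hsk : ∀ q, skipBad d nx (BadFrom d nx seed j) q = nx q := fun q =>
      skipBad_of_not_bad fun h => hno _ h
    refine ⟨mem_keptPoints.2 ⟨Nat.zero_le _, .zero, hno 0 (Nat.zero_le _)⟩,
      fun q hq => (mem_keptPoints.1 hq).1, fun q hq => ?_, fun q hq h => ?_,
      fun q hq q' hq' h => ?_⟩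
    · rw [hsk]; exact hj.lt q (mem_keptPoints.1 hq).1
    · rw [hsk] at h ⊢
      exact mem_keptPoints.2 ⟨h, (mem_keptPoints.1 hq).2.1.step, hno _ h⟩
    · rw [hsk, hsk]
      exact hj.mono _ _ h (mem_keptPoints.1 hq').1
  · by_cases hrem : Removable d nx seed j
    · obtain ⟨i, rfl⟩ : ∃ i, j = i + 1 := ⟨j - 1, by have := hrem.1; omega⟩
      have ih := IsJump.pointSystem hj hs (i + 1 + 1)
      have := ih.jumpOver (hj.copiedBlock hs hrem) (hj.pt_le _)
      rw [← hj.keptPoints_badFrom hrem] at this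
      have heq : ∀ q ≤ d, skipBad d nx (BadFrom d nx seed (i + 1)) q = _ := fun q hq =>
        hj.skipBad_badFrom hrem hq
      refine ⟨this.zero_mem, this.le, fun q hq => ?_, fun q hq h => ?_, fun q hq q' hq' h => ?_⟩
      · rw [heq q (this.le q hq)]; exact this.lt q hq
      · rw [heq q (this.le q hq)] at h ⊢; exact this.mem q hq h
      · rw [heq q (this.le q hq), heq q' (this.le q' hq')]; exact this.mono q hq q' hq' h
    · rw [not_removable_badFrom hrem]
      exact IsJump.pointSystem hj hs (j + 1)
termination_by blk nx d + 1 - j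

theorem Pierced.congr {ι : Type} {K : Finset ℕ} {f g : ℕ → ℕ} {O : ι → ℕ → Prop} {N : ℤ}
    (h : ∀ q ∈ K, f q = g q) (hp : Pierced d K f O N) : Pierced d K g O N := by
  obtain ⟨S, h1, h2, h3, h4, h5⟩ := hp
  refine ⟨S, h1, h2, h3, fun q hq hd => ?_, h5⟩
  rw [← h q hq] at hd ⊢
  exact h4 q hq hd

theorem removedFrom_of_not {j : ℕ} (hrem : ¬ Removable d nx seed j) :
    removedFrom d nx seed j = removedFrom d nx seed (j + 1) := by
  classical
  unfold removedFrom
  congr 1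
  refine Finset.filter_congr fun i _ => ⟨fun h => ⟨h.1, ?_⟩, fun h => ⟨h.1, by omega⟩⟩
  rcases eq_or_lt_of_le h.2 with h1 | h1
  · exact absurd (h1 ▸ h.1) hrem
  · exact h1

theorem removedFrom_of_removable {j : ℕ} (hrem : Removable d nx seed j) :
    removedFrom d nx seed j = removedFrom d nx seed (j + 1) + 1 := by
  classical
  unfold removedFrom
  rw [← Finset.card_insert_of_notMem (a := j) (by simp)]
  congr 1
  ext i
  simp only [Finset.mem_filter, Finset.mem_range, Finset.mem_insert]
  constructor
  · rintro ⟨h1, h2, h3⟩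
    by_cases h : i = j
    · exact Or.inl h
    · exact Or.inr ⟨h1, h2, by omega⟩
  · rintro (rfl | ⟨h1, h2, h3⟩)
    · exact ⟨by have := hrem.2.1; omega, hrem, le_rfl⟩
    · exact ⟨h1, h2, by omega⟩

/-- Removing all removable blocks preserves solvability, if `O` changes only after seeds. -/
theorem IsJump.pierced_badFrom (hj : IsJump d nx) (hs : ∀ v, seed v → v ≤ d) {ι : Type}
    {O : ι → ℕ → Prop} (hO : ∀ x v, ¬ seed v → (O x v ↔ O x (v + 1))) (hOd : ∀ x v, O x v → v ≤ d)
    (N : ℤ) (j : ℕ) :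
    Pierced d (keptPoints d nx seed (BadFrom d nx seed j))
      (skipBad d nx (BadFrom d nx seed j)) O (N - removedFrom d nx seed j) ↔
    Pierced d (keptPoints d nx seed fun _ => False) nx O N := by
  by_cases hjd : blk nx d < j
  · have hno : ∀ v ≤ d, ¬ BadFrom d nx seed j v := fun v hv h => by
      have := hj.blk_mono hv le_rfl
      have := h.2
      omega
    have hsk : ∀ q, skipBad d nx (BadFrom d nx seed j) q = nx q := fun q =>
      skipBad_of_not_bad fun h => hno _ h
    have hK : keptPoints d nx seed (BadFrom d nx seed j) = keptPoints d nx seed fun _ => False := by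
      ext v
      rw [mem_keptPoints, mem_keptPoints]
      exact ⟨fun h => ⟨h.1, h.2.1, id⟩, fun h => ⟨h.1, h.2.1, hno v h.1⟩⟩
    have hR : removedFrom d nx seed j = 0 := by
      classical
      unfold removedFrom
      rw [Finset.card_eq_zero, Finset.filter_eq_empty_iff]
      intro i hi h
      rw [Finset.mem_range] at hi
      omega
    rw [hK, hR, Nat.cast_zero, sub_zero]
    exact ⟨Pierced.congr fun q _ => hsk q, Pierced.congr fun q _ => (hsk q).symm⟩
  · by_cases hrem : Removable d nx seed j
    · obtain ⟨i, rfl⟩ : ∃ i, j = i + 1 := ⟨j - 1, by have := hrem.1; omega⟩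
      have ih := IsJump.pierced_badFrom hj hs hO hOd N (i + 1 + 1)
      have hcb := hj.copiedBlock hs hrem
      have hps := hj.pointSystem hs (i + 1 + 1)
      have hp1 : pt nx (i + 1) ≤ d := hj.pt_le_of_le_blk hrem.2.1
      -- no seeds from the start of block `i` up to the successor of `pt (i + 1)`
      have hnoseed : ∀ v, pt nx i ≤ v →
          v < skipBad d nx (BadFrom d nx seed (i + 1 + 1)) (pt nx (i + 1)) → ¬ seed v := by
        intro v h1 h2 hsd
        have hv := hs v hsd
        by_cases h3 : pt nx (i + 1 + 1) ≤ v
        · have hb := bad_of_lt_skipBad_pt hj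
            (fun u v _ _ h => IsJump.badFrom_congr u v h (i + 1 + 1)) hp1 h3 h2
          exact blockCount_eq_zero.1 hb.1.2.2.2.1 v hv hsd rfl
        · by_cases h4 : pt nx (i + 1) ≤ v
          · exact blockCount_eq_zero.1 hrem.2.2.2.1 v hv hsd ((hj.blk_eq_iff hv _).2 ⟨h4, by omega⟩)
          · exact blockCount_eq_zero.1 hrem.2.2.1 v hv hsd ((hj.blk_eq_iff hv _).2 ⟨h1, by
              rw [Nat.add_sub_cancel]; omega⟩)
      -- Side constraints change only after seeds, so they are constant on the seed-free stretch
      -- from the preceding block to the jump of `pt nx (i + 1)`. This is the hypothesis of the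
      -- exchange argument.
      have hconst : ∀ x v, pt nx i ≤ v →
          v ≤ skipBad d nx (BadFrom d nx seed (i + 1 + 1)) (pt nx (i + 1)) →
          (O x (pt nx i) ↔ O x v) := by
        intro x v h1
        induction v, h1 using Nat.le_induction with
        | base => exact fun _ => Iff.rfl
        | succ v h1 ihv =>
          exact fun h2 => (ihv (by omega)).trans (hO x v (hnoseed v h1 (by omega)))
      have hdel := hcb.pierced_outside_iff hps (hj.pt_le _) (O := O)
        (fun x u v h1 h2 h3 h4 h5 => (hconst x v h3 h4).1 ((hconst x u h1 h2).2 h5)) hOd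
        (N := N - removedFrom d nx seed (i + 1 + 1))
      rw [← ih, ← hdel, ← hj.keptPoints_badFrom hrem, removedFrom_of_removable hrem]
      push_cast
      rw [sub_sub]
      have heq : ∀ q ∈ keptPoints d nx seed (BadFrom d nx seed (i + 1)),
          skipBad d nx (BadFrom d nx seed (i + 1)) q = _ := fun q hq =>
        hj.skipBad_badFrom hrem (mem_keptPoints.1 hq).1
      exact ⟨Pierced.congr heq, Pierced.congr fun q hq => (heq q hq).symm⟩
    · rw [not_removable_badFrom hrem, removedFrom_of_not hrem]
      exact IsJump.pierced_badFrom hj hs hO hOd N (j + 1)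
termination_by blk nx d + 1 - j

end Blocks

/-! ### The number of kept points -/

/-- `v` lies in a removable block. -/
def InRemovable (d : ℕ) (nx : ℕ → ℕ) (seed : ℕ → Prop) (v : ℕ) : Prop :=
  Removable d nx seed (blk nx v)

section Size

variable {d : ℕ} {nx : ℕ → ℕ} {seed : ℕ → Prop}

theorem badFrom_zero : BadFrom d nx seed 0 = InRemovable d nx seed := by
  ext v; simp [BadFrom, InRemovable]

open Classical in
/-- The number of seeds up to `d`. -/
noncomputable def seedCount (d : ℕ) (seed : ℕ → Prop) : ℕ :=
  ((Finset.range (d + 1)).filter seed).card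

theorem IsJump.sum_blockCount (hj : IsJump d nx) (A : ℕ → Prop) :
    ∑ i ∈ Finset.range (blk nx d + 1), blockCount d nx A i = seedCount d A := by
  classical
  unfold seedCount blockCount
  rw [Finset.card_eq_sum_card_fiberwise (f := blk nx) (t := Finset.range (blk nx d + 1))]
  · simp only [Finset.filter_filter]
  · intro v hv
    simp only [Finset.coe_filter, Finset.mem_range, Set.mem_ofPred_eq, Finset.coe_range,
      Set.mem_Iio] at hv ⊢
    have := hj.blk_mono (show v ≤ d by omega) le_rfl
    omega

theorem IsJump.reach_block_zero (hj : IsJump d nx) (hs : ∀ v, seed v → v ≤ d) {b : ℕ}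
    (hb : b ≤ d) (hr : Reach nx seed b) (hi : blk nx b = 0) : b = 0 ∨ seed b := by
  cases hr with
  | zero => exact Or.inl rfl
  | seed h => exact Or.inr h
  | @step v h =>
    exfalso
    have hvd : v ≤ d := by
      by_contra hcon
      have := hj.reach_le hs h
      have hv : v = d + 1 := by omega
      rw [hv, hj.top] at hb
      omega
    have h1 := (hj.le_blk_iff hb 1).2 (by
      have := hj.mono 0 v (Nat.zero_le _) hvd
      exact this)
    omega

theorem IsJump.blockCount_zero_le (hj : IsJump d nx) (hs : ∀ v, seed v → v ≤ d) :
    blockCount d nx (Reach nx seed) 0 ≤ blockCount d nx seed 0 + 1 := by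
  classical
  unfold blockCount
  refine le_trans (Finset.card_le_card ?_) (Finset.card_insert_le 0 _)
  intro b hb
  simp only [Finset.mem_filter, Finset.mem_range, Finset.mem_insert] at hb ⊢
  rcases hj.reach_block_zero hs (by omega) hb.2.1 hb.2.2 with h | h
  · exact Or.inl h
  · exact Or.inr ⟨hb.1, h, hb.2.2⟩

theorem IsJump.blockCount_le (hj : IsJump d nx) (hs : ∀ v, seed v → v ≤ d) (i : ℕ) :
    blockCount d nx (Reach nx seed) i ≤
      1 + ∑ j ∈ Finset.range (i + 1), blockCount d nx seed j := by
  induction i with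
  | zero => have := hj.blockCount_zero_le hs; simp; omega
  | succ i ih =>
    rw [Finset.sum_range_succ]
    have := hj.blockCount_succ_le hs i
    omega

-- Potential argument with the number of reached points of the current block as potential. A block
-- that is not removable, with no seed in it or in its predecessor, has a strictly smaller count and
-- pays for itself. Otherwise its seeds and those of its predecessor pay, once for the block, and
-- its own seeds once more for the increase of the count.
open Classical in
theorem IsJump.card_not_removable_add_le (hj : IsJump d nx) (hs : ∀ v, seed v → v ≤ d) (m : ℕ)
    (hm : m ≤ blk nx d) :
    ((Finset.range m).filter fun i => ¬ Removable d nx seed (i + 1)).card +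
        blockCount d nx (Reach nx seed) m ≤
      blockCount d nx (Reach nx seed) 0 +
        ∑ i ∈ Finset.range m, (blockCount d nx seed i + 2 * blockCount d nx seed (i + 1)) := by
  induction m with
  | zero => simp
  | succ m ih =>
    have ih := ih (by omega)
    rw [Finset.sum_range_succ, Finset.range_add_one, Finset.filter_insert]
    have h1 := hj.blockCount_succ_le hs m
    split_ifs with h
    · omega
    · have h2 : blockCount d nx seed m = 0 → blockCount d nx seed (m + 1) = 0 →
          blockCount d nx (Reach nx seed) (m + 1) ≠ blockCount d nx (Reach nx seed) m :=
        fun h2 h3 h4 => h ⟨by omega, hm, h2, h3, h4⟩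
      rw [Finset.card_insert_of_notMem (by simp)]
      omega

-- The potential starts at no more than one plus the seeds of block `0`, and it ends at one or more,
-- because the last block contains its own first point. Summing the charges gives the factor three.
open Classical in
theorem IsJump.card_not_removable_le (hj : IsJump d nx) (hs : ∀ v, seed v → v ≤ d) :
    ((Finset.range (blk nx d)).filter fun i => ¬ Removable d nx seed (i + 1)).card ≤
      3 * seedCount d seed := by
  have h1 := hj.card_not_removable_add_le hs (blk nx d) le_rfl
  have h2 := hj.blockCount_zero_le hs
  have h3 := hj.sum_blockCount seed
  have h4 : 1 ≤ blockCount d nx (Reach nx seed) (blk nx d) := by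
    by_contra hcon
    have hp := hj.pt_le_of_le_blk (le_refl (blk nx d))
    exact (blockCount_eq_zero (A := Reach nx seed)).1 (by omega) _ hp (.pt _) (hj.blk_pt hp)
  rw [Finset.sum_add_distrib, ← Finset.mul_sum] at h1
  have h5 := Finset.sum_range_succ (blockCount d nx seed) (blk nx d)
  have h6 := Finset.sum_range_succ' (blockCount d nx seed) (blk nx d)
  omega

/-- Block `0` contributes only seeds besides `0`. Every other surviving block is one of the few
non-removable ones, and no block has more than one reached point beyond the total number of seeds.
-/
theorem IsJump.card_kept_le (hj : IsJump d nx) (hs : ∀ v, seed v → v ≤ d) :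
    ((keptPoints d nx seed (InRemovable d nx seed)).erase 0).card ≤
      seedCount d seed + 3 * seedCount d seed * (1 + seedCount d seed) := by
  classical
  have hsub : (keptPoints d nx seed (InRemovable d nx seed)).erase 0 ⊆
      (Finset.range (d + 1)).filter seed ∪
        ((Finset.range (blk nx d)).filter fun i => ¬ Removable d nx seed (i + 1)).biUnion fun i =>
          (Finset.range (d + 1)).filter fun v => Reach nx seed v ∧ blk nx v = i + 1 := by
    intro v hv
    rw [Finset.mem_erase, mem_keptPoints] at hv
    obtain ⟨h0, hvd, hr, hb⟩ := hv
    simp only [Finset.mem_union, Finset.mem_filter, Finset.mem_range, Finset.mem_biUnion]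
    rcases Nat.eq_zero_or_pos (blk nx v) with h | h
    · exact Or.inl ⟨by omega, (hj.reach_block_zero hs hvd hr h).resolve_left h0⟩
    · have := hj.blk_mono hvd le_rfl
      have h1 : blk nx v - 1 + 1 = blk nx v := by omega
      refine Or.inr ⟨blk nx v - 1, ⟨by omega, by rw [h1]; exact hb⟩, by omega, hr, h1.symm⟩
  refine (Finset.card_le_card hsub).trans ((Finset.card_union_le _ _).trans
    (Nat.add_le_add_left ?_ _))
  refine (Finset.card_biUnion_le_card_mul _ _ (1 + seedCount d seed) fun i hi => ?_).trans
    (Nat.mul_le_mul_right _ (hj.card_not_removable_le hs))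
  rw [Finset.mem_filter, Finset.mem_range] at hi
  refine (hj.blockCount_le hs (i + 1)).trans (Nat.add_le_add_left ?_ _)
  rw [← hj.sum_blockCount seed]
  exact Finset.sum_le_sum_of_subset (Finset.range_subset_range.2 (by omega))

end Size

/-! ### Instances as lists of lists of intervals -/

/-- A nonempty list of nonempty intervals below `d`, from left to right, with gaps between them. -/
structure Separated (d : ℕ) (L : List (ℕ × ℕ)) : Prop where
  ne_nil : L ≠ []
  le : ∀ p ∈ L, p.1 ≤ p.2
  lt : ∀ p ∈ L, p.2 < d
  pairwise : L.Pairwise fun p q => p.2 + 1 < q.1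

/-- The point `v` (that is, the value `v - 1`) lies in the interval `p`. -/
def Meets (v : ℕ) (p : ℕ × ℕ) : Prop := p.1 < v ∧ v ≤ p.2 + 1

/-- `N` points among `1, …, d` suffice to meet each of the domains `Ls`; the virtual point `0` is
free. -/
def Coverable (d : ℕ) (Ls : List (List (ℕ × ℕ))) (N : ℤ) : Prop :=
  ∃ S ⊆ Finset.range (d + 1), 0 ∈ S ∧ (S.card : ℤ) ≤ N + 1 ∧
    ∀ L ∈ Ls, ∃ p ∈ L, ∃ v ∈ S, Meets v p

/-- `nx q` is the least right end of a domain that is an interval beginning after `q`. -/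
structure NextSpec (d : ℕ) (Ls : List (List (ℕ × ℕ))) (nx : ℕ → ℕ) : Prop where
  exists_of_le : ∀ q ≤ d, nx q ≤ d → ∃ p, [p] ∈ Ls ∧ q ≤ p.1 ∧ nx q = p.2 + 1
  le_of_mem : ∀ q p, [p] ∈ Ls → q ≤ p.1 → nx q ≤ p.2 + 1
  le : ∀ q ≤ d, nx q ≤ d + 1
  top : nx (d + 1) = d + 1

/-- The boundaries of the intervals in domains with holes. -/
def IsSeed (Ls : List (List (ℕ × ℕ))) (v : ℕ) : Prop :=
  ∃ L ∈ Ls, L.length ≠ 1 ∧ ∃ p ∈ L, v = p.1 ∨ v = p.2 + 1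

/-- The domains with holes. -/
def optionalDom (Ls : List (List (ℕ × ℕ))) (x : {L // L ∈ Ls ∧ L.length ≠ 1}) (v : ℕ) : Prop :=
  ∃ p ∈ x.1, Meets v p

/-- The total number of holes. -/
def holeCount (Ls : List (List (ℕ × ℕ))) : ℕ := (Ls.map fun L => L.length - 1).sum

section Lists

variable {d : ℕ} {Ls : List (List (ℕ × ℕ))} {nx : ℕ → ℕ}

/-- Monotone because fewer intervals begin after a later point, so the minimum of their right ends
can only grow. -/
theorem NextSpec.isJump (h : NextSpec d Ls nx) (hL : ∀ L ∈ Ls, Separated d L) : IsJump d nx where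
  lt q hq := by
    by_contra hcon
    obtain ⟨p, h1, h2, h3⟩ := h.exists_of_le q hq (by omega)
    have := (hL _ h1).le p (by simp)
    omega
  le := h.le
  top := h.top
  mono q q' hqq hq' := by
    by_cases hd : nx q' ≤ d
    · obtain ⟨p, h1, h2, h3⟩ := h.exists_of_le q' hq' hd
      have := h.le_of_mem q p h1 (by omega)
      omega
    · have := h.le q (by omega)
      omega

theorem IsSeed.le (hL : ∀ L ∈ Ls, Separated d L) (v : ℕ) (h : IsSeed Ls v) : v ≤ d := by
  obtain ⟨L, h1, -, p, h2, h3⟩ := h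
  have h4 := (hL L h1).le p h2
  have h5 := (hL L h1).lt p h2
  omega

/-- The seeds are the last point before an interval and the last point in it. From any other point a
single step neither enters nor leaves an interval. -/
theorem optionalDom_succ (x : {L // L ∈ Ls ∧ L.length ≠ 1}) (v : ℕ) (h : ¬ IsSeed Ls v) :
    optionalDom Ls x v ↔ optionalDom Ls x (v + 1) := by
  have hne : ∀ p ∈ x.1, v ≠ p.1 ∧ v ≠ p.2 + 1 := fun p hp =>
    ⟨fun hv => h ⟨x.1, x.2.1, x.2.2, p, hp, Or.inl hv⟩,
      fun hv => h ⟨x.1, x.2.1, x.2.2, p, hp, Or.inr hv⟩⟩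
  unfold optionalDom Meets
  constructor
  · rintro ⟨p, hp, h1, h2⟩
    have := hne p hp
    exact ⟨p, hp, by omega, by omega⟩
  · rintro ⟨p, hp, h1, h2⟩
    have := hne p hp
    exact ⟨p, hp, by omega, by omega⟩

theorem optionalDom_le (hL : ∀ L ∈ Ls, Separated d L) (x : {L // L ∈ Ls ∧ L.length ≠ 1}) (v : ℕ)
    (h : optionalDom Ls x v) : v ≤ d := by
  obtain ⟨p, hp, h1, h2⟩ := h
  have := (hL x.1 x.2.1).lt p hp
  omega

/-- Every solution can be rounded up to reached points. -/
theorem NextSpec.coverable_iff (h : NextSpec d Ls nx) (hL : ∀ L ∈ Ls, Separated d L) (N : ℤ) :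
    Coverable d Ls N ↔
      Pierced d (keptPoints d nx (IsSeed Ls) fun _ => False) nx (optionalDom Ls) N := by
  classical
  have hmem : ∀ v, v ∈ keptPoints d nx (IsSeed Ls) (fun _ => False) ↔
      v ≤ d ∧ Reach nx (IsSeed Ls) v := fun v => by simp [mem_keptPoints]
  constructor
  · rintro ⟨S, hSd, h0, hc, hS⟩
    -- The next reached point at or after `s`. A point after which no point up to `d` is reached is
    -- of no use and is sent to the virtual point `0`.
    let up : ℕ → ℕ := fun s =>
      if hx : ∃ v, s ≤ v ∧ v ≤ d ∧ Reach nx (IsSeed Ls) v then Nat.find hx else 0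
    have hup : ∀ s v, s ≤ v → v ≤ d → Reach nx (IsSeed Ls) v → s ≤ up s ∧ up s ≤ v := by
      intro s v h1 h2 h3
      have hx : ∃ v, s ≤ v ∧ v ≤ d ∧ Reach nx (IsSeed Ls) v := ⟨v, h1, h2, h3⟩
      simp only [up, dif_pos hx]
      exact ⟨(Nat.find_spec hx).1, Nat.find_min' hx ⟨h1, h2, h3⟩⟩
    refine ⟨S.image up, ?_, ?_, ?_, ?_, ?_⟩
    · intro v hv
      obtain ⟨s, hs, rfl⟩ := Finset.mem_image.1 hv
      rw [hmem]
      simp only [up]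
      split_ifs with hx
      · exact (Nat.find_spec hx).2
      · exact ⟨Nat.zero_le _, .zero⟩
    · refine Finset.mem_image.2 ⟨0, h0, ?_⟩
      have := (hup 0 0 le_rfl (Nat.zero_le _) .zero).2
      omega
    · have := Finset.card_image_le (s := S) (f := up)
      omega
    · intro q hq hqd
      rw [hmem] at hq
      obtain ⟨p, h1, h2, h3⟩ := h.exists_of_le q hq.1 hqd
      obtain ⟨p', hp', v, hv, h4, h5⟩ := hS _ h1
      rw [List.mem_singleton] at hp'
      subst hp'
      have := hup v (nx q) (by omega) hqd hq.2.step
      exact ⟨up v, Finset.mem_image_of_mem _ hv, by omega, by omega⟩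
    · intro x
      obtain ⟨p, hp, v, hv, h4, h5⟩ := hS x.1 x.2.1
      have := (hL x.1 x.2.1).lt p hp
      have := hup v (p.2 + 1) (by omega) (by omega)
        (.seed ⟨x.1, x.2.1, x.2.2, p, hp, Or.inr rfl⟩)
      exact ⟨up v, Finset.mem_image_of_mem _ hv, p, hp, by omega, by omega⟩
  · rintro ⟨S, hSK, h0, hc, hR, hO⟩
    refine ⟨S, fun v hv => ?_, h0, hc, fun L hLs => ?_⟩
    · have := (hmem v).1 (hSK hv)
      exact Finset.mem_range.2 (by omega)
    · by_cases hlen : L.length = 1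
      · obtain ⟨p, rfl⟩ := List.length_eq_one_iff.1 hlen
        have hpd := (hL _ hLs).lt p (by simp)
        have hple := (hL _ hLs).le p (by simp)
        have hne : ((Finset.range (p.1 + 1)).filter fun v => Reach nx (IsSeed Ls) v).Nonempty :=
          ⟨0, by simp [Reach.zero]⟩
        have hm := Finset.max'_mem _ hne
        -- With `q` the last reached point before the interval, the jump of `q` ends no later than
        -- the interval does. The chosen point in `(q, nx q]` is reached, so by maximality it cannot
        -- precede the interval.
        set q := ((Finset.range (p.1 + 1)).filter fun v => Reach nx (IsSeed Ls) v).max' hne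
        rw [Finset.mem_filter, Finset.mem_range] at hm
        have h1 := h.le_of_mem q p hLs (by omega)
        obtain ⟨v, hv, h2, h3⟩ := hR q ((hmem q).2 ⟨by omega, hm.2⟩) (by omega)
        refine ⟨p, by simp, v, hv, ?_, by omega⟩
        by_contra hcon
        have h4 : v ≤ q := Finset.le_max' _ _ (Finset.mem_filter.2
          ⟨Finset.mem_range.2 (by omega), ((hmem v).1 (hSK hv)).2⟩)
        omega
      · obtain ⟨v, hv, p, hp, h1⟩ := hO ⟨L, hLs, hlen⟩
        exact ⟨p, hp, v, hv, h1⟩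

/-! ### The rank of a point -/

/-- The number of points of `K` among `1, …, v`. -/
def rank (K : Finset ℕ) : ℕ → ℕ
  | 0 => 0
  | v + 1 => rank K v + if v + 1 ∈ K then 1 else 0

section Rank

variable {K : Finset ℕ}

theorem rank_mono : Monotone (rank K) :=
  monotone_nat_of_le_succ fun v => by rw [rank.eq_2]; omega

theorem rank_lt_iff {u v : ℕ} (hv : v ∈ K) : rank K u < rank K v ↔ u < v := by
  constructor
  · intro h
    by_contra hcon
    have := rank_mono (K := K) (not_lt.1 hcon)
    omega
  · intro h
    obtain ⟨w, rfl⟩ : ∃ w, v = w + 1 := ⟨v - 1, by omega⟩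
    have h1 := rank_mono (K := K) (show u ≤ w by omega)
    rw [rank, if_pos hv]
    omega

theorem rank_le_iff {u v : ℕ} (hu : u ∈ K) : rank K u ≤ rank K v ↔ u ≤ v := by
  rw [← not_lt, rank_lt_iff hu, not_lt]

theorem rank_pos_iff {v : ℕ} (hv : v ∈ K) : 0 < rank K v ↔ 0 < v := by
  rw [← rank_lt_iff hv]; rfl

theorem rank_injOn : Set.InjOn (rank K) K := fun _ hu _ hv h =>
  le_antisymm ((rank_le_iff hu).1 h.le) ((rank_le_iff hv).1 h.ge)

theorem exists_rank_eq (h0 : 0 ∈ K) {d r : ℕ} (h : r ≤ rank K d) : ∃ v ∈ K, v ≤ d ∧ rank K v = r := by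
  induction d with
  | zero => exact ⟨0, h0, le_rfl, by rw [rank] at h ⊢; omega⟩
  | succ d ih =>
    by_cases hr : r ≤ rank K d
    · obtain ⟨v, h1, h2, h3⟩ := ih hr
      exact ⟨v, h1, by omega, h3⟩
    · rw [rank] at h
      split_ifs at h with hd
      · exact ⟨d + 1, hd, le_rfl, by rw [rank, if_pos hd]; omega⟩
      · omega

theorem rank_eq_card (d : ℕ) (hK : ∀ v ∈ K, v ≤ d) : rank K d = (K.erase 0).card := by
  have key : ∀ d, rank K d = ((K.erase 0).filter fun v => v ≤ d).card := by
    intro d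
    induction d with
    | zero =>
      symm
      rw [rank, Finset.card_eq_zero, Finset.filter_eq_empty_iff]
      intro v hv
      rw [Finset.mem_erase] at hv
      omega
    | succ d ih =>
      rw [rank, ih]
      split_ifs with h
      · rw [← Finset.card_insert_of_notMem (a := d + 1) (by simp)]
        congr 1
        ext v
        simp only [Finset.mem_insert, Finset.mem_filter, Finset.mem_erase]
        constructor
        · rintro (rfl | ⟨h1, h2⟩)
          · exact ⟨⟨by omega, h⟩, le_rfl⟩
          · exact ⟨h1, by omega⟩
        · rintro ⟨h1, h2⟩
          by_cases h3 : v = d + 1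
          · exact Or.inl h3
          · exact Or.inr ⟨h1, by omega⟩
      · rw [add_zero]
        congr 1
        refine Finset.filter_congr fun v hv => ?_
        rw [Finset.mem_erase] at hv
        refine ⟨fun h1 => by omega, fun h1 => ?_⟩
        by_contra hcon
        have : v = d + 1 := by omega
        exact h (this ▸ hv.2)
  rw [key, Finset.filter_true_of_mem]
  exact fun v hv => hK v (Finset.mem_of_mem_erase hv)

end Rank

/-! ### The reduced instance -/

/-- The renaming of an interval when only the points `K` are kept. -/
def renameIvl (K : Finset ℕ) (p : ℕ × ℕ) : ℕ × ℕ := (rank K p.1, rank K (p.2 + 1) - 1)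

/-- The domains `(q, f q]`, for `q` from `d` down to `d + 1 - t`. -/
def requiredDoms (d : ℕ) (K : Finset ℕ) (f : ℕ → ℕ) (t : ℕ) : List (List (ℕ × ℕ)) :=
  ((List.range t).filter fun i => d - i ∈ K ∧ f (d - i) ≤ d).map fun i =>
    [renameIvl K (d - i, f (d - i) - 1)]

/-- The renamed domains with holes. -/
def optionalDoms (K : Finset ℕ) (Ls : List (List (ℕ × ℕ))) : List (List (ℕ × ℕ)) :=
  (Ls.filter fun L => L.length ≠ 1).map fun L => L.map (renameIvl K)

theorem mem_requiredDoms {K : Finset ℕ} {f : ℕ → ℕ} (hK : ∀ q ∈ K, q ≤ d) {L : List (ℕ × ℕ)} :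
    L ∈ requiredDoms d K f (d + 1) ↔ ∃ q ∈ K, f q ≤ d ∧ L = [renameIvl K (q, f q - 1)] := by
  simp only [requiredDoms, List.mem_map, List.mem_filter, List.mem_range, decide_eq_true_eq]
  constructor
  · rintro ⟨i, ⟨h1, h2, h3⟩, rfl⟩
    exact ⟨d - i, h2, h3, rfl⟩
  · rintro ⟨q, h1, h2, rfl⟩
    have hq := hK q h1
    have : d - (d - q) = q := by omega
    exact ⟨d - q, ⟨by omega, by rw [this]; exact ⟨h1, h2⟩⟩, by rw [this]⟩

theorem mem_optionalDoms {K : Finset ℕ} {L : List (ℕ × ℕ)} :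
    L ∈ optionalDoms K Ls ↔ ∃ L₀ ∈ Ls, L₀.length ≠ 1 ∧ L = L₀.map (renameIvl K) := by
  simp only [optionalDoms, List.mem_map, List.mem_filter, decide_eq_true_eq]
  constructor
  · rintro ⟨L₀, ⟨h1, h2⟩, rfl⟩; exact ⟨L₀, h1, h2, rfl⟩
  · rintro ⟨L₀, h1, h2, rfl⟩; exact ⟨L₀, ⟨h1, h2⟩, rfl⟩

/-- Comparing ranks with a point of `K` is exact even if the left end is not in `K`. The hypothesis
`hp` makes the subtraction in `renameIvl` genuine. -/
theorem meets_renameIvl {K : Finset ℕ} {p : ℕ × ℕ} {v : ℕ} (hv : v ∈ K)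
    (hp : 0 < rank K (p.2 + 1)) : Meets (rank K v) (renameIvl K p) ↔ Meets v p := by
  have h1 := rank_lt_iff (u := p.1) hv
  have h2 := rank_le_iff (v := p.2 + 1) hv
  unfold Meets renameIvl
  simp only
  rw [Nat.sub_add_cancel hp, h1, h2]

/-- The rank is injective on `K`, fixes `0` and reaches every number up to `rank K d`. Solutions are
therefore carried back and forth by it. -/
theorem coverable_reduced_iff {K : Finset ℕ} {f : ℕ → ℕ} (hs : PointSystem d K f)
    (hseed : ∀ v, IsSeed Ls v → v ∈ K) (N : ℤ) :
    Coverable (rank K d) (requiredDoms d K f (d + 1) ++ optionalDoms K Ls) N ↔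
      Pierced d K f (optionalDom Ls) N := by
  have hpos : ∀ q ∈ K, f q ≤ d → 0 < rank K (f q - 1 + 1) := fun q hq hqd => by
    have := hs.lt q hq
    rw [Nat.sub_add_cancel (by omega)]
    exact (rank_pos_iff (hs.mem q hq hqd)).2 (by omega)
  have hpos' : ∀ L ∈ Ls, L.length ≠ 1 → ∀ p ∈ L, 0 < rank K (p.2 + 1) := fun L h1 h2 p hp =>
    (rank_pos_iff (hseed _ ⟨L, h1, h2, p, hp, Or.inr rfl⟩)).2 (by omega)
  have hmeet : ∀ q ∈ K, f q ≤ d → ∀ v, Meets v (q, f q - 1) ↔ q < v ∧ v ≤ f q := by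
    intro q hq hqd v
    have := hs.lt q hq
    simp only [Meets]
    rw [Nat.sub_add_cancel (by omega)]
  constructor
  · rintro ⟨S, hSd, h0, hc, hS⟩
    have hlift : ∀ v ∈ S, ∃ u ∈ K, rank K u = v := fun v hv => by
      have := Finset.mem_range.1 (hSd hv)
      obtain ⟨u, h1, -, h2⟩ := exists_rank_eq (K := K) hs.zero_mem (d := d) (r := v) (by omega)
      exact ⟨u, h1, h2⟩
    refine ⟨K.filter fun u => rank K u ∈ S, Finset.filter_subset _ _,
      Finset.mem_filter.2 ⟨hs.zero_mem, h0⟩, ?_, ?_, ?_⟩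
    · have : (K.filter fun u => rank K u ∈ S).card ≤ S.card :=
        Finset.card_le_card_of_injOn (rank K) (fun u hu => (Finset.mem_filter.1 hu).2)
          (fun u hu v hv h => rank_injOn (Finset.mem_filter.1 hu).1 (Finset.mem_filter.1 hv).1 h)
      omega
    · intro q hq hqd
      obtain ⟨p, hp, v, hv, hm⟩ := hS _ (List.mem_append_left _
        ((mem_requiredDoms hs.le).2 ⟨q, hq, hqd, rfl⟩))
      rw [List.mem_singleton] at hp
      subst hp
      obtain ⟨u, hu, rfl⟩ := hlift v hv
      rw [meets_renameIvl hu (hpos q hq hqd), hmeet q hq hqd] at hm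
      exact ⟨u, Finset.mem_filter.2 ⟨hu, hv⟩, hm⟩
    · intro x
      obtain ⟨p, hp, v, hv, hm⟩ := hS _ (List.mem_append_right _
        (mem_optionalDoms.2 ⟨x.1, x.2.1, x.2.2, rfl⟩))
      obtain ⟨p₀, hp₀, rfl⟩ := List.mem_map.1 hp
      obtain ⟨u, hu, rfl⟩ := hlift v hv
      rw [meets_renameIvl hu (hpos' _ x.2.1 x.2.2 p₀ hp₀)] at hm
      exact ⟨u, Finset.mem_filter.2 ⟨hu, hv⟩, p₀, hp₀, hm⟩
  · rintro ⟨S, hSK, h0, hc, hR, hO⟩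
    refine ⟨S.image (rank K), ?_, Finset.mem_image.2 ⟨0, h0, rfl⟩, ?_, ?_⟩
    · intro v hv
      obtain ⟨u, hu, rfl⟩ := Finset.mem_image.1 hv
      exact Finset.mem_range.2 (Nat.lt_succ_of_le (rank_mono (hs.le u (hSK hu))))
    · have := Finset.card_image_le (s := S) (f := rank K)
      omega
    · intro L hLm
      rcases List.mem_append.1 hLm with hLm | hLm
      · obtain ⟨q, hq, hqd, rfl⟩ := (mem_requiredDoms hs.le).1 hLm
        obtain ⟨v, hv, hm⟩ := hR q hq hqd
        exact ⟨_, List.mem_singleton_self _, _, Finset.mem_image_of_mem _ hv,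
          (meets_renameIvl (hSK hv) (hpos q hq hqd)).2 ((hmeet q hq hqd v).2 hm)⟩
      · obtain ⟨L₀, h1, h2, rfl⟩ := mem_optionalDoms.1 hLm
        obtain ⟨v, hv, p, hp, hm⟩ := hO ⟨L₀, h1, h2⟩
        exact ⟨_, List.mem_map_of_mem hp, _, Finset.mem_image_of_mem _ hv,
          (meets_renameIvl (hSK hv) (hpos' _ h1 h2 p hp)).2 hm⟩

/-- Gaps survive because the point just before each interval of a domain with holes is a seed, hence
kept. It lies strictly after the end of the previous interval, so its rank is strictly larger. Kept
right ends make the renamed intervals nonempty. -/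
theorem separated_reduced {K : Finset ℕ} {f : ℕ → ℕ} (hs : PointSystem d K f)
    (hL : ∀ L ∈ Ls, Separated d L) (hseed : ∀ v, IsSeed Ls v → v ∈ K) :
    ∀ L ∈ requiredDoms d K f (d + 1) ++ optionalDoms K Ls, Separated (rank K d) L := by
  intro L hLm
  rcases List.mem_append.1 hLm with hLm | hLm
  · obtain ⟨q, hq, hqd, rfl⟩ := (mem_requiredDoms hs.le).1 hLm
    have hlt := hs.lt q hq
    have h1 := (rank_lt_iff (hs.mem q hq hqd)).2 hlt
    have h2 := rank_mono (K := K) hqd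
    have h3 : f q - 1 + 1 = f q := by omega
    refine ⟨by simp, ?_, ?_, by simp⟩ <;>
    · intro p hp
      rw [List.mem_singleton] at hp
      subst hp
      simp only [renameIvl, h3]
      omega
  · obtain ⟨L₀, h1, h2, rfl⟩ := mem_optionalDoms.1 hLm
    have hsep := hL L₀ h1
    have key : ∀ p ∈ L₀, rank K p.1 < rank K (p.2 + 1) ∧ rank K (p.2 + 1) ≤ rank K d := fun p hp =>
      ⟨(rank_lt_iff (hseed _ ⟨L₀, h1, h2, p, hp, Or.inr rfl⟩)).2 (by have := hsep.le p hp; omega),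
        rank_mono (hsep.lt p hp)⟩
    refine ⟨by simpa using hsep.ne_nil, ?_, ?_, ?_⟩
    · intro p hp
      obtain ⟨p₀, hp₀, rfl⟩ := List.mem_map.1 hp
      have := key p₀ hp₀
      simp only [renameIvl]
      omega
    · intro p hp
      obtain ⟨p₀, hp₀, rfl⟩ := List.mem_map.1 hp
      have := key p₀ hp₀
      simp only [renameIvl]
      omega
    · rw [List.pairwise_map]
      refine hsep.pairwise.imp_of_mem fun {p q} hp hq hpq => ?_
      have h3 := key p hp
      have h4 := (rank_lt_iff (K := K) (u := p.2 + 1) (hseed _ ⟨L₀, h1, h2, q, hq, Or.inl rfl⟩)).2 hpq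
      simp only [renameIvl]
      omega

/-! ### The size of the reduced instance. -/

theorem holeCount_optionalDoms (K : Finset ℕ) : holeCount (optionalDoms K Ls) = holeCount Ls := by
  unfold holeCount optionalDoms
  induction Ls with
  | nil => rfl
  | cons L Ls ih =>
    by_cases h : L.length = 1
    · simpa [h] using ih
    · simpa [h] using ih

theorem holeCount_requiredDoms (K : Finset ℕ) (f : ℕ → ℕ) (t : ℕ) :
    holeCount (requiredDoms d K f t) = 0 := by
  unfold holeCount requiredDoms
  rw [List.sum_eq_zero_iff]
  intro x hx
  simp only [List.map_map, List.mem_map] at hx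
  obtain ⟨i, -, rfl⟩ := hx
  rfl

theorem holeCount_append (Ls Ls' : List (List (ℕ × ℕ))) :
    holeCount (Ls ++ Ls') = holeCount Ls + holeCount Ls' := by
  simp [holeCount]

theorem length_optionalDoms_le (K : Finset ℕ) (hL : ∀ L ∈ Ls, L ≠ []) :
    (optionalDoms K Ls).length ≤ holeCount Ls := by
  unfold holeCount optionalDoms
  induction Ls with
  | nil => simp
  | cons L Ls ih =>
    have ih := ih fun L h => hL L (List.mem_cons_of_mem _ h)
    have := List.length_pos_iff.2 (hL L (List.mem_cons_self ..))
    by_cases h : L.length = 1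
    · simp [h] at ih ⊢; omega
    · simp [h] at ih ⊢; omega

/-- There is at most one domain per point of `K`, and `K` has one point more than its rank because
of `0`. If there is a domain at all, the rank is positive and the extra one is absorbed by doubling.
-/
theorem length_requiredDoms_le {K : Finset ℕ} {f : ℕ → ℕ} (hs : PointSystem d K f) :
    (requiredDoms d K f (d + 1)).length ≤ 2 * rank K d := by
  rcases Nat.eq_zero_or_pos (requiredDoms d K f (d + 1)).length with h | h
  · omega
  · obtain ⟨L, hL⟩ := List.exists_mem_of_length_pos h
    obtain ⟨q, hq, hqd, -⟩ := (mem_requiredDoms hs.le).1 hL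
    have h1 := (rank_lt_iff (hs.mem q hq hqd)).2 (hs.lt q hq)
    have h2 := rank_mono (K := K) hqd
    have h3 : (requiredDoms d K f (d + 1)).length ≤ K.card := by
      unfold requiredDoms
      rw [List.length_map, ← List.toFinset_card_of_nodup (List.nodup_range.filter _)]
      refine Finset.card_le_card_of_injOn (fun i => d - i) ?_ ?_
      · intro i hi
        simp at hi
        exact hi.2.1
      · intro i hi j hj hij
        simp at hi hj hij
        omega
    have h4 := rank_eq_card d hs.le
    have h5 := Finset.card_erase_add_one hs.zero_mem
    omega

/-- A domain with `m ≥ 2` intervals has at most `2 * m` seeds and `m - 1` holes, and `2 * m ≤ 4 * (m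
- 1)`. -/
theorem seedCount_le (d : ℕ) (hL : ∀ L ∈ Ls, L ≠ []) :
    seedCount d (IsSeed Ls) ≤ 4 * holeCount Ls := by
  classical
  have h1 : seedCount d (IsSeed Ls) ≤ ((Ls.filter fun L => L.length ≠ 1).flatMap fun L =>
      L.flatMap fun p => [p.1, p.2 + 1]).length := by
    unfold seedCount
    refine le_trans (Finset.card_le_card fun v hv => ?_) (List.toFinset_card_le _)
    obtain ⟨L, h1, h2, p, h3, h4⟩ := (Finset.mem_filter.1 hv).2
    rw [List.mem_toFinset, List.mem_flatMap]
    refine ⟨L, by simp [h1, h2], List.mem_flatMap.2 ⟨p, h3, ?_⟩⟩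
    simpa using h4
  refine h1.trans ?_
  clear h1
  unfold holeCount
  induction Ls with
  | nil => simp
  | cons L Ls ih =>
    have ih := ih fun L h => hL L (List.mem_cons_of_mem _ h)
    have := List.length_pos_iff.2 (hL L (List.mem_cons_self ..))
    by_cases h : L.length = 1
    · simp [h] at ih ⊢; omega
    · simp [h, List.length_flatMap] at ih ⊢; omega

end Lists

/-! ### The succinct description -/

/-- The natural number `m` is (the rank of) an element of `A`. -/
def HasVal {d : ℕ} (A : Finset (Fin d)) (m : ℕ) : Prop := ∃ h : m < d, (⟨m, h⟩ : Fin d) ∈ A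

/-- The intervals of a domain from left to right. -/
def ivlList {d : ℕ} (A : Finset (Fin d)) : List (ℕ × ℕ) :=
  ((intervals A).sort (· ≤ ·)).map fun p => ((ofLex p).1.val, (ofLex p).2.val)

/-- The intervals of the domains of an instance. -/
def Instance.lists (I : Instance) : List (List (ℕ × ℕ)) :=
  (List.finRange I.n).map fun x => ivlList (I.dom x)

/-- The succinct description of a domain given as a list of intervals. -/
def encodeList (L : List (ℕ × ℕ)) : List ℤ :=
  (L.length : ℤ) :: L.flatMap fun p => [(p.1 : ℤ), (p.2 : ℤ)]

/-- `(a, b)` are the end points of an interval of `A`. -/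
structure IsIvl {d : ℕ} (A : Finset (Fin d)) (a b : ℕ) : Prop where
  le : a ≤ b
  mem : ∀ m, a ≤ m → m ≤ b → HasVal A m
  left : ∀ m, m + 1 = a → ¬ HasVal A m
  right : ¬ HasVal A (b + 1)

section Encode

variable {d : ℕ} {A : Finset (Fin d)}

theorem hasVal_val (v : Fin d) : HasVal A v.val ↔ v ∈ A := ⟨fun h => h.2, fun h => ⟨v.2, h⟩⟩

/-- Maximality need only be tested against extension by one value to either side. -/
theorem mem_intervals (p : Fin d ×ₗ Fin d) :
    p ∈ intervals A ↔ IsIvl A (ofLex p).1.val (ofLex p).2.val := by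
  simp only [intervals, Finset.mem_filter, Finset.mem_univ, true_and]
  generalize (ofLex p).1 = a
  generalize (ofLex p).2 = b
  constructor
  · rintro ⟨hab, hA, hmax⟩
    refine ⟨hab, ?_, ?_, ?_⟩
    · intro m h1 h2
      have hm : m < d := by omega
      exact ⟨hm, hA (Finset.mem_Icc.2 ⟨h1, h2⟩)⟩
    · rintro m h1 ⟨hm, h2⟩
      have h3 := (hmax ⟨m, hm⟩ b ?_ ?_).1
      · rw [Fin.ext_iff] at h3; simp at h3; omega
      · intro v hv
        rw [Finset.mem_Icc, Fin.le_def, Fin.le_def] at hv ⊢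
        simp; omega
      · intro v hv
        by_cases hva : a ≤ v
        · exact hA (Finset.mem_Icc.2 ⟨hva, (Finset.mem_Icc.1 hv).2⟩)
        · have : v = ⟨m, hm⟩ := by
            rw [Finset.mem_Icc, Fin.le_def, Fin.le_def] at hv
            rw [Fin.le_def] at hva
            rw [Fin.ext_iff]
            simp at hv ⊢; omega
          rwa [this]
    · rintro ⟨hm, h2⟩
      have h3 := (hmax a ⟨b.val + 1, hm⟩ ?_ ?_).2
      · rw [Fin.ext_iff] at h3; simp at h3
      · intro v hv
        rw [Finset.mem_Icc, Fin.le_def, Fin.le_def] at hv ⊢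
        simp; omega
      · intro v hv
        by_cases hva : v ≤ b
        · exact hA (Finset.mem_Icc.2 ⟨(Finset.mem_Icc.1 hv).1, hva⟩)
        · have : v = ⟨b.val + 1, hm⟩ := by
            rw [Finset.mem_Icc, Fin.le_def, Fin.le_def] at hv
            rw [Fin.le_def] at hva
            rw [Fin.ext_iff]
            simp at hv ⊢; omega
          rwa [this]
  · rintro ⟨hab, hA, hl, hr⟩
    refine ⟨hab, fun v hv => ?_, fun l r hsub hlr => ?_⟩
    · rw [Finset.mem_Icc] at hv
      exact (hA v hv.1 hv.2).2
    · have h1 := Finset.mem_Icc.1 (hsub (Finset.mem_Icc.2 ⟨le_rfl, hab⟩))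
      have h2 := Finset.mem_Icc.1 (hsub (Finset.mem_Icc.2 ⟨hab, le_rfl⟩))
      rw [Fin.le_def, Fin.le_def] at h1 h2
      constructor
      · by_contra hne
        rw [Fin.ext_iff] at hne
        refine hl (a.val - 1) (by omega) ⟨by omega, hlr (Finset.mem_Icc.2 ?_)⟩
        rw [Fin.le_def, Fin.le_def]
        simp; omega
      · by_contra hne
        rw [Fin.ext_iff] at hne
        have hb : b.val + 1 < d := by omega
        refine hr ⟨hb, hlr (Finset.mem_Icc.2 ?_)⟩
        rw [Fin.le_def, Fin.le_def]
        simp; omega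

theorem IsIvl.lt {a b : ℕ} (h : IsIvl A a b) : b < d := (h.mem b h.le le_rfl).1

theorem mem_ivlList {a b : ℕ} : (a, b) ∈ ivlList A ↔ IsIvl A a b := by
  simp only [ivlList, List.mem_map, Finset.mem_sort, Prod.mk.injEq]
  constructor
  · rintro ⟨p, hp, rfl, rfl⟩
    exact (mem_intervals p).1 hp
  · intro h
    have hb := h.lt
    have := h.le
    exact ⟨toLex (⟨a, by omega⟩, ⟨b, hb⟩), (mem_intervals _).2 h, rfl, rfl⟩

/-- If two intervals overlapped or touched, one of them would contain the value just beyond an end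
of the other. -/
theorem IsIvl.separate {a b a' b' : ℕ} (h : IsIvl A a b) (h' : IsIvl A a' b')
    (hlt : a < a' ∨ a = a' ∧ b < b') : b + 1 < a' := by
  have h1 := h.le
  have h2 := h'.le
  by_contra hcon
  by_cases hb : b < b'
  · exact h.right (h'.mem _ (by omega) (by omega))
  · obtain ⟨m, rfl⟩ : ∃ m, a' = m + 1 := ⟨a' - 1, by omega⟩
    exact h'.left m rfl (h.mem m (by omega) (by omega))

theorem exists_isIvl {m : ℕ} (hm : HasVal A m) : ∃ a b, a ≤ m ∧ m ≤ b ∧ IsIvl A a b := by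
  classical
  -- extend to the right and to the left as far as possible
  have hr : ∃ b, m ≤ b ∧ ¬ HasVal A (b + 1) := ⟨m + d, by omega, fun h => by have := h.1; omega⟩
  have hl : ∃ a, ∀ k, a ≤ k → k ≤ m → HasVal A k := ⟨m, fun k h1 h2 => by
    have : k = m := by omega
    rwa [this]⟩
  have hb := Nat.find_spec hr
  have ha := Nat.find_spec hl
  have ham : Nat.find hl ≤ m := Nat.find_min' hl fun k h1 h2 => by
    have : k = m := by omega
    rwa [this]
  refine ⟨Nat.find hl, Nat.find hr, ham, hb.1, ham.trans hb.1, fun k h1 h2 => ?_, fun k hk hv => ?_,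
    hb.2⟩
  · by_cases hk : k ≤ m
    · exact ha k h1 hk
    · have h3 := Nat.find_min hr (m := k - 1) (by omega)
      by_contra hcon
      exact h3 ⟨by omega, by rwa [Nat.sub_add_cancel (by omega)]⟩
  · refine Nat.find_min hl (m := k) (by omega) fun i h1 h2 => ?_
    rcases eq_or_lt_of_le h1 with rfl | h
    · exact hv
    · exact ha i (by omega) h2

theorem separated_ivlList (hA : A.Nonempty) : Separated d (ivlList A) where
  ne_nil := by
    obtain ⟨v, hv⟩ := hA
    obtain ⟨a, b, -, -, h⟩ := exists_isIvl ((hasVal_val v).2 hv)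
    exact List.ne_nil_of_mem (mem_ivlList.2 h)
  le p hp := (mem_ivlList.1 hp).le
  lt p hp := (mem_ivlList.1 hp).lt
  pairwise := by
    unfold ivlList
    rw [List.pairwise_map]
    refine (List.Pairwise.and (Finset.pairwise_sort (intervals A) (· ≤ ·))
      (Finset.sort_nodup (intervals A) (· ≤ ·))).imp_of_mem fun {p q} hp hq hpq => ?_
    rw [Finset.mem_sort] at hp hq
    refine ((mem_intervals p).1 hp).separate ((mem_intervals q).1 hq) ?_
    have hlt := (Prod.Lex.lt_iff ..).1 (lt_of_le_of_ne hpq.1 hpq.2)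
    rcases hlt with h | ⟨h1, h2⟩
    · exact Or.inl h
    · exact Or.inr ⟨by rw [h1], h2⟩

theorem length_ivlList : (ivlList A).length = (intervals A).card := by
  simp [ivlList]

theorem encodeDom_eq : encodeDom A = encodeList (ivlList A) := by
  unfold encodeDom encodeList
  rw [length_ivlList, ivlList, List.flatMap_map]

/-! ### Counting intervals and holes. -/

/-- The left ends of the intervals. -/
def leftEnds (A : Finset (Fin d)) : Finset (Fin d) :=
  A.filter fun w => ∀ u : Fin d, u.val + 1 = w.val → u ∉ A

theorem card_intervals : (intervals A).card = (leftEnds A).card := by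
  refine Finset.card_nbij (fun p => (ofLex p).1) ?_ ?_ ?_
  · intro p hp
    have h := (mem_intervals p).1 hp
    refine Finset.mem_filter.2 ⟨(h.mem _ le_rfl h.le).2, fun u hu hA => ?_⟩
    exact h.left _ hu ((hasVal_val u).2 hA)
  · intro p hp q hq hpq
    have h := (mem_intervals p).1 hp
    have h' := (mem_intervals q).1 hq
    have hpq : (ofLex p).1 = (ofLex q).1 := hpq
    have h1 := h.separate h'
    have h2 := h'.separate h
    have h3 := h.le
    have h4 := h'.le
    rw [hpq] at h1 h2 h3
    have h5 : (ofLex p).2 = (ofLex q).2 := by rw [Fin.ext_iff]; omega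
    exact ofLex.injective (Prod.ext hpq h5)
  · intro w hw
    obtain ⟨hwA, hleft⟩ := Finset.mem_filter.1 hw
    obtain ⟨a, b, h1, h2, h⟩ := exists_isIvl ((hasVal_val w).2 hwA)
    have hb := h.lt
    have haw : a = w.val := by
      by_contra hne
      obtain ⟨hlt, hmem⟩ := h.mem (w.val - 1) (by omega) (by omega)
      exact hleft _ (by simp; omega) hmem
    subst haw
    exact ⟨toLex (w, ⟨b, hb⟩), (mem_intervals _).2 h, rfl⟩

theorem mem_holes (p : Fin d × Fin d) : p ∈ holes A ↔ (p.1 ∈ A ∧ p.2 ∈ A) ∧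
    (∃ v, v ∉ A ∧ p.1 < v ∧ v < p.2) ∧ ¬ ∃ v' ∈ A, p.1 < v' ∧ v' < p.2 :=
  (@Finset.mem_filter _ _ (_) _ _).trans (and_congr_left' Finset.mem_product)

/-- A hole is determined by its right element, which is the left end of an interval. The minimum of
the domain is the only left end that closes no hole. -/
theorem card_holes (hA : A.Nonempty) : (holes A).card + 1 = (leftEnds A).card := by
  have hmin : A.min' hA ∈ leftEnds A :=
    Finset.mem_filter.2 ⟨A.min'_mem hA, fun u hu hu' => by
      have := A.min'_le u hu'
      rw [Fin.le_def] at this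
      omega⟩
  rw [← Finset.card_erase_add_one hmin]
  congr 1
  refine Finset.card_nbij (fun p => p.2) ?_ ?_ ?_
  · rintro ⟨u, w⟩ hp
    obtain ⟨h1, ⟨v, h2, h3, h4⟩, h5⟩ := (mem_holes _).1 hp
    simp only at h1 h3 h4 h5 ⊢
    refine Finset.mem_erase.2 ⟨?_, Finset.mem_filter.2 ⟨h1.2, fun v' hv' hv'A => h5 ⟨v', hv'A, ?_⟩⟩⟩
    · have := A.min'_le u h1.1
      have h6 := lt_of_le_of_lt this (h3.trans h4)
      exact ne_of_gt h6
    · rw [Fin.lt_def] at h3 h4 ⊢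
      rw [Fin.lt_def]
      omega
  · rintro ⟨u, w⟩ hp ⟨u', w'⟩ hp' hww
    obtain ⟨h1, ⟨v, h2, h3, h4⟩, h5⟩ := (mem_holes _).1 hp
    obtain ⟨h1', ⟨v', h2', h3', h4'⟩, h5'⟩ := (mem_holes _).1 hp'
    simp only at *
    subst hww
    rcases lt_trichotomy u u' with h | h | h
    · exact absurd ⟨u', h1'.1, h, h3'.trans h4'⟩ h5
    · rw [h]
    · exact absurd ⟨u, h1.1, h, h3.trans h4⟩ h5'
  · intro w hw
    obtain ⟨hne, hw⟩ := Finset.mem_erase.1 hw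
    obtain ⟨hwA, hleft⟩ := Finset.mem_filter.1 hw
    have hlt : A.min' hA < w := lt_of_le_of_ne (A.min'_le w hwA) (Ne.symm hne)
    have hS : (A.filter fun u => u < w).Nonempty := ⟨_, Finset.mem_filter.2 ⟨A.min'_mem hA, hlt⟩⟩
    have hm := Finset.max'_mem _ hS
    -- The hole ending at `w` begins at the predecessor of `w` in `A`; the value `w - 1` is missing
    -- because `w` is a left end.
    set u := (A.filter fun u => u < w).max' hS with hu
    rw [Finset.mem_filter] at hm
    have huw := Fin.lt_def.1 hm.2
    have hne1 : u.val + 1 ≠ w.val := fun h => hleft u h hm.1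
    refine ⟨(u, w), (mem_holes _).2 ⟨⟨hm.1, hwA⟩,
      ⟨⟨w.val - 1, by omega⟩, hleft _ (by simp; omega), ?_, ?_⟩, ?_⟩, rfl⟩
    · rw [Fin.lt_def]; simp; omega
    · rw [Fin.lt_def]; simp; omega
    · rintro ⟨v', h1, h2, h3⟩
      have := Finset.le_max' _ _ (Finset.mem_filter.2 ⟨h1, h3⟩ : v' ∈ A.filter fun u => u < w)
      exact absurd h2 (not_lt.2 this)

theorem card_holes_eq (hA : A.Nonempty) : (holes A).card = (ivlList A).length - 1 := by
  rw [length_ivlList, card_intervals, ← card_holes hA, Nat.add_sub_cancel]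

theorem Instance.numHoles_eq (I : Instance) : I.numHoles = holeCount I.lists := by
  unfold Instance.numHoles holeCount Instance.lists
  rw [List.map_map, Fin.sum_univ_def]
  congr 1
  exact List.map_congr_left fun x _ => card_holes_eq (I.dom_nonempty x)

theorem Instance.encode_eq (I : Instance) : I.encode =
    [I.N, (I.n : ℤ), (I.d : ℤ), (I.numHoles : ℤ)] ++ I.lists.flatMap encodeList := by
  unfold Instance.encode Instance.lists
  rw [List.flatMap_map]
  simp only [encodeDom_eq]

theorem Instance.separated (I : Instance) : ∀ L ∈ I.lists, Separated I.d L := by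
  intro L hL
  obtain ⟨x, -, rfl⟩ := List.mem_map.1 hL
  exact separated_ivlList (I.dom_nonempty x)

theorem Instance.length_lists (I : Instance) : I.lists.length = I.n := by
  simp [Instance.lists]

theorem hasVal_iff_ivlList {m : ℕ} : HasVal A m ↔ ∃ p ∈ ivlList A, p.1 ≤ m ∧ m ≤ p.2 := by
  constructor
  · intro h
    obtain ⟨a, b, h1, h2, h3⟩ := exists_isIvl h
    exact ⟨(a, b), mem_ivlList.2 h3, h1, h2⟩
  · rintro ⟨⟨a, b⟩, hp, h1, h2⟩
    exact (mem_ivlList.1 hp).mem m h1 h2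

/-- A solution is represented by the set of its values, shifted by one. The virtual point accounts
for the bound `N + 1`. -/
theorem Instance.consistent_iff (I : Instance) : I.Consistent ↔ Coverable I.d I.lists I.N := by
  constructor
  · rintro ⟨α, hα, hc⟩
    refine ⟨insert 0 ((Finset.univ.image α).image fun v => v.val + 1), ?_,
      Finset.mem_insert_self _ _, ?_, ?_⟩
    · intro v hv
      simp only [Finset.mem_insert, Finset.mem_image] at hv
      rw [Finset.mem_range]
      rcases hv with rfl | ⟨u, -, rfl⟩
      · omega
      · omega
    · have h1 := Finset.card_insert_le 0 ((Finset.univ.image α).image fun v => v.val + 1)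
      have h2 := Finset.card_image_le (s := Finset.univ.image α) (f := fun v => v.val + 1)
      omega
    · intro L hL
      obtain ⟨x, -, rfl⟩ := List.mem_map.1 hL
      obtain ⟨p, hp, h1, h2⟩ := hasVal_iff_ivlList.1 ((hasVal_val _).2 (hα x))
      refine ⟨p, hp, (α x).val + 1, Finset.mem_insert_of_mem (Finset.mem_image_of_mem _
        (Finset.mem_image_of_mem _ (Finset.mem_univ x))), ?_, ?_⟩ <;> omega
  · rintro ⟨S, hSd, h0, hc, hS⟩
    have h : ∀ x : Fin I.n, ∃ v : Fin I.d, v ∈ I.dom x ∧ v.val + 1 ∈ S := by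
      intro x
      obtain ⟨p, hp, v, hv, h1, h2⟩ := hS _ (List.mem_map_of_mem (List.mem_finRange x))
      obtain ⟨h3, h4⟩ := (hasVal_iff_ivlList (A := I.dom x) (m := v - 1)).2
        ⟨p, hp, by omega, by omega⟩
      refine ⟨⟨v - 1, h3⟩, h4, ?_⟩
      rw [Nat.sub_add_cancel (by omega)]
      exact hv
    choose α hα hαS using h
    refine ⟨α, hα, ?_⟩
    have h1 : (Finset.univ.image α).card ≤ (S.erase 0).card := by
      refine Finset.card_le_card_of_injOn (fun v => v.val + 1) ?_ ?_
      · intro v hv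
        obtain ⟨x, -, rfl⟩ := Finset.mem_image.1 (Finset.mem_coe.1 hv)
        exact Finset.mem_erase.2 ⟨Nat.succ_ne_zero _, hαS x⟩
      · intro u _ v _ huv
        exact Fin.ext (by simpa using huv)
    have h2 := Finset.card_erase_add_one h0
    omega

/-! ### Instances built from lists of intervals. -/

/-- The domain that is the union of the intervals of a list. -/
def listDom (d : ℕ) (L : List (ℕ × ℕ)) : Finset (Fin d) :=
  Finset.univ.filter fun v => ∃ p ∈ L, p.1 ≤ v.val ∧ v.val ≤ p.2

theorem Separated.hasVal_iff {L : List (ℕ × ℕ)} (hL : Separated d L) {m : ℕ} :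
    HasVal (listDom d L) m ↔ ∃ p ∈ L, p.1 ≤ m ∧ m ≤ p.2 := by
  unfold HasVal listDom
  simp only [Finset.mem_filter, Finset.mem_univ, true_and]
  constructor
  · rintro ⟨_, h⟩; exact h
  · rintro ⟨p, hp, h1, h2⟩
    exact ⟨h2.trans_lt (hL.lt p hp), p, hp, h1, h2⟩

theorem Separated.listDom_nonempty {L : List (ℕ × ℕ)} (hL : Separated d L) :
    (listDom d L).Nonempty := by
  obtain ⟨p, hp⟩ := List.exists_mem_of_ne_nil L hL.ne_nil
  obtain ⟨h, hv⟩ := hL.hasVal_iff.2 ⟨p, hp, le_rfl, hL.le p hp⟩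
  exact ⟨_, hv⟩

/-- An interval of the union cannot run from one listed interval into another, because the value
right after the first belongs to none of them. -/
theorem Separated.isIvl_iff {L : List (ℕ × ℕ)} (hL : Separated d L) {a b : ℕ} :
    IsIvl (listDom d L) a b ↔ (a, b) ∈ L := by
  have hsep : ∀ p ∈ L, ∀ q ∈ L, p ≠ q → p.2 + 1 < q.1 ∨ q.2 + 1 < p.1 := fun p hp q hq hne =>
    haveI : Std.Symm fun p q : ℕ × ℕ => p.2 + 1 < q.1 ∨ q.2 + 1 < p.1 := ⟨fun _ _ => Or.symm⟩
    (hL.pairwise.imp (S := fun p q : ℕ × ℕ => p.2 + 1 < q.1 ∨ q.2 + 1 < p.1) Or.inl).forall hp hq hne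
  constructor
  · rintro ⟨h1, h2, h3, h4⟩
    simp only [hL.hasVal_iff] at h2 h3 h4
    obtain ⟨p, hp, h5, h6⟩ := h2 a le_rfl h1
    have h7 : p.1 = a := by
      by_contra hne
      exact h3 (a - 1) (by omega) ⟨p, hp, by omega, by omega⟩
    have h8 : p.2 = b := by
      by_contra hne
      by_cases hlt : b < p.2
      · exact h4 ⟨p, hp, by omega, by omega⟩
      · obtain ⟨q, hq, h8, h9⟩ := h2 (p.2 + 1) (by omega) (by omega)
        have := hsep p hp q hq (fun h => by rw [h] at h9; omega)
        omega
    rw [← h7, ← h8]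
    exact hp
  · intro h
    have hab := hL.le _ h
    refine ⟨hab, fun m h1 h2 => hL.hasVal_iff.2 ⟨_, h, h1, h2⟩, fun m hm hv => ?_, fun hv => ?_⟩
    · obtain ⟨q, hq, h8, h9⟩ := hL.hasVal_iff.1 hv
      have := hsep _ h q hq (fun h => by rw [← h] at h8; simp at h8; omega)
      simp only at this hab
      omega
    · obtain ⟨q, hq, h8, h9⟩ := hL.hasVal_iff.1 hv
      have := hsep _ h q hq (fun h => by rw [← h] at h9; simp at h9)
      simp only at this hab
      omega

theorem Separated.pairwise_fst_lt {L : List (ℕ × ℕ)} (hL : Separated d L) :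
    L.Pairwise fun p q => p.1 < q.1 :=
  hL.pairwise.imp_of_mem fun {p q} hp _ h => by have := hL.le p hp; omega

theorem Separated.ivlList_listDom {L : List (ℕ × ℕ)} (hL : Separated d L) :
    ivlList (listDom d L) = L := by
  have h1 := (separated_ivlList hL.listDom_nonempty).pairwise_fst_lt
  have h2 := hL.pairwise_fst_lt
  have nd : ∀ {l : List (ℕ × ℕ)}, (l.Pairwise fun p q => p.1 < q.1) → l.Nodup := fun h =>
    h.imp fun {p q} hpq heq => by rw [heq] at hpq; exact lt_irrefl _ hpq
  refine List.Perm.eq_of_pairwise (le := fun p q : ℕ × ℕ => p.1 < q.1) ?_ h1 h2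
    ((List.perm_ext_iff_of_nodup (nd h1) (nd h2)).2 fun p => ?_)
  · intro p q _ _ h h'; omega
  · exact mem_ivlList.trans hL.isIvl_iff

/-- The instance with the given lists of intervals. -/
def Instance.ofLists (d : ℕ) (Ls : List (List (ℕ × ℕ))) (hL : ∀ L ∈ Ls, Separated d L) (N : ℤ) :
    Instance where
  n := Ls.length
  d := d
  dom x := listDom d Ls[x]
  dom_nonempty x := (hL _ (List.getElem_mem _)).listDom_nonempty
  N := N

theorem Instance.lists_ofLists (Ls : List (List (ℕ × ℕ))) (hL : ∀ L ∈ Ls, Separated d L) (N : ℤ) :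
    (Instance.ofLists d Ls hL N).lists = Ls := by
  unfold Instance.lists Instance.ofLists
  refine List.ext_getElem (by simp) fun i h1 h2 => ?_
  simp only [List.getElem_map, List.getElem_finRange]
  exact (hL _ (List.getElem_mem _)).ivlList_listDom

end Encode

/-! ### Reasoning about programs -/

/-- `p`, started in `s`, halts within `T` time units in a state with the property `Q`. -/
def Runs (w : ℕ) (p : Program) (s : State) (T : ℕ) (Q : State → Prop) : Prop :=
  ∃ t s', Exec w p s t s' ∧ t ≤ T ∧ Q s'

/-- The weakest precondition of a loop-free program. -/
def wp (w : ℕ) : Program → (State → Prop) → State → Prop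
  | .skip, Q, s => Q s
  | .assign r e, Q, s => (e.eval s).natAbs ≤ w ∧ Q (s.setReg r (e.eval s))
  | .store b e f, Q, s =>
      (e.eval s).natAbs ≤ w ∧ (f.eval s).natAbs ≤ w ∧ Q (s.setMem b (e.eval s) (f.eval s))
  | .seq p q, Q, s => wp w p (wp w q Q) s
  | .ite a p q, Q, s => (a.Holds s → wp w p Q s) ∧ (¬ a.Holds s → wp w q Q s)
  | .while _ _, _, _ => False

/-- A bound on the running time of a loop-free program. -/
def Program.maxCost : Program → ℕ
  | .skip => 1
  | .assign _ e => e.cost + 1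
  | .store _ e f => e.cost + f.cost + 1
  | .seq p q => p.maxCost + q.maxCost
  | .ite a p q => a.cost + (p.maxCost + q.maxCost) + 1
  | .while _ _ => 0

/-- Sequential composition. -/
def Program.seqs : List Program → Program
  | [] => .skip
  | [p] => p
  | p :: q :: ps => .seq p (seqs (q :: ps))

section Rules

variable {w : ℕ} {p q : Program} {s : State} {T T' : ℕ} {Q Q' : State → Prop}

theorem Runs.mono (h : Runs w p s T Q) (hT : T ≤ T') (hQ : ∀ s, Q s → Q' s) : Runs w p s T' Q' := by
  obtain ⟨t, s', h1, h2, h3⟩ := h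
  exact ⟨t, s', h1, h2.trans hT, hQ _ h3⟩

theorem Runs.seq (hp : Runs w p s T Q) (hq : ∀ s, Q s → Runs w q s T' Q') :
    Runs w (.seq p q) s (T + T') Q' := by
  obtain ⟨t, s', h1, h2, h3⟩ := hp
  obtain ⟨t', s'', h4, h5, h6⟩ := hq _ h3
  exact ⟨t + t', s'', .seq h1 h4, by omega, h6⟩

theorem wp_mono (h : ∀ s, Q s → Q' s) (hp : wp w p Q s) : wp w p Q' s := by
  induction p generalizing Q Q' s with
  | skip => exact h s hp
  | assign r e => exact ⟨hp.1, h _ hp.2⟩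
  | store b e f => exact ⟨hp.1, hp.2.1, h _ hp.2.2⟩
  | seq p q ihp ihq => exact ihp (fun s => ihq h) hp
  | ite a p q ihp ihq => exact ⟨fun ha => ihp h (hp.1 ha), fun ha => ihq h (hp.2 ha)⟩
  | _ => exact hp

/-- The value `0` of `maxCost` on loops is harmless, since `wp` of a loop is `False`. For a
conditional `maxCost` adds up both branches, which is more than either needs. -/
theorem runs_of_wp (h : wp w p Q s) : Runs w p s p.maxCost Q := by
  induction p generalizing Q s with
  | skip => exact ⟨1, s, .skip s, le_rfl, h⟩
  | assign r e => exact ⟨_, _, .assign s r e h.1, le_rfl, h.2⟩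
  | store b e f => exact ⟨_, _, .store s b e f h.1 h.2.1, le_rfl, h.2.2⟩
  | seq p q ihp ihq => exact (ihp h).seq fun s hs => ihq hs
  | ite a p q ihp ihq =>
    by_cases ha : a.Holds s
    · obtain ⟨t, s', h1, h2, h3⟩ := ihp (h.1 ha)
      exact ⟨_, s', .iteTrue ha h1, by simp only [Program.maxCost]; omega, h3⟩
    · obtain ⟨t, s', h1, h2, h3⟩ := ihq (h.2 ha)
      exact ⟨_, s', .iteFalse ha h1, by simp only [Program.maxCost]; omega, h3⟩
  | _ => exact h.elim

/-- The number `m` of iterations is fixed beforehand, so an invariant indexed by the iteration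
serves both for correctness and for summing the running time. -/
theorem runs_while {a : Test} (Inv : ℕ → State → Prop) (T : ℕ → ℕ) (m : ℕ) (h0 : Inv 0 s)
    (hstep : ∀ i < m, ∀ s, Inv i s → a.Holds s ∧ Runs w p s (T i) (Inv (i + 1)))
    (hend : ∀ s, Inv m s → ¬ a.Holds s) :
    Runs w (.while a p) s (∑ i ∈ Finset.range m, (T i + a.cost + 1) + a.cost + 1) (Inv m) := by
  induction m generalizing Inv T s with
  | zero => exact ⟨_, s, .whileFalse (hend s h0), by simp, h0⟩
  | succ m ih =>
    obtain ⟨ha, t₁, s₁, h1, h2, h3⟩ := hstep 0 (Nat.succ_pos m) s h0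
    obtain ⟨t₂, s₂, h4, h5, h6⟩ := ih (fun i => Inv (i + 1)) (fun i => T (i + 1)) h3
      (fun i hi => hstep (i + 1) (by omega)) hend
    refine ⟨_, s₂, .whileTrue ha h1 h4, ?_, h6⟩
    rw [Finset.sum_range_succ']
    omega

theorem runs_while_const {a : Test} (Inv : ℕ → State → Prop) (m : ℕ) (h0 : Inv 0 s)
    (hstep : ∀ i < m, ∀ s, Inv i s → a.Holds s ∧ wp w p (Inv (i + 1)) s)
    (hend : ∀ s, Inv m s → ¬ a.Holds s) :
    Runs w (.while a p) s ((m + 1) * (p.maxCost + a.cost + 1)) (Inv m) := by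
  refine (runs_while Inv (fun _ => p.maxCost) m h0
    (fun i hi s hs => ⟨(hstep i hi s hs).1, runs_of_wp (hstep i hi s hs).2⟩) hend).mono ?_
    fun _ => id
  rw [Finset.sum_const, Finset.card_range, smul_eq_mul, Nat.succ_mul]
  omega

end Rules

section StateLemmas

variable (s : State)

@[simp] theorem State.setReg_reg (r : ℕ) (z : ℤ) (q : ℕ) :
    (s.setReg r z).reg q = if q = r then z else s.reg q := Function.update_apply ..

@[simp] theorem State.setReg_mem (r : ℕ) (z : ℤ) : (s.setReg r z).mem = s.mem := rfl

@[simp] theorem State.setMem_reg (b : ℕ) (i z : ℤ) : (s.setMem b i z).reg = s.reg := rfl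

@[simp] theorem State.setMem_mem (b : ℕ) (i z : ℤ) (c : ℕ) :
    (s.setMem b i z).mem c = if c = b then Function.update (s.mem b) i z else s.mem c :=
  Function.update_apply ..

end StateLemmas

/-! ### Reading the input -/

/-- The address of the description of domain `x` in the input. -/
def inputPos (Ls : List (List (ℕ × ℕ))) (x : ℕ) : ℕ := 4 + ((Ls.take x).flatMap encodeList).length

/-- `inp` holds an instance with domains `Ls`. -/
structure HoldsInput (N : ℤ) (d : ℕ) (Ls : List (List (ℕ × ℕ))) (inp : ℤ → ℤ) : Prop where
  zero : inp 0 = N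
  one : inp 1 = Ls.length
  two : inp 2 = d
  three : inp 3 = holeCount Ls
  length : ∀ x (hx : x < Ls.length), inp (inputPos Ls x) = Ls[x].length
  fst : ∀ x (hx : x < Ls.length) j (hj : j < Ls[x].length),
    inp (inputPos Ls x + 1 + 2 * j) = Ls[x][j].1
  snd : ∀ x (hx : x < Ls.length) j (hj : j < Ls[x].length),
    inp (inputPos Ls x + 1 + 2 * j + 1) = Ls[x][j].2

section Input

variable {Ls : List (List (ℕ × ℕ))}

theorem length_encodeList (L : List (ℕ × ℕ)) : (encodeList L).length = 1 + 2 * L.length := by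
  simp [encodeList, List.length_flatMap]; ring

theorem inputPos_succ {x : ℕ} (hx : x < Ls.length) :
    inputPos Ls (x + 1) = inputPos Ls x + 1 + 2 * Ls[x].length := by
  unfold inputPos
  rw [← List.take_append_getElem hx, List.flatMap_append, List.length_append]
  simp [length_encodeList]; ring

theorem sum_length (hL : ∀ L ∈ Ls, L ≠ []) :
    (Ls.map List.length).sum = Ls.length + holeCount Ls := by
  unfold holeCount
  induction Ls with
  | nil => rfl
  | cons L Ls ih =>
    have ih := ih fun L h => hL L (List.mem_cons_of_mem _ h)
    have := List.length_pos_iff.2 (hL L (List.mem_cons_self ..))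
    simp only [List.map_cons, List.sum_cons, List.length_cons]
    omega

theorem inputPos_le (hL : ∀ L ∈ Ls, L ≠ []) (x : ℕ) :
    inputPos Ls x ≤ 4 + 3 * Ls.length + 2 * holeCount Ls := by
  have h1 : ((Ls.take x).flatMap encodeList).length ≤ (Ls.flatMap encodeList).length :=
    ((List.take_sublist x Ls).flatMap _).length_le
  have h2 : (Ls.flatMap encodeList).length = Ls.length + 2 * (Ls.map List.length).sum := by
    rw [List.length_flatMap]
    simp only [length_encodeList]
    clear h1 hL
    induction Ls with
    | nil => rfl
    | cons L Ls ih => simp only [List.map_cons, List.sum_cons, List.length_cons]; omega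
  rw [sum_length hL] at h2
  unfold inputPos
  omega

theorem getElem_flatMap_pair (L : List (ℕ × ℕ)) (g h : ℕ × ℕ → ℤ) (j : ℕ) (hj : j < L.length) :
    (L.flatMap fun p => [g p, h p])[2 * j]? = some (g L[j]) ∧
      (L.flatMap fun p => [g p, h p])[2 * j + 1]? = some (h L[j]) := by
  induction L generalizing j with
  | nil => simp at hj
  | cons p L ih =>
    cases j with
    | zero => simp
    | succ j =>
      have := ih j (by simpa using hj)
      simpa [Nat.mul_add, List.flatMap_cons] using this

theorem getElem?_flatMap_take {α : Type} {l : List α} {f : α → List ℤ} {x : ℕ} (hx : x < l.length)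
    {i : ℕ} (hi : i < (f l[x]).length) :
    (l.flatMap f)[((l.take x).flatMap f).length + i]? = (f l[x])[i]? := by
  have h1 : l = l.take x ++ l[x] :: l.drop (x + 1) := by simp
  conv_lhs => rw [h1]
  rw [List.flatMap_append, List.flatMap_cons, ← h1, List.getElem?_append_right (by omega),
    Nat.add_sub_cancel_left, List.getElem?_append_left hi]

theorem holdsInput_init (N : ℤ) (d : ℕ) (Ls : List (List (ℕ × ℕ))) :
    HoldsInput N d Ls ((State.init ([N, (Ls.length : ℤ), (d : ℤ), (holeCount Ls : ℤ)] ++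
      Ls.flatMap encodeList)).mem 0) := by
  set inp := (State.init ([N, (Ls.length : ℤ), (d : ℤ), (holeCount Ls : ℤ)] ++
      Ls.flatMap encodeList)).mem 0 with hinp
  have key : ∀ a : ℕ, inp a = ([N, (Ls.length : ℤ), (d : ℤ), (holeCount Ls : ℤ)] ++
      Ls.flatMap encodeList).getD a 0 := fun a => by
    simp [hinp, State.init]
  have key' : ∀ x (hx : x < Ls.length) i, i < (encodeList Ls[x]).length → ∀ z,
      (encodeList Ls[x])[i]? = some z → inp ((inputPos Ls x + i : ℕ) : ℤ) = z := by
    intro x hx i hi z hz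
    rw [key, List.getD_eq_getElem?_getD, List.getElem?_append_right (by simp [inputPos]; omega)]
    have : inputPos Ls x + i - [N, (Ls.length : ℤ), (d : ℤ), (holeCount Ls : ℤ)].length =
        ((Ls.take x).flatMap encodeList).length + i := by
      simp [inputPos]; omega
    rw [this, getElem?_flatMap_take hx hi, hz]
    rfl
  refine ⟨?_, ?_, ?_, ?_, fun x hx => ?_, fun x hx j hj => ?_, fun x hx j hj => ?_⟩
  · simpa using key 0
  · simpa using key 1
  · simpa using key 2
  · simpa using key 3
  · exact key' x hx 0 (by simp [length_encodeList]) _ (by simp [encodeList])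
  · have := key' x hx (2 * j + 1) (by rw [length_encodeList]; omega) _ (by
      simp only [encodeList, List.getElem?_cons_succ]
      exact (getElem_flatMap_pair _ _ _ j hj).1)
    rw [← this]; congr 1; push_cast; ring
  · have := key' x hx (2 * j + 1 + 1) (by rw [length_encodeList]; omega) _ (by
      simp only [encodeList, List.getElem?_cons_succ]
      exact (getElem_flatMap_pair _ _ _ j hj).2)
    rw [← this]; congr 1; push_cast; ring

end Input

/-! ### Loops over the intervals of the input -/

/-- The body of the loop over the intervals of a domain. -/
def ivlBody (p : Program) : Program := .seqs [
  .assign 8 (.load 0 (.reg 4)),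
  .assign 9 (.load 0 (.add (.reg 4) (.const 1))),
  p,
  .assign 4 (.add (.reg 4) (.const 2)),
  .assign 7 (.add (.reg 7) (.const 1))]

/-- What precedes the loop over the intervals of a domain. -/
def domHead (q : Program) : Program := .seqs [
  .assign 6 (.load 0 (.reg 4)),
  .assign 4 (.add (.reg 4) (.const 1)),
  .assign 7 (.const 0),
  q]

/-- The loop over the intervals of a domain. -/
def ivlLoop (p : Program) : Program := .while (.lt (.reg 7) (.reg 6)) (ivlBody p)

/-- The loop over all domains, which does `q` once for each domain and `p` for each interval. -/
def inputLoop (q p : Program) : Program :=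
  .seq (.seq (.assign 4 (.const 4)) (.assign 5 (.const 0)))
    (.while (.lt (.reg 5) (.reg 1))
      (.seq (domHead q) (.seq (ivlLoop p) (.assign 5 (.add (.reg 5) (.const 1))))))

/-- The control registers when `j` intervals of domain `x` have been processed. -/
structure AtIvl (Ls : List (List (ℕ × ℕ))) (inp : ℤ → ℤ) (x : ℕ) (hx : x < Ls.length) (j : ℕ)
    (s : State) : Prop where
  mem : s.mem 0 = inp
  reg1 : s.reg 1 = Ls.length
  reg4 : s.reg 4 = inputPos Ls x + 1 + 2 * j
  reg5 : s.reg 5 = x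
  reg6 : s.reg 6 = Ls[x].length
  reg7 : s.reg 7 = j

/-- The invariants `O`, between domains, and `J`, between intervals, need only be insensitive to the
control registers `4` to `9`. The intervals number the variables plus the holes in total, whence the
linear time bound although domains differ in length. -/
theorem runs_inputLoop {N : ℤ} {d w : ℕ} {Ls : List (List (ℕ × ℕ))} {inp : ℤ → ℤ}
    (hin : HoldsInput N d Ls inp) (hL : ∀ L ∈ Ls, L ≠ [])
    (hLd : ∀ L ∈ Ls, ∀ p ∈ L, p.1 < d ∧ p.2 < d)
    (hw : 5 + 3 * Ls.length + 2 * holeCount Ls + d ≤ w)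
    {q p : Program} (O : ℕ → State → Prop) (J : ℕ → ℕ → State → Prop)
    (hOreg : ∀ x s r z, 4 ≤ r → r ≤ 9 → O x s → O x (s.setReg r z))
    (hJreg : ∀ x j s r z, 4 ≤ r → r ≤ 9 → J x j s → J x j (s.setReg r z))
    (hq : ∀ x (hx : x < Ls.length) s, AtIvl Ls inp x hx 0 s → O x s →
      wp w q (fun s' => AtIvl Ls inp x hx 0 s' ∧ J x 0 s') s)
    (hp : ∀ x (hx : x < Ls.length) j (hj : j < Ls[x].length) s, AtIvl Ls inp x hx j s →
      s.reg 8 = Ls[x][j].1 → s.reg 9 = Ls[x][j].2 → J x j s →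
      wp w p (fun s' => AtIvl Ls inp x hx j s' ∧ J x (j + 1) s') s)
    (hJO : ∀ x (hx : x < Ls.length) s, J x Ls[x].length s → O (x + 1) s)
    {s : State} (h0 : O 0 s) (hmem : s.mem 0 = inp) (hreg : s.reg 1 = Ls.length) :
    Runs w (inputLoop q p) s
      ((q.maxCost + p.maxCost + 40) * (2 * Ls.length + holeCount Ls + 1))
      (fun s' => s'.mem 0 = inp ∧ s'.reg 1 = Ls.length ∧ O Ls.length s') := by
  have hwpos : ∀ x, inputPos Ls x ≤ 4 + 3 * Ls.length + 2 * holeCount Ls := inputPos_le hL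
  have hlen : ∀ x (hx : x < Ls.length), 1 + inputPos Ls x + 2 * Ls[x].length ≤
      4 + 3 * Ls.length + 2 * holeCount Ls := fun x hx => by
    have := hwpos (x + 1); rw [inputPos_succ hx] at this; omega
  -- the inner loop
  have hinner : ∀ x (hx : x < Ls.length) s, AtIvl Ls inp x hx 0 s ∧ J x 0 s →
      Runs w (ivlLoop p) s ((Ls[x].length + 1) * ((ivlBody p).maxCost + 4))
        (fun s => AtIvl Ls inp x hx Ls[x].length s ∧ J x Ls[x].length s) := by
    intro x hx s hs
    refine runs_while_const (fun j s => AtIvl Ls inp x hx j s ∧ J x j s) Ls[x].length hs ?_ ?_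
    · rintro j hj s ⟨hc, hJ⟩
      have hl := hlen x hx
      have hdj := hLd _ (List.getElem_mem hx) _ (List.getElem_mem hj)
      have h8 := hin.fst x hx j hj
      have h9 := hin.snd x hx j hj
      refine ⟨by simp [Test.Holds, Expr.eval, hc.reg7, hc.reg6]; omega, ?_⟩
      simp only [ivlBody, Program.seqs, wp, Expr.eval]
      have e8 : s.mem 0 (s.reg 4) = Ls[x][j].1 := by rw [hc.mem, hc.reg4, h8]
      have e9 : s.mem 0 (s.reg 4 + 1) = Ls[x][j].2 := by rw [hc.mem, hc.reg4, h9]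
      refine ⟨by rw [e8]; omega, by simp [e9]; omega, ?_⟩
      refine wp_mono ?_ (hp x hx j hj _ ⟨?_, ?_, ?_, ?_, ?_, ?_⟩ ?_ ?_
        (hJreg _ _ _ _ _ (by omega) (by omega) (hJreg _ _ _ _ _ (by omega) (by omega) hJ)))
      · rintro s ⟨hc, hJ⟩
        refine ⟨?_, ?_, ⟨?_, ?_, ?_, ?_, ?_, ?_⟩,
          hJreg _ _ _ _ _ (by omega) (by omega) (hJreg _ _ _ _ _ (by omega) (by omega) hJ)⟩
        · rw [hc.reg4]; omega
        · simp [hc.reg7]; omega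
        · simp [hc.mem]
        · simp [hc.reg1]
        · simp [hc.reg4]; ring
        · simp [hc.reg5]
        · simp [hc.reg6]
        · simp [hc.reg7]
      · simp [hc.mem]
      · simp [hc.reg1]
      · simp [hc.reg4]
      · simp [hc.reg5]
      · simp [hc.reg6]
      · simp [hc.reg7]
      · simp [e8]
      · simp [e9]
    · rintro s ⟨hc, -⟩
      simp [Test.Holds, Expr.eval, hc.reg7, hc.reg6]
  -- the outer loop
  let Inv : ℕ → State → Prop := fun x s => s.mem 0 = inp ∧ s.reg 1 = Ls.length ∧
    s.reg 4 = inputPos Ls x ∧ s.reg 5 = x ∧ O x s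
  -- The default `0` only makes the cost a total function of `x`; the indices that occur are in
  -- range.
  let T : ℕ → ℕ := fun x => (domHead q).maxCost +
    (((Ls.map List.length)[x]?.getD 0 + 1) * ((ivlBody p).maxCost + 4) + 4)
  have houter : Runs w (.while (.lt (.reg 5) (.reg 1))
      (.seq (domHead q) (.seq (ivlLoop p) (.assign 5 (.add (.reg 5) (.const 1))))))
      ((s.setReg 4 4).setReg 5 0)
      (∑ x ∈ Finset.range Ls.length, (T x + 3 + 1) + 3 + 1) (Inv Ls.length) := by
    refine runs_while Inv T Ls.length ?_ ?_ ?_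
    · refine ⟨by simp [hmem], by simp [hreg], by simp [inputPos], by simp, ?_⟩
      exact hOreg _ _ _ _ (by omega) (by omega) (hOreg _ _ _ _ (by omega) (by omega) h0)
    · rintro x hx s ⟨h1, h2, h3, h4, h5⟩
      refine ⟨by simp [Test.Holds, Expr.eval, h2, h4]; omega, ?_⟩
      have hl := hlen x hx
      have e6 : s.mem 0 (s.reg 4) = Ls[x].length := by rw [h1, h3, hin.length x hx]
      have hhead : Runs w (domHead q) s (domHead q).maxCost
          (fun s => AtIvl Ls inp x hx 0 s ∧ J x 0 s) := by
        refine runs_of_wp ?_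
        simp only [domHead, Program.seqs, wp, Expr.eval]
        refine ⟨by rw [e6]; omega, by simp [h3]; omega, by simp, hq x hx _ ⟨?_, ?_, ?_, ?_, ?_, ?_⟩
          (hOreg _ _ _ _ (by omega) (by omega) (hOreg _ _ _ _ (by omega) (by omega)
            (hOreg _ _ _ _ (by omega) (by omega) h5)))⟩
        · simp [h1]
        · simp [h2]
        · simp [h3]
        · simp [h4]
        · simp [e6]
        · simp
      refine (hhead.seq fun s hs => (hinner x hx s hs).seq (T' := 4) fun s hs =>
        ((runs_of_wp ?_).mono (by simp [Program.maxCost, Expr.cost]) fun _ => id)).mono ?_ fun _ => id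
      · obtain ⟨hc, hJ⟩ := hs
        simp only [wp, Expr.eval]
        refine ⟨by rw [hc.reg5]; omega, ?_, ?_, ?_, ?_, ?_⟩
        · simp [hc.mem]
        · simp [hc.reg1]
        · simp [hc.reg4, inputPos_succ hx]
        · simp [hc.reg5]
        · exact hOreg _ _ _ _ (by omega) (by omega) (hJO x hx s hJ)
      · simp [T, hx]
    · rintro s ⟨h1, h2, h3, h4, h5⟩
      simp [Test.Holds, Expr.eval, h2, h4]
  have hstart : Runs w (.seq (.assign 4 (.const 4)) (.assign 5 (.const 0))) s 4
      (fun s' => s' = (s.setReg 4 4).setReg 5 0) := by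
    refine (runs_of_wp ?_).mono (by simp [Program.maxCost, Expr.cost]) fun _ => id
    simp only [wp, Expr.eval]
    exact ⟨by simp; omega, by simp, trivial⟩
  refine (hstart.seq fun s hs => hs ▸ houter).mono ?_ fun s hs => ⟨hs.1, hs.2.1, hs.2.2.2.2⟩
  -- the running time
  have hsum : ∑ x ∈ Finset.range Ls.length, ((Ls.map List.length)[x]?.getD 0) =
      Ls.length + holeCount Ls := by
    have key : ∀ l : List ℕ, ∑ x ∈ Finset.range l.length, l[x]?.getD 0 = l.sum := fun l => by
      induction l with
      | nil => rfl
      | cons a l ih => simp [Finset.sum_range_succ', ih, add_comm]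
    rw [← sum_length hL, ← key, List.length_map]
  have hT : ∑ x ∈ Finset.range Ls.length, (T x + 3 + 1) =
      Ls.length * ((domHead q).maxCost + (ivlBody p).maxCost + 12) +
        (Ls.length + holeCount Ls) * ((ivlBody p).maxCost + 4) := by
    have : ∀ x, T x + 3 + 1 = ((domHead q).maxCost + (ivlBody p).maxCost + 12) +
        (Ls.map List.length)[x]?.getD 0 * ((ivlBody p).maxCost + 4) := fun x => by
      simp only [T]; ring
    simp only [this]
    rw [Finset.sum_add_distrib, ← Finset.sum_mul, hsum]
    simp
  rw [hT]
  have hb : (ivlBody p).maxCost = p.maxCost + 16 := by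
    simp [ivlBody, Program.seqs, Program.maxCost, Expr.cost]; ring
  have hh : (domHead q).maxCost = q.maxCost + 9 := by
    simp [domHead, Program.seqs, Program.maxCost, Expr.cost]; ring
  rw [hb, hh]
  nlinarith [Nat.zero_le (q.maxCost * Ls.length), Nat.zero_le (q.maxCost * holeCount Ls),
    Nat.zero_le (p.maxCost * Ls.length), Nat.zero_le (p.maxCost * holeCount Ls)]

/-! ### The phases of the program -/

/-- The constants of the run: the input in bank `0` and the head of the instance in registers. -/
structure Consts (N : ℤ) (d : ℕ) (Ls : List (List (ℕ × ℕ))) (inp : ℤ → ℤ) (s : State) : Prop where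
  mem0 : s.mem 0 = inp
  reg0 : s.reg 0 = N
  reg1 : s.reg 1 = Ls.length
  reg2 : s.reg 2 = d
  reg3 : s.reg 3 = holeCount Ls

/-- Bank cells `B v` hold `1` or `0` according to whether `S v` holds. -/
def Indicates (B : ℤ → ℤ) (S : ℕ → Prop) : Prop := ∀ v : ℕ, B v = 1 ∧ S v ∨ B v = 0 ∧ ¬ S v

section Basic

variable {N : ℤ} {d w : ℕ} {Ls : List (List (ℕ × ℕ))} {inp : ℤ → ℤ} {s : State}

theorem Consts.setReg (h : Consts N d Ls inp s) {r : ℕ} (hr : 4 ≤ r) (z : ℤ) :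
    Consts N d Ls inp (s.setReg r z) := by
  obtain ⟨h1, h2, h3, h4, h5⟩ := h
  constructor
  · exact h1
  all_goals rw [State.setReg_reg, if_neg (by omega)]; assumption

theorem Consts.setMem (h : Consts N d Ls inp s) {b : ℕ} (hb : b ≠ 0) (i z : ℤ) :
    Consts N d Ls inp (s.setMem b i z) := by
  obtain ⟨h1, h2, h3, h4, h5⟩ := h
  refine ⟨?_, h2, h3, h4, h5⟩
  rw [State.setMem_mem, if_neg hb.symm, h1]

theorem Indicates.eq_one_iff {B : ℤ → ℤ} {S : ℕ → Prop} (h : Indicates B S) (v : ℕ) :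
    B v = 1 ↔ S v := by
  rcases h v with ⟨h1, h2⟩ | ⟨h1, h2⟩
  · simp [h1, h2]
  · simp [h1, h2]

theorem Indicates.insert {B : ℤ → ℤ} {S : ℕ → Prop} (h : Indicates B S) (a : ℕ) :
    Indicates (Function.update B a 1) fun v => v = a ∨ S v := by
  intro v
  by_cases hv : v = a
  · subst hv; simp
  · have : (v : ℤ) ≠ a := by exact_mod_cast hv
    simpa [Function.update_of_ne this, hv] using h v

theorem Indicates.congr {B : ℤ → ℤ} {S S' : ℕ → Prop} (h : Indicates B S) (hS : ∀ v, S v ↔ S' v) :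
    Indicates B S' := fun v => by simpa only [hS] using h v

theorem wp_seq {p q : Program} {Q R : State → Prop} (hp : wp w p R s) (hq : ∀ s, R s → wp w q Q s) :
    wp w (.seq p q) Q s := wp_mono (p := p) hq hp

end Basic

/-! #### Reading the instance -/

/-- The part of the reading phase for one interval. -/
def readIvl : Program :=
  .ite (.eq (.reg 6) (.const 1))
    (.ite (.lt (.load 2 (.reg 8)) (.sub (.reg 2) (.reg 9)))
      (.store 2 (.reg 8) (.sub (.reg 2) (.reg 9))) .skip)
    (.seq (.store 3 (.reg 8) (.const 1)) (.store 3 (.add (.reg 9) (.const 1)) (.const 1)))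

/-- Bank `2` describes the intervals `T`, bank `3` the seeds `S`. -/
structure Parsed (N : ℤ) (d : ℕ) (Ls : List (List (ℕ × ℕ))) (inp : ℤ → ℤ) (T : ℕ × ℕ → Prop)
    (S : ℕ → Prop) (s : State) : Prop where
  consts : Consts N d Ls inp s
  ge : ∀ p, T p → (d : ℤ) - p.2 ≤ s.mem 2 p.1
  eq : ∀ a : ℕ, s.mem 2 a = 0 ∨ ∃ p, T p ∧ p.1 = a ∧ s.mem 2 a = d - p.2
  seed : Indicates (s.mem 3) S
  zero5 : ∀ a, s.mem 5 a = 0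
  zero7 : ∀ a, s.mem 7 a = 0
  zero8 : ∀ a, s.mem 8 a = 0
  zero9 : ∀ a, s.mem 9 a = 0

section Read

variable {N : ℤ} {d w : ℕ} {Ls : List (List (ℕ × ℕ))} {inp : ℤ → ℤ} {s : State}
  {T T' : ℕ × ℕ → Prop} {S S' : ℕ → Prop}

theorem Parsed.setReg (h : Parsed N d Ls inp T S s) {r : ℕ} (hr : 4 ≤ r) (z : ℤ) :
    Parsed N d Ls inp T S (s.setReg r z) :=
  ⟨h.consts.setReg hr z, h.ge, h.eq, h.seed, h.zero5, h.zero7, h.zero8, h.zero9⟩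

theorem Parsed.setMem_four (h : Parsed N d Ls inp T S s) (i z : ℤ) :
    Parsed N d Ls inp T S (s.setMem 4 i z) :=
  ⟨h.consts.setMem (by omega) _ _, h.ge, h.eq, h.seed, h.zero5, h.zero7, h.zero8, h.zero9⟩

theorem Parsed.congr (h : Parsed N d Ls inp T S s) (hT : ∀ p, T p ↔ T' p) (hS : ∀ v, S v ↔ S' v) :
    Parsed N d Ls inp T' S' s := by
  obtain rfl : T = T' := funext fun p => propext (hT p)
  obtain rfl : S = S' := funext fun p => propext (hS p)
  exact h

/-- Bank `2` stores `d - p.2` at the left end `p.1`, so that the least right end becomes a maximum.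
Since `p.2 < d` for the intervals that occur, the initial `0` stands for the absence of an interval.
-/
theorem Parsed.setMem_two (h : Parsed N d Ls inp T S s) (p : ℕ × ℕ)
    (hp : s.mem 2 p.1 < d - p.2) :
    Parsed N d Ls inp (fun q => T q ∨ q = p) S (s.setMem 2 p.1 (d - p.2)) := by
  refine ⟨h.consts.setMem (by omega) _ _, ?_, ?_, h.seed, h.zero5, h.zero7, h.zero8, h.zero9⟩
  · intro q hq
    rw [State.setMem_mem, if_pos rfl]
    by_cases hqp : q.1 = p.1
    · rw [hqp, Function.update_self]
      rcases hq with hq | rfl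
      · have := h.ge q hq; rw [hqp] at this; omega
      · exact le_rfl
    · rw [Function.update_of_ne (by exact_mod_cast hqp)]
      rcases hq with hq | rfl
      · exact h.ge q hq
      · exact absurd rfl hqp
  · intro a
    rw [State.setMem_mem, if_pos rfl]
    by_cases hqp : a = p.1
    · right
      exact ⟨p, Or.inr rfl, hqp.symm, by rw [hqp, Function.update_self]⟩
    · rw [Function.update_of_ne (by exact_mod_cast hqp)]
      rcases h.eq a with h1 | ⟨q, h1, h2⟩
      · exact Or.inl h1
      · exact Or.inr ⟨q, Or.inl h1, h2⟩

theorem Parsed.insert (h : Parsed N d Ls inp T S s) (p : ℕ × ℕ)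
    (hp : (d : ℤ) - p.2 ≤ s.mem 2 p.1) :
    Parsed N d Ls inp (fun q => T q ∨ q = p) S s := by
  refine ⟨h.consts, ?_, ?_, h.seed, h.zero5, h.zero7, h.zero8, h.zero9⟩
  · rintro q (hq | rfl)
    · exact h.ge q hq
    · exact hp
  · intro a
    rcases h.eq a with h1 | ⟨q, h1, h2⟩
    · exact Or.inl h1
    · exact Or.inr ⟨q, Or.inl h1, h2⟩

theorem Parsed.setMem_three (h : Parsed N d Ls inp T S s) (a : ℕ) :
    Parsed N d Ls inp T (fun v => v = a ∨ S v) (s.setMem 3 a 1) := by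
  refine ⟨h.consts.setMem (by omega) _ _, h.ge, h.eq, ?_, h.zero5, h.zero7, h.zero8, h.zero9⟩
  rw [State.setMem_mem, if_pos rfl]
  exact h.seed.insert a

theorem isSeed_take_succ {x : ℕ} (hx : x < Ls.length) (v : ℕ) :
    IsSeed (Ls.take (x + 1)) v ↔ IsSeed (Ls.take x) v ∨
      Ls[x].length ≠ 1 ∧ ∃ p ∈ Ls[x], v = p.1 ∨ v = p.2 + 1 := by
  unfold IsSeed
  rw [← List.take_append_getElem hx]
  simp only [List.mem_append, List.mem_singleton]
  constructor
  · rintro ⟨L, h1 | rfl, h2⟩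
    · exact Or.inl ⟨L, h1, h2⟩
    · exact Or.inr h2
  · rintro (⟨L, h1, h2⟩ | h2)
    · exact ⟨L, Or.inl h1, h2⟩
    · exact ⟨_, Or.inr rfl, h2⟩

theorem runs_read (hin : HoldsInput N d Ls inp) (hL : ∀ L ∈ Ls, Separated d L)
    (hw : 5 + 3 * Ls.length + 2 * holeCount Ls + d ≤ w)
    (h0 : Parsed N d Ls inp (fun _ => False) (fun _ => False) s) :
    Runs w (inputLoop .skip readIvl) s
      ((Program.skip.maxCost + readIvl.maxCost + 40) * (2 * Ls.length + holeCount Ls + 1))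
      (Parsed N d Ls inp (fun p => [p] ∈ Ls) (IsSeed Ls)) := by
  have hLd : ∀ L ∈ Ls, ∀ p ∈ L, p.1 < d ∧ p.2 < d := fun L hL' p hp => by
    have h1 := (hL L hL').le p hp
    have h2 := (hL L hL').lt p hp
    omega
  refine (runs_inputLoop hin (fun L h => (hL L h).ne_nil) hLd hw
    (O := fun x => Parsed N d Ls inp (fun p => [p] ∈ Ls.take x) (IsSeed (Ls.take x)))
    -- A hole-free domain contributes only to bank `2`, a domain with holes only to the seeds. The
    -- default `[]` lets the invariant be stated for every `x`.
    (J := fun x j => Parsed N d Ls inp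
      (fun p => [p] ∈ Ls.take x ∨ (Ls[x]?.getD []).length = 1 ∧ p ∈ (Ls[x]?.getD []).take j)
      (fun v => IsSeed (Ls.take x) v ∨ (Ls[x]?.getD []).length ≠ 1 ∧
        ∃ p ∈ (Ls[x]?.getD []).take j, v = p.1 ∨ v = p.2 + 1))
    (fun x s r z h1 h2 h => h.setReg h1 z) (fun x j s r z h1 h2 h => h.setReg h1 z)
    ?_ ?_ ?_ ?_ h0.consts.mem0 h0.consts.reg1).mono le_rfl ?_
  · intro x hx s hc hO
    exact ⟨hc, hO.congr (fun p => by simp) (fun v => by simp)⟩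
  · intro x hx j hj s hc h8 h9 hJ
    rw [List.getElem?_eq_getElem hx, Option.getD_some] at hJ ⊢
    obtain ⟨p, hp⟩ : ∃ p, Ls[x][j] = p := ⟨_, rfl⟩
    have htake : ∀ q, q ∈ Ls[x].take (j + 1) ↔ q ∈ Ls[x].take j ∨ q = p := fun q => by
      rw [← List.take_append_getElem hj, hp]; simp
    have hpd := hLd _ (List.getElem_mem hx) _ (List.getElem_mem hj)
    have h2 := hJ.consts.reg2
    rw [hp] at h8 h9 hpd
    simp only [readIvl, wp, Test.Holds, Expr.eval, h8, h9, h2, hc.reg6, State.setMem_reg]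
    refine ⟨fun h1 => ⟨fun hlt => ⟨by omega, by omega, ?_, ?_⟩, fun hlt => ⟨hc, ?_⟩⟩,
      fun h1 => ⟨by omega, by simp; omega, by omega, by simp; omega, ?_, ?_⟩⟩
    · exact ⟨by simp [hc.mem], hc.reg1, hc.reg4, hc.reg5, hc.reg6, hc.reg7⟩
    · have h1 : Ls[x].length = 1 := by exact_mod_cast h1
      exact (hJ.setMem_two p hlt).congr (fun q => by simp only [htake]; tauto)
        (fun v => by simp [h1])
    · have h1 : Ls[x].length = 1 := by exact_mod_cast h1
      exact (hJ.insert p (by omega)).congr (fun q => by simp only [htake]; tauto)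
        (fun v => by simp [h1])
    · exact ⟨by simp [hc.mem], hc.reg1, hc.reg4, hc.reg5, hc.reg6, hc.reg7⟩
    · have h1 : ¬ Ls[x].length = 1 := by exact_mod_cast h1
      have := (hJ.setMem_three p.1).setMem_three (p.2 + 1)
      push_cast at this
      refine Parsed.congr (T' := fun q => [q] ∈ Ls.take x ∨ Ls[x].length = 1 ∧ q ∈ Ls[x].take (j + 1))
        (S' := fun v => IsSeed (Ls.take x) v ∨ Ls[x].length ≠ 1 ∧
          ∃ p ∈ Ls[x].take (j + 1), v = p.1 ∨ v = p.2 + 1) this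
        (fun q => by simp [h1]) (fun v => ?_)
      simp only [htake, or_and_right, exists_or, exists_eq_left, ne_eq, h1, not_false_eq_true,
        true_and]
      generalize (∃ q ∈ Ls[x].take j, v = q.1 ∨ v = q.2 + 1) = C
      generalize (v = p.1) = A
      generalize (v = p.2 + 1) = B
      tauto
  · intro x hx s hJ
    rw [List.getElem?_eq_getElem hx, Option.getD_some, List.take_length] at hJ
    refine hJ.congr (fun p => ?_) (fun v => (isSeed_take_succ hx v).symm)
    rw [← List.take_append_getElem hx, List.mem_append, List.mem_singleton]
    refine or_congr_right ⟨?_, ?_⟩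
    · rintro ⟨h1, h2⟩
      obtain ⟨q, hq⟩ := List.length_eq_one_iff.1 h1
      rw [hq] at h2 ⊢
      rw [List.mem_singleton.1 h2]
    · intro h
      rw [← h]
      simp
  · exact h0.congr (fun p => by simp) (fun v => by simp [IsSeed])
  · rintro s ⟨-, -, h⟩
    simpa using h

end Read

/-! #### The jumps -/

/-- The computation of the jumps, backwards. -/
def jumpPhase : Program := .seq (.seqs [
    .store 4 (.add (.reg 2) (.const 1)) (.add (.reg 2) (.const 1)),
    .assign 10 (.reg 2),
    .assign 12 (.const 0)])
  (.while (.not (.lt (.reg 10) (.const 0))) (.seqs [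
    .ite (.lt (.reg 12) (.load 2 (.reg 10))) (.assign 12 (.load 2 (.reg 10))) .skip,
    .store 4 (.reg 10) (.sub (.add (.reg 2) (.const 1)) (.reg 12)),
    .assign 10 (.sub (.reg 10) (.const 1))]))

/-- `z` is the least right end of an interval of `T` that begins after `q`. -/
def NextVal (d : ℕ) (T : ℕ × ℕ → Prop) (q : ℕ) (z : ℤ) : Prop :=
  (∀ p, T p → q ≤ p.1 → z ≤ p.2 + 1) ∧ (z = d + 1 ∨ ∃ p, T p ∧ q ≤ p.1 ∧ z = p.2 + 1)

/-- The jumps stand in bank `4`. -/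
structure Jumps (N : ℤ) (d : ℕ) (Ls : List (List (ℕ × ℕ))) (inp : ℤ → ℤ) (nx : ℕ → ℕ)
    (s : State) : Prop where
  consts : Consts N d Ls inp s
  seed : Indicates (s.mem 3) (IsSeed Ls)
  jump : ∀ q ≤ d + 1, s.mem 4 q = nx q
  zero5 : ∀ a, s.mem 5 a = 0
  zero7 : ∀ a, s.mem 7 a = 0
  zero8 : ∀ a, s.mem 8 a = 0
  zero9 : ∀ a, s.mem 9 a = 0

theorem Program.seqs_cons (p q : Program) (ps : List Program) :
    Program.seqs (p :: q :: ps) = .seq p (.seqs (q :: ps)) := rfl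

/-- Going backwards, register `12` is the maximum of `d - p.2` over hole-free domains beginning at
or after the current point. Subtracted from `d + 1` it gives the least right end as a point, or `d +
1` if there is none. The cell at `d + 1` is a sentinel. -/
theorem runs_jump {N : ℤ} {d w : ℕ} {Ls : List (List (ℕ × ℕ))} {inp : ℤ → ℤ} {s : State}
    (hL : ∀ L ∈ Ls, Separated d L) (hw : d + 5 ≤ w)
    (h0 : Parsed N d Ls inp (fun p => [p] ∈ Ls) (IsSeed Ls) s) :
    Runs w jumpPhase s (40 * (d + 2))
      (fun s => ∃ nx, NextSpec d Ls nx ∧ Jumps N d Ls inp nx s) := by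
  have hLd : ∀ p : ℕ × ℕ, [p] ∈ Ls → p.1 < d ∧ p.2 < d := fun p hp => by
    have h1 := (hL _ hp).le p (by simp)
    have h2 := (hL _ hp).lt p (by simp)
    omega
  set T : ℕ × ℕ → Prop := fun p => [p] ∈ Ls with hT
  let Inv : ℕ → State → Prop := fun i s => Parsed N d Ls inp T (IsSeed Ls) s ∧
    s.reg 10 = d - i ∧
    (NextVal d T (d + 1 - i) (d + 1 - s.reg 12)) ∧
    (∀ q ≤ d, d < q + i → NextVal d T q (s.mem 4 q)) ∧ s.mem 4 ((d + 1 : ℕ) : ℤ) = d + 1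
  have hval : ∀ q z, NextVal d T q z → 0 < z ∧ z ≤ d + 1 := by
    rintro q z ⟨-, rfl | ⟨p, h1, h2, rfl⟩⟩
    · omega
    · have := hLd p h1; omega
  have hrest : Parsed N d Ls inp T (IsSeed Ls)
      (((s.setMem 4 (d + 1) (d + 1)).setReg 10 d).setReg 12 0) :=
    ((h0.setMem_four _ _).setReg (by omega) _).setReg (by omega) _
  have hpre : Runs w (.seqs [
      .store 4 (.add (.reg 2) (.const 1)) (.add (.reg 2) (.const 1)),
      .assign 10 (.reg 2), .assign 12 (.const 0)]) s 11 (Inv 0) := by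
    refine (runs_of_wp ?_).mono (by simp [Program.seqs, Program.maxCost, Expr.cost]) fun _ => id
    simp only [Program.seqs, wp, Expr.eval, h0.consts.reg2, State.setMem_reg]
    refine ⟨by omega, by omega, by omega, by simp, hrest, by simp, ?_, ?_, ?_⟩
    · refine ⟨fun p hp h => ?_, Or.inl (by simp)⟩
      have := hLd p hp
      omega
    · intro q h1 h2; omega
    · simp
  have hloop : ∀ s, Inv 0 s → Runs w (.while (.not (.lt (.reg 10) (.const 0))) (.seqs [
    .ite (.lt (.reg 12) (.load 2 (.reg 10))) (.assign 12 (.load 2 (.reg 10))) .skip,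
    .store 4 (.reg 10) (.sub (.add (.reg 2) (.const 1)) (.reg 12)),
    .assign 10 (.sub (.reg 10) (.const 1))])) s ((d + 1 + 1) * 27) (Inv (d + 1)) := by
    intro s hs
    refine (runs_while_const Inv (d + 1) hs ?_ ?_).mono
      (by simp [Program.seqs, Program.maxCost, Expr.cost, Test.cost]) fun _ => id
    · rintro i hi s ⟨h1, h2, h3, h4, h5⟩
      refine ⟨by simp [Test.Holds, Expr.eval, h2]; omega, ?_⟩
      have hq : s.reg 10 = ((d - i : ℕ) : ℤ) := by rw [h2]; omega
      have hi' : d + 1 - (i + 1) = d - i := by omega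
      have hge : ∀ p, T p → (d : ℤ) - p.2 ≤ s.mem 2 p.1 := h1.ge
      -- the bank after the maximum has been updated
      rw [Program.seqs_cons]
      refine wp_seq (R := fun s => Parsed N d Ls inp T (IsSeed Ls) s ∧
        s.reg 10 = ((d - i : ℕ) : ℤ) ∧ (NextVal d T (d - i) (d + 1 - s.reg 12)) ∧
        (∀ q ≤ d, d < q + i → NextVal d T q (s.mem 4 q)) ∧ s.mem 4 ((d + 1 : ℕ) : ℤ) = d + 1) ?_ ?_
      · have heq := h1.eq (d - i)
        have hb := hval _ _ h3
        have hsplit : ∀ p : ℕ × ℕ, d - i ≤ p.1 → p.1 = d - i ∨ d + 1 - i ≤ p.1 := fun p hp => by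
          omega
        simp only [wp, Test.Holds, Expr.eval, hq]
        refine ⟨fun hlt => ⟨?_, h1.setReg (by omega) _, by simp [hq], ⟨?_, ?_⟩, h4, h5⟩, fun hlt => ⟨h1, trivial, ⟨?_, ?_⟩, h4, h5⟩⟩
        · rcases heq with h | ⟨p, h6, h7, h8⟩
          · rw [h]; simp
          · rw [h8]; omega
        · intro p hp hle
          simp only [State.setReg_reg, if_true]
          rcases hsplit p hle with h | h
          · have := hge p hp
            rw [h] at this
            omega
          · have := h3.1 p hp h
            omega
        · simp only [State.setReg_reg, if_true]
          rcases heq with h | ⟨p, h6, h7, h8⟩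
          · rw [h]; simp
          · refine Or.inr ⟨p, h6, h7.ge, by rw [h8]; ring⟩
        · intro p hp hle
          rcases hsplit p hle with h | h
          · have := hge p hp
            rw [h] at this
            omega
          · exact h3.1 p hp h
        · rcases h3.2 with h | ⟨p, h6, h7, h8⟩
          · exact Or.inl h
          · exact Or.inr ⟨p, h6, by omega, h8⟩
      · rintro s ⟨h1, h2, h3, h4, h5⟩
        have hb := hval _ _ h3
        simp only [Program.seqs, wp, Expr.eval, h2, h1.consts.reg2, State.setMem_reg]
        refine ⟨by omega, by omega, by omega, ?_, ?_, ?_, ?_, ?_⟩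
        · exact (h1.setMem_four _ _).setReg (by omega) _
        · simp; omega
        · rw [hi']; simpa using h3
        · intro q hqd hqi
          simp only [State.setReg_mem, State.setMem_mem, if_true]
          by_cases hqq : q = d - i
          · rw [hqq, Function.update_self]; exact h3
          · rw [Function.update_of_ne (by exact_mod_cast hqq)]
            exact h4 q hqd (by omega)
        · simp only [State.setReg_mem, State.setMem_mem, if_true]
          rw [Function.update_of_ne (by omega)]
          exact h5
    · rintro s ⟨h1, h2, h3, h4, h5⟩
      simp [Test.Holds, Expr.eval, h2]
  refine (hpre.seq hloop).mono (by omega) ?_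
  rintro s' ⟨h1, h2, h3, h4, h5⟩
  refine ⟨fun q => (s'.mem 4 q).toNat, ⟨?_, ?_, ?_, ?_⟩, h1.consts, h1.seed,
    ?_, h1.zero5, h1.zero7, h1.zero8, h1.zero9⟩
  · intro q hq hqd
    rcases (h4 q hq (by omega)).2 with h | ⟨p, h6, h7, h8⟩
    · omega
    · exact ⟨p, h6, h7, by omega⟩
  · intro q p hp hle
    have := (h4 q (by have := hLd p hp; omega) (by omega)).1 p hp hle
    omega
  · intro q hq
    have := hval _ _ (h4 q hq (by omega))
    omega
  · rw [h5]; omega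
  · intro q hq
    by_cases hqd : q ≤ d
    · have := hval _ _ (h4 q hqd (by omega))
      omega
    · have : q = d + 1 := by omega
      rw [this, h5]
      omega

/-! #### Reached points and blocks -/

open Classical in
/-- The number of elements of block `i` below `m` with the property `A`. -/
noncomputable def countBelow (nx : ℕ → ℕ) (A : ℕ → Prop) (m i : ℕ) : ℕ :=
  ((Finset.range m).filter fun v => A v ∧ blk nx v = i).card

/-- Reached points, as far as they are seeds below `a` or images of points below `b`. -/
def ReachBelow (nx : ℕ → ℕ) (seed : ℕ → Prop) (a b u : ℕ) : Prop :=
  u = 0 ∨ (u < a ∧ seed u) ∨ ∃ x < b, Reach nx seed x ∧ nx x = u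

section Scan

variable {d : ℕ} {nx : ℕ → ℕ} {seed : ℕ → Prop}

theorem countBelow_succ_of {A : ℕ → Prop} {m : ℕ} (h : A m) (i : ℕ) :
    countBelow nx A (m + 1) i = countBelow nx A m i + if i = blk nx m then 1 else 0 := by
  classical
  unfold countBelow
  rw [Finset.range_add_one, Finset.filter_insert]
  by_cases hi : i = blk nx m
  · rw [if_pos ⟨h, hi.symm⟩, Finset.card_insert_of_notMem (by simp), if_pos hi]
  · rw [if_neg fun h => hi h.2.symm, if_neg hi, add_zero]

theorem countBelow_succ_of_not {A : ℕ → Prop} {m : ℕ} (h : ¬ A m) (i : ℕ) :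
    countBelow nx A (m + 1) i = countBelow nx A m i := by
  classical
  unfold countBelow
  rw [Finset.range_add_one, Finset.filter_insert, if_neg fun h' => h h'.1]

theorem countBelow_zero (A : ℕ → Prop) (i : ℕ) : countBelow nx A 0 i = 0 := rfl

theorem countBelow_le (A : ℕ → Prop) (m i : ℕ) : countBelow nx A m i ≤ m := by
  classical
  exact (Finset.card_filter_le _ _).trans (Finset.card_range m).le

/-- Jumps strictly increase, so every preimage of `u` is treated before `u`. The mark of a point is
final when the scan tests it. -/
theorem IsJump.reachBelow_iff (hj : IsJump d nx) (hs : ∀ v, seed v → v ≤ d) {a b u : ℕ}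
    (hu : u ≤ d) (hua : u < a) (hub : u ≤ b) : ReachBelow nx seed a b u ↔ Reach nx seed u := by
  constructor
  · rintro (rfl | ⟨-, h⟩ | ⟨x, -, h, rfl⟩)
    · exact .zero
    · exact .seed h
    · exact h.step
  · intro h
    cases h with
    | zero => exact Or.inl rfl
    | seed h => exact Or.inr (Or.inl ⟨hua, h⟩)
    | @step v h =>
      have hv : v ≤ d := by
        by_contra hcon
        have := hj.reach_le hs h
        have hv : v = d + 1 := by omega
        rw [hv, hj.top] at hu
        omega
      have := hj.lt v hv
      exact Or.inr (Or.inr ⟨v, by omega, h, rfl⟩)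

/-- Each block up to `d` has at least one point. This keeps block numbers within the word bound and
the loop over blocks linear. -/
theorem IsJump.blk_le (hj : IsJump d nx) {v : ℕ} (hv : v ≤ d) : blk nx v ≤ v := by
  have h1 : ∀ i, pt nx i ≤ d → i ≤ pt nx i := by
    intro i
    induction i with
    | zero => intro _; omega
    | succ i ih =>
      intro h
      have h2 := hj.pt_mono (Nat.le_succ i)
      have h3 := ih (h2.trans h)
      have h4 := hj.pt_lt_succ (h2.trans h)
      exact Nat.lt_of_le_of_lt h3 h4
  have h2 := (hj.le_blk_iff hv _).1 le_rfl
  exact (h1 _ (h2.trans hv)).trans h2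

end Scan

/-- The computation of the reached points, the blocks and their counts, forwards. -/
def scanBody : Program := .seqs [
  .ite (.eq (.reg 10) (.reg 12))
    (.seq (.assign 11 (.add (.reg 11) (.const 1))) (.assign 12 (.load 4 (.reg 10)))) .skip,
  .store 6 (.reg 10) (.reg 11),
  .ite (.eq (.load 3 (.reg 10)) (.const 1))
    (.seq (.store 5 (.reg 10) (.const 1))
      (.store 8 (.reg 11) (.add (.load 8 (.reg 11)) (.const 1)))) .skip,
  .ite (.eq (.load 5 (.reg 10)) (.const 1))
    (.seq (.store 5 (.load 4 (.reg 10)) (.const 1))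
      (.store 7 (.reg 11) (.add (.load 7 (.reg 11)) (.const 1)))) .skip,
  .assign 10 (.add (.reg 10) (.const 1))]

/-- The computation of the blocks, of the reached points, and of their numbers in each block. -/
def scanPhase : Program := .seq (.seqs [
    .store 5 (.const 0) (.const 1),
    .assign 10 (.const 0),
    .assign 11 (.const 0),
    .assign 12 (.load 4 (.const 0))])
  (.while (.not (.lt (.reg 2) (.reg 10))) scanBody)

/-- The state of the scan: the current point is `v`, the current block is that of `b`, bank `6` has
been written below `e`, seeds have been treated below `a`, and reached points below `c`. -/
structure Scan (N : ℤ) (d : ℕ) (Ls : List (List (ℕ × ℕ))) (inp : ℤ → ℤ) (nx : ℕ → ℕ)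
    (v b e a c : ℕ) (s : State) : Prop where
  consts : Consts N d Ls inp s
  seed : Indicates (s.mem 3) (IsSeed Ls)
  jump : ∀ q ≤ d + 1, s.mem 4 q = nx q
  point : s.reg 10 = v
  block : s.reg 11 = blk nx b
  next : s.reg 12 = pt nx (blk nx b + 1)
  mark : Indicates (s.mem 5) (ReachBelow nx (IsSeed Ls) a c)
  blocks : ∀ u < e, s.mem 6 u = blk nx u
  reached : ∀ i : ℕ, s.mem 7 i = countBelow nx (Reach nx (IsSeed Ls)) c i
  seeds : ∀ i : ℕ, s.mem 8 i = countBelow nx (IsSeed Ls) a i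
  zero9 : ∀ a, s.mem 9 a = 0

/-- The outcome of the scan. -/
structure Scanned (N : ℤ) (d : ℕ) (Ls : List (List (ℕ × ℕ))) (inp : ℤ → ℤ) (nx : ℕ → ℕ)
    (s : State) : Prop where
  consts : Consts N d Ls inp s
  jump : ∀ q ≤ d + 1, s.mem 4 q = nx q
  lastBlock : s.reg 11 = blk nx d
  mark : ∀ v ≤ d, s.mem 5 v = 1 ↔ Reach nx (IsSeed Ls) v
  blocks : ∀ u ≤ d, s.mem 6 u = blk nx u
  reached : ∀ i : ℕ, s.mem 7 i = blockCount d nx (Reach nx (IsSeed Ls)) i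
  seeds : ∀ i : ℕ, s.mem 8 i = blockCount d nx (IsSeed Ls) i

section ScanRuns

variable {N : ℤ} {d w : ℕ} {Ls : List (List (ℕ × ℕ))} {inp : ℤ → ℤ} {nx : ℕ → ℕ} {s : State}

/-- The parameters of `Scan` advance one at a time, one per instruction of the body. Seeds are
treated before the test for reached points, so that a seed is also counted as reached. -/
theorem wp_scanBody (hj : IsJump d nx) (hs : ∀ v, IsSeed Ls v → v ≤ d) (hw : d + 5 ≤ w) {v : ℕ}
    (hv : v ≤ d) (h : Scan N d Ls inp nx v (v - 1) v v v s) :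
    wp w scanBody (Scan N d Ls inp nx (v + 1) v (v + 1) (v + 1) (v + 1)) s := by
  have hblk := hj.blk_le hv
  unfold scanBody
  rw [Program.seqs_cons]
  refine wp_seq (R := Scan N d Ls inp nx v v v v v) ?_ fun s h => ?_
  · simp only [wp, Test.Holds, Expr.eval, h.point, h.next, h.block, State.setReg_mem, State.setReg_reg]
    -- The recursion for `blk` applies only to positive points. For `v = 0` the truncated `v - 1` is
    -- `0` itself, and the test for a new block fails.
    have hvblk : v ≠ 0 → blk nx v =
        if pt nx (blk nx (v - 1) + 1) ≤ v then blk nx (v - 1) + 1 else blk nx (v - 1) := by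
      intro h0
      obtain ⟨u, rfl⟩ : ∃ u, v = u + 1 := ⟨v - 1, by omega⟩
      rfl
    have hlt := ((hj.blk_eq_iff (show v - 1 ≤ d by omega) _).1 rfl).2
    refine ⟨fun he => ?_, fun he => ?_⟩
    · have he : v = pt nx (blk nx (v - 1) + 1) := by exact_mod_cast he
      have h0 : v ≠ 0 := by omega
      have hb : blk nx v = blk nx (v - 1) + 1 := by rw [hvblk h0, if_pos he.ge]
      have hnx : s.mem 4 v = pt nx (blk nx v + 1) := by
        rw [h.jump v (by omega), pt_succ, hb, ← he]
      have hpt := hj.pt_le (blk nx v + 1)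
      refine ⟨by omega, ?_, ?_⟩
      · simp [hnx]; omega
      · refine ⟨(h.consts.setReg (by omega) _).setReg (by omega) _, h.seed, h.jump, ?_, ?_, ?_, h.mark,
          h.blocks, h.reached, h.seeds, h.zero9⟩
        · simp [h.point]
        · simp [hb]
        · simp [hnx]
    · have hb : blk nx v = blk nx (v - 1) := by
        by_cases h0 : v = 0
        · rw [h0]
        · rw [hvblk h0, if_neg]
          intro hle
          have : v ≠ pt nx (blk nx (v - 1) + 1) := by exact_mod_cast he
          omega
      exact ⟨h.consts, h.seed, h.jump, h.point, by rw [hb, h.block], by rw [hb, h.next], h.mark,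
        h.blocks, h.reached, h.seeds, h.zero9⟩
  rw [Program.seqs_cons]
  refine wp_seq (R := Scan N d Ls inp nx v v (v + 1) v v) ?_ fun s h => ?_
  · simp only [wp, Expr.eval, h.point, h.block]
    refine ⟨by omega, by omega, h.consts.setMem (by omega) _ _, h.seed, h.jump, h.point, h.block,
      h.next, h.mark, fun u hu => ?_, h.reached, h.seeds, h.zero9⟩
    simp only [State.setMem_mem, if_true]
    by_cases huv : u = v
    · rw [huv, Function.update_self]
    · rw [Function.update_of_ne (by exact_mod_cast huv)]
      exact h.blocks u (by omega)
  rw [Program.seqs_cons]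
  refine wp_seq (R := Scan N d Ls inp nx v v (v + 1) (v + 1) v) ?_ fun s h => ?_
  · simp only [wp, Test.Holds, Expr.eval, h.point, h.block, h.seed.eq_one_iff, State.setMem_reg]
    have hiff : ∀ u, ReachBelow nx (IsSeed Ls) (v + 1) v u ↔
        (u = v ∧ IsSeed Ls v) ∨ ReachBelow nx (IsSeed Ls) v v u := by
      intro u
      unfold ReachBelow
      constructor
      · rintro (h1 | ⟨h1, h2⟩ | h1)
        · exact Or.inr (Or.inl h1)
        · by_cases huv : u = v
          · exact Or.inl ⟨huv, huv ▸ h2⟩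
          · exact Or.inr (Or.inr (Or.inl ⟨by omega, h2⟩))
        · exact Or.inr (Or.inr (Or.inr h1))
      · rintro (⟨rfl, h1⟩ | h1 | ⟨h1, h2⟩ | h1)
        · exact Or.inr (Or.inl ⟨by omega, h1⟩)
        · exact Or.inl h1
        · exact Or.inr (Or.inl ⟨by omega, h2⟩)
        · exact Or.inr (Or.inr h1)
    refine ⟨fun hsd => ?_, fun hsd => ?_⟩
    · have hcnt := h.seeds (blk nx v)
      have hle := countBelow_le (nx := nx) (IsSeed Ls) v (blk nx v)
      have e8 : (s.setMem 5 v 1).mem 8 (blk nx v) = countBelow nx (IsSeed Ls) v (blk nx v) := by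
        simp [hcnt]
      rw [e8]
      refine ⟨by omega, by simp; omega, by omega, by omega,
        (h.consts.setMem (by omega) _ _).setMem (by omega) _ _, h.seed, h.jump, h.point, h.block,
        h.next, ?_, h.blocks, h.reached, fun i => ?_, h.zero9⟩
      · refine (h.mark.insert v).congr fun u => ?_
        rw [hiff]
        simp [hsd]
      · simp only [State.setMem_mem, if_true]
        rw [countBelow_succ_of hsd]
        by_cases hi : i = blk nx v
        · rw [hi, Function.update_self]; simp
        · rw [Function.update_of_ne (by exact_mod_cast hi), if_neg hi]
          simpa using h.seeds i
    · refine ⟨h.consts, h.seed, h.jump, h.point, h.block, h.next, h.mark.congr fun u => ?_, h.blocks,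
        h.reached, fun i => ?_, h.zero9⟩
      · rw [hiff]; simp [hsd]
      · rw [countBelow_succ_of_not hsd]; exact h.seeds i
  rw [Program.seqs_cons]
  refine wp_seq (R := Scan N d Ls inp nx v v (v + 1) (v + 1) (v + 1)) ?_ fun s h => ?_
  · simp only [wp, Test.Holds, Expr.eval, h.point, h.block, h.mark.eq_one_iff, State.setMem_reg,
      hj.reachBelow_iff hs hv (Nat.lt_succ_self v) le_rfl]
    have hnx := h.jump v (by omega)
    have hnle := hj.le v hv
    have hiff : ∀ u, ReachBelow nx (IsSeed Ls) (v + 1) (v + 1) u ↔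
        (u = nx v ∧ Reach nx (IsSeed Ls) v) ∨ ReachBelow nx (IsSeed Ls) (v + 1) v u := by
      intro u
      unfold ReachBelow
      constructor
      · rintro (h1 | h1 | ⟨x, h1, h2, h3⟩)
        · exact Or.inr (Or.inl h1)
        · exact Or.inr (Or.inr (Or.inl h1))
        · by_cases hxv : x = v
          · subst hxv; exact Or.inl ⟨h3.symm, h2⟩
          · exact Or.inr (Or.inr (Or.inr ⟨x, by omega, h2, h3⟩))
      · rintro (⟨rfl, h1⟩ | h1 | h1 | ⟨x, h1, h2⟩)
        · exact Or.inr (Or.inr ⟨v, by omega, h1, rfl⟩)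
        · exact Or.inl h1
        · exact Or.inr (Or.inl h1)
        · exact Or.inr (Or.inr ⟨x, by omega, h2⟩)
    rw [hnx]
    refine ⟨fun hr => ?_, fun hr => ?_⟩
    · have hcnt := h.reached (blk nx v)
      have hle := countBelow_le (nx := nx) (Reach nx (IsSeed Ls)) v (blk nx v)
      have e7 : (s.setMem 5 (nx v) 1).mem 7 (blk nx v) =
          countBelow nx (Reach nx (IsSeed Ls)) v (blk nx v) := by
        simp [hcnt]
      rw [e7]
      refine ⟨by omega, by simp; omega, by omega, by omega,
        (h.consts.setMem (by omega) _ _).setMem (by omega) _ _, h.seed, h.jump, h.point, h.block,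
        h.next, ?_, h.blocks, fun i => ?_, h.seeds, h.zero9⟩
      · refine (h.mark.insert (nx v)).congr fun u => ?_
        rw [hiff]
        simp [hr]
      · simp only [State.setMem_mem, if_true]
        rw [countBelow_succ_of hr]
        by_cases hi : i = blk nx v
        · rw [hi, Function.update_self]; simp
        · rw [Function.update_of_ne (by exact_mod_cast hi), if_neg hi]
          simpa using h.reached i
    · refine ⟨h.consts, h.seed, h.jump, h.point, h.block, h.next, h.mark.congr fun u => ?_, h.blocks,
        fun i => ?_, h.seeds, h.zero9⟩
      · rw [hiff]; simp [hr]
      · rw [countBelow_succ_of_not hr]; exact h.reached i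
  simp only [Program.seqs, wp, Expr.eval, h.point]
  exact ⟨by omega, h.consts.setReg (by omega) _, h.seed, h.jump, by simp, by simp [h.block],
    by simp [h.next], h.mark, h.blocks, h.reached, h.seeds, h.zero9⟩

theorem runs_scan (hj : IsJump d nx) (hs : ∀ v, IsSeed Ls v → v ≤ d) (hw : d + 5 ≤ w)
    (h0 : Jumps N d Ls inp nx s) :
    Runs w scanPhase s (100 * (d + 2))
      (fun s => Scanned N d Ls inp nx s ∧ ∀ a, s.mem 9 a = 0) := by
  have hpre : Runs w (.seqs [
      .store 5 (.const 0) (.const 1), .assign 10 (.const 0), .assign 11 (.const 0),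
      .assign 12 (.load 4 (.const 0))]) s 10 (Scan N d Ls inp nx 0 (0 - 1) 0 0 0) := by
    refine (runs_of_wp ?_).mono (by simp [Program.seqs, Program.maxCost, Expr.cost]) fun _ => id
    have h4 : s.mem 4 0 = nx 0 := h0.jump 0 (by omega)
    have hle := hj.le 0 (Nat.zero_le _)
    simp only [Program.seqs, wp, Expr.eval]
    refine ⟨by simp, by simp; omega, by simp, by simp, by simp [h4]; omega, ?_, h0.seed, h0.jump, ?_,
      ?_, ?_, ?_, fun u hu => by omega, fun i => ?_, fun i => ?_, h0.zero9⟩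
    · exact (((h0.consts.setMem (by omega) _ _).setReg (by omega) _).setReg (by omega) _).setReg
        (by omega) _
    · simp
    · simp [blk]
    · simp [h4, blk, pt]
    · have hz : Indicates (s.mem 5) fun _ => False := fun v => Or.inr ⟨h0.zero5 v, id⟩
      refine (hz.insert 0).congr fun u => ?_
      simp [ReachBelow]
    · rw [countBelow_zero]; exact h0.zero7 i
    · rw [countBelow_zero]; exact h0.zero8 i
  have hcost : scanBody.maxCost ≤ 80 := by
    simp [scanBody, Program.seqs, Program.maxCost, Expr.cost, Test.cost]
  have hloop : ∀ s, Scan N d Ls inp nx 0 (0 - 1) 0 0 0 s →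
      Runs w (.while (.not (.lt (.reg 2) (.reg 10))) scanBody) s ((d + 1 + 1) * 85)
        (Scan N d Ls inp nx (d + 1) (d + 1 - 1) (d + 1) (d + 1) (d + 1)) := by
    intro s h
    refine (runs_while_const (fun v => Scan N d Ls inp nx v (v - 1) v v v) (d + 1) h ?_ ?_).mono
      (Nat.mul_le_mul_left _ (by simp [Test.cost, Expr.cost]; omega)) fun _ => id
    · intro v hv s h
      refine ⟨by simp [Test.Holds, Expr.eval, h.point, h.consts.reg2]; omega, ?_⟩
      exact wp_scanBody hj hs hw (by omega) h
    · intro s h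
      simp [Test.Holds, Expr.eval, h.point, h.consts.reg2]
  refine (hpre.seq hloop).mono (by omega) fun s h => ?_
  refine ⟨⟨h.consts, h.jump, by simpa using h.block, fun v hv => ?_,
    fun u hu => h.blocks u (by omega), h.reached, h.seeds⟩, h.zero9⟩
  rw [h.mark.eq_one_iff, hj.reachBelow_iff hs hv (by omega) (by omega)]

end ScanRuns

/-! #### Removable blocks -/

/-- The search for removable blocks. -/
def blockBody : Program := .seqs [
  .ite (.and (.and (.eq (.load 8 (.sub (.reg 10) (.const 1))) (.const 0))
        (.eq (.load 8 (.reg 10)) (.const 0)))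
      (.eq (.load 7 (.reg 10)) (.load 7 (.sub (.reg 10) (.const 1)))))
    (.seq (.store 9 (.reg 10) (.const 1)) (.assign 13 (.add (.reg 13) (.const 1)))) .skip,
  .assign 10 (.add (.reg 10) (.const 1))]

/-- All removable blocks are marked and counted. -/
def blockPhase : Program := .seq (.seq (.assign 13 (.const 0)) (.assign 10 (.const 1)))
  (.while (.not (.lt (.reg 11) (.reg 10))) blockBody)

/-- The removable blocks are marked in bank `9`. -/
structure BlocksMarked (N : ℤ) (d : ℕ) (Ls : List (List (ℕ × ℕ))) (inp : ℤ → ℤ) (nx : ℕ → ℕ)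
    (s : State) : Prop where
  consts : Consts N d Ls inp s
  jump : ∀ q ≤ d + 1, s.mem 4 q = nx q
  mark : ∀ v ≤ d, s.mem 5 v = 1 ↔ Reach nx (IsSeed Ls) v
  blocks : ∀ u ≤ d, s.mem 6 u = blk nx u
  removable : Indicates (s.mem 9) (Removable d nx (IsSeed Ls))
  removed : s.reg 13 = removedFrom d nx (IsSeed Ls) 0

section BlockRuns

variable {N : ℤ} {d w : ℕ} {Ls : List (List (ℕ × ℕ))} {inp : ℤ → ℤ} {nx : ℕ → ℕ} {s : State}

theorem Scanned.setReg (h : Scanned N d Ls inp nx s) {r : ℕ} (hr : 4 ≤ r) (hr' : r ≠ 11) (z : ℤ) :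
    Scanned N d Ls inp nx (s.setReg r z) :=
  ⟨h.consts.setReg hr z, h.jump, by rw [State.setReg_reg, if_neg hr'.symm]; exact h.lastBlock,
    h.mark, h.blocks, h.reached, h.seeds⟩

theorem Scanned.setMem_nine (h : Scanned N d Ls inp nx s) (i z : ℤ) :
    Scanned N d Ls inp nx (s.setMem 9 i z) :=
  ⟨h.consts.setMem (by omega) i z, h.jump, h.lastBlock, h.mark, h.blocks, h.reached, h.seeds⟩

-- The loop runs exactly over the blocks `1, …, blk nx d`, so the range conditions in `Removable`
-- hold automatically and only the counts are compared.
open Classical in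
theorem runs_block (hj : IsJump d nx) (hw : d + 5 ≤ w) (h0 : Scanned N d Ls inp nx s)
    (hz : ∀ a, s.mem 9 a = 0) :
    Runs w blockPhase s (50 * (d + 2)) (BlocksMarked N d Ls inp nx) := by
  have hblk := hj.blk_le (le_refl d)
  let cnt : ℕ → ℕ := fun t =>
    ((Finset.range (t + 1)).filter fun i => Removable d nx (IsSeed Ls) i).card
  let Inv : ℕ → State → Prop := fun t s => Scanned N d Ls inp nx s ∧ s.reg 10 = t + 1 ∧
    Indicates (s.mem 9) (fun i => i ≤ t ∧ Removable d nx (IsSeed Ls) i) ∧ s.reg 13 = cnt t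
  have hnot0 : ¬ Removable d nx (IsSeed Ls) 0 := fun h => by have := h.1; omega
  have hpre : Runs w (.seq (.assign 13 (.const 0)) (.assign 10 (.const 1))) s 4 (Inv 0) := by
    refine (runs_of_wp ?_).mono (by simp [Program.maxCost, Expr.cost]) fun _ => id
    simp only [wp, Expr.eval]
    refine ⟨by simp, by simp; omega, (h0.setReg (by omega) (by omega) _).setReg (by omega) (by omega) _,
      by simp, ?_, ?_⟩
    · intro i
      refine Or.inr ⟨hz i, ?_⟩
      rintro ⟨h1, h2⟩
      obtain rfl : i = 0 := by omega
      exact hnot0 h2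
    · simp [cnt, Finset.filter_singleton, hnot0]
  have hcost : blockBody.maxCost ≤ 35 := by
    simp [blockBody, Program.seqs, Program.maxCost, Expr.cost, Test.cost]
  have hloop : ∀ s, Inv 0 s → Runs w (.while (.not (.lt (.reg 11) (.reg 10))) blockBody) s
      ((blk nx d + 1) * 40) (Inv (blk nx d)) := by
    intro s hs
    refine (runs_while_const Inv (blk nx d) hs ?_ ?_).mono
      (Nat.mul_le_mul_left _ (by simp [Test.cost, Expr.cost]; omega)) fun _ => id
    · rintro t ht s ⟨h1, h2, h3, h4⟩
      have h11 := h1.lastBlock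
      refine ⟨by simp [Test.Holds, Expr.eval, h2, h11]; omega, ?_⟩
      have h2' : s.reg 10 = ((t + 1 : ℕ) : ℤ) := by rw [h2]; push_cast; rfl
      have hrem : Removable d nx (IsSeed Ls) (t + 1) ↔
          (blockCount d nx (IsSeed Ls) t = 0 ∧ blockCount d nx (IsSeed Ls) (t + 1) = 0) ∧
            blockCount d nx (Reach nx (IsSeed Ls)) (t + 1) =
              blockCount d nx (Reach nx (IsSeed Ls)) t := by
        unfold Removable
        rw [Nat.add_sub_cancel]
        constructor
        · rintro ⟨-, -, h1, h2, h3⟩; exact ⟨⟨h1, h2⟩, h3⟩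
        · rintro ⟨⟨h1, h2⟩, h3⟩; exact ⟨by omega, ht, h1, h2, h3⟩
      have hcnt : cnt (t + 1) = cnt t + if Removable d nx (IsSeed Ls) (t + 1) then 1 else 0 := by
        simp only [cnt]
        rw [Finset.range_add_one (n := t + 1), Finset.filter_insert]
        split_ifs with h
        · rw [Finset.card_insert_of_notMem (by simp)]
        · rfl
      have hcle : cnt t ≤ t + 1 := (Finset.card_filter_le _ _).trans (Finset.card_range _).le
      have hcond : ((((blockCount d nx (IsSeed Ls) t : ℕ) : ℤ) = 0 ∧
          ((blockCount d nx (IsSeed Ls) (t + 1) : ℕ) : ℤ) = 0) ∧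
          ((blockCount d nx (Reach nx (IsSeed Ls)) (t + 1) : ℕ) : ℤ) =
            (blockCount d nx (Reach nx (IsSeed Ls)) t : ℕ)) ↔ Removable d nx (IsSeed Ls) (t + 1) := by
        rw [hrem]; norm_cast
      have hsub : ((t + 1 : ℕ) : ℤ) - 1 = (t : ℕ) := by push_cast; ring
      simp only [blockBody, Program.seqs, wp, Test.Holds, Expr.eval, h2', State.setMem_reg,
        State.setReg_reg, h1.seeds, h1.reached, hsub, hcond]
      refine ⟨fun hr => ⟨by omega, by simp; omega, by rw [h4]; omega, by simp; omega, ?_, ?_, ?_, ?_⟩,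
        fun hr => ⟨by omega, h1.setReg (by omega) (by omega) _, ?_, ?_, ?_⟩⟩
      · exact ((h1.setMem_nine _ _).setReg (by omega) (by omega) _).setReg (by omega) (by omega) _
      · simp
      · have := h3.insert (t + 1)
        simp only [State.setReg_mem, State.setMem_mem, if_true]
        refine this.congr fun i => ?_
        constructor
        · rintro (rfl | ⟨h5, h6⟩)
          · exact ⟨le_rfl, hr⟩
          · exact ⟨by omega, h6⟩
        · rintro ⟨h5, h6⟩
          by_cases hi : i = t + 1
          · exact Or.inl hi
          · exact Or.inr ⟨by omega, h6⟩
      · simp [hcnt, hr, h4]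
      · simp
      · refine h3.congr fun i => ?_
        constructor
        · rintro ⟨h5, h6⟩
          exact ⟨by omega, h6⟩
        · rintro ⟨h5, h6⟩
          refine ⟨?_, h6⟩
          by_contra hcon
          obtain rfl : i = t + 1 := by omega
          exact hr h6
      · simp [hcnt, hr, h4]
    · rintro s ⟨h1, h2, h3, h4⟩
      simp [Test.Holds, Expr.eval, h2, h1.lastBlock]
  refine (hpre.seq hloop).mono (by omega) ?_
  rintro s ⟨h1, h2, h3, h4⟩
  refine ⟨h1.consts, h1.jump, h1.mark, h1.blocks,
    h3.congr fun i => ⟨fun h => h.2, fun h => ⟨h.2.1, h⟩⟩, ?_⟩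
  rw [h4]
  simp [cnt, removedFrom]

end BlockRuns

/-! #### Ranks -/

/-- The computation of the ranks. -/
def rankBody : Program := .seqs [
  .ite (.and (.eq (.load 5 (.reg 10)) (.const 1)) (.eq (.load 9 (.load 6 (.reg 10))) (.const 0)))
    (.assign 12 (.add (.reg 12) (.const 1))) .skip,
  .store 10 (.reg 10) (.reg 12),
  .assign 10 (.add (.reg 10) (.const 1))]

/-- The ranks of all points are computed. -/
def rankPhase : Program := .seq (.seqs [
    .store 10 (.const 0) (.const 0), .assign 12 (.const 0), .assign 10 (.const 1)])
  (.while (.not (.lt (.reg 2) (.reg 10))) rankBody)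

/-- The kept points of an instance. -/
noncomputable def kernelPoints (d : ℕ) (Ls : List (List (ℕ × ℕ))) (nx : ℕ → ℕ) : Finset ℕ :=
  keptPoints d nx (IsSeed Ls) (InRemovable d nx (IsSeed Ls))

/-- The ranks of the points stand in bank `10`. -/
structure Ranked (N : ℤ) (d : ℕ) (Ls : List (List (ℕ × ℕ))) (inp : ℤ → ℤ) (nx : ℕ → ℕ)
    (t : ℕ) (s : State) : Prop where
  marked : BlocksMarked N d Ls inp nx s
  rank : ∀ v ≤ t, s.mem 10 v = rank (kernelPoints d Ls nx) v

section RankRuns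

variable {N : ℤ} {d w : ℕ} {Ls : List (List (ℕ × ℕ))} {inp : ℤ → ℤ} {nx : ℕ → ℕ} {s : State}

theorem BlocksMarked.setReg (h : BlocksMarked N d Ls inp nx s) {r : ℕ} (hr : 4 ≤ r) (hr' : r ≠ 13)
    (z : ℤ) : BlocksMarked N d Ls inp nx (s.setReg r z) :=
  ⟨h.consts.setReg hr z, h.jump, h.mark, h.blocks, h.removable, by
    rw [State.setReg_reg, if_neg hr'.symm]; exact h.removed⟩

theorem BlocksMarked.setMem (h : BlocksMarked N d Ls inp nx s) {b : ℕ} (hb : b = 1 ∨ 10 ≤ b)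
    (i z : ℤ) : BlocksMarked N d Ls inp nx (s.setMem b i z) := by
  have hm : ∀ c, c ≠ b → (s.setMem b i z).mem c = s.mem c := fun c hc => by
    rw [State.setMem_mem, if_neg hc]
  refine ⟨h.consts.setMem (by omega) i z, ?_, ?_, ?_, ?_, h.removed⟩
  · rw [hm 4 (by omega)]; exact h.jump
  · rw [hm 5 (by omega)]; exact h.mark
  · rw [hm 6 (by omega)]; exact h.blocks
  · rw [hm 9 (by omega)]; exact h.removable

/-- The test whether a point is kept. -/
theorem BlocksMarked.kept_iff (h : BlocksMarked N d Ls inp nx s) {v : ℕ} (hv : v ≤ d) :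
    (s.mem 5 v = 1 ∧ s.mem 9 (s.mem 6 v) = 0) ↔ v ∈ kernelPoints d Ls nx := by
  unfold kernelPoints
  rw [mem_keptPoints, h.mark v hv, h.blocks v hv, InRemovable]
  rcases h.removable (blk nx v) with ⟨h1, h2⟩ | ⟨h1, h2⟩
  · simp [h1, h2]
  · simp [h1, h2, hv]

theorem rank_le (K : Finset ℕ) (v : ℕ) : rank K v ≤ v := by
  induction v with
  | zero => exact le_rfl
  | succ v ih => rw [rank]; split_ifs <;> omega

theorem runs_rank (hw : d + 5 ≤ w) (h0 : BlocksMarked N d Ls inp nx s) :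
    Runs w rankPhase s (50 * (d + 2)) (Ranked N d Ls inp nx d) := by
  let Inv : ℕ → State → Prop := fun t s => Ranked N d Ls inp nx t s ∧ s.reg 10 = t + 1 ∧
    s.reg 12 = rank (kernelPoints d Ls nx) t
  have hpre : Runs w (.seqs [
      .store 10 (.const 0) (.const 0), .assign 12 (.const 0), .assign 10 (.const 1)]) s 10
      (Inv 0) := by
    refine (runs_of_wp ?_).mono (by simp [Program.seqs, Program.maxCost, Expr.cost]) fun _ => id
    simp only [Program.seqs, wp, Expr.eval]
    refine ⟨by simp, by simp, by simp, by simp; omega, ⟨?_, ?_⟩, by simp, by simp [rank]⟩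
    · exact ((h0.setMem (by omega) _ _).setReg (by omega) (by omega) _).setReg (by omega)
        (by omega) _
    · intro v hv
      obtain rfl : v = 0 := by omega
      simp [rank]
  have hloop : ∀ s, Inv 0 s → Runs w (.while (.not (.lt (.reg 2) (.reg 10))) rankBody) s ((d + 1) * 40)
      (Inv d) := by
    intro s hs
    refine (runs_while_const Inv d hs ?_ ?_).mono (Nat.mul_le_mul_left _ (by
      simp [rankBody, Program.seqs, Program.maxCost, Expr.cost, Test.cost])) fun _ => id
    · rintro t ht s ⟨h1, h2, h3⟩
      have hr := h1.marked.consts.reg2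
      refine ⟨by simp [Test.Holds, Expr.eval, h2, hr]; omega, ?_⟩
      have h2' : s.reg 10 = ((t + 1 : ℕ) : ℤ) := by rw [h2]; push_cast; rfl
      have hle := rank_le (kernelPoints d Ls nx) (t + 1)
      unfold rankBody
      rw [Program.seqs_cons]
      refine wp_seq (R := fun s => Ranked N d Ls inp nx t s ∧ s.reg 10 = ((t + 1 : ℕ) : ℤ) ∧
        s.reg 12 = rank (kernelPoints d Ls nx) (t + 1)) ?_ ?_
      · simp only [wp, Test.Holds, Expr.eval, h2', h1.marked.kept_iff (show t + 1 ≤ d by omega)]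
        refine ⟨fun hk => ⟨?_, ⟨h1.marked.setReg (by omega) (by omega) _, h1.rank⟩, by simp [h2], ?_⟩,
          fun hk => ⟨h1, trivial, ?_⟩⟩
        · rw [rank, if_pos hk] at hle; rw [h3]; omega
        · simp [h3, rank, hk]
        · simp [h3, rank, hk]
      · rintro s ⟨h1, h2, h3⟩
        simp only [Program.seqs, wp, Expr.eval, h2, h3, State.setMem_reg]
        refine ⟨by omega, by omega, by omega, ⟨(h1.marked.setMem (by omega) _ _).setReg (by omega)
          (by omega) _, ?_⟩, by simp, by simp [h3]⟩
        intro v hv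
        simp only [State.setReg_mem, State.setMem_mem, if_true]
        by_cases hvt : v = t + 1
        · rw [hvt, Function.update_self]
        · rw [Function.update_of_ne (by exact_mod_cast hvt)]
          exact h1.rank v (by omega)
    · rintro s ⟨h1, h2, h3⟩
      simp [Test.Holds, Expr.eval, h2, h1.marked.consts.reg2]
  exact (hpre.seq hloop).mono (by omega) fun s h => h.1

end RankRuns

/-! #### Writing the output -/

/-- The sequence `E` stands in bank `1` from address `4` on, and register `14` points behind it. -/
structure Wrote (E : List ℤ) (s : State) : Prop where
  ptr : s.reg 14 = 4 + E.length
  get : ∀ i (h : i < E.length), s.mem 1 (4 + i) = E[i]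

/-- Append the value of `e` to the output. -/
def emit (e : Expr) : Program := .seq (.store 1 (.reg 14) e) (.assign 14 (.add (.reg 14) (.const 1)))

/-- The state after `z` has been appended to the output. -/
def State.push (s : State) (z : ℤ) : State := (s.setMem 1 (s.reg 14) z).setReg 14 (s.reg 14 + 1)

/-- The successor of a point among the kept ones. -/
noncomputable def kernelNext (d : ℕ) (Ls : List (List (ℕ × ℕ))) (nx : ℕ → ℕ) : ℕ → ℕ :=
  skipBad d nx (InRemovable d nx (IsSeed Ls))

section Emit

variable {N : ℤ} {d w : ℕ} {Ls : List (List (ℕ × ℕ))} {inp : ℤ → ℤ} {nx : ℕ → ℕ} {s : State}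
  {E : List ℤ}

theorem Wrote.push (h : Wrote E s) (z : ℤ) : Wrote (E ++ [z]) (s.push z) := by
  refine ⟨by simp [State.push, h.ptr]; ring, fun i hi => ?_⟩
  simp only [State.push, State.setReg_mem, State.setMem_mem, if_true, h.ptr]
  rw [List.length_append, List.length_singleton] at hi
  by_cases hi' : i = E.length
  · subst hi'; simp
  · rw [Function.update_of_ne (by omega), h.get i (by omega), List.getElem_append_left]

theorem Wrote.setReg (h : Wrote E s) {r : ℕ} (hr : r ≠ 14) (z : ℤ) : Wrote E (s.setReg r z) :=
  ⟨by rw [State.setReg_reg, if_neg hr.symm, h.ptr], h.get⟩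

theorem Wrote.setMem (h : Wrote E s) {b : ℕ} (hb : b ≠ 1) (i z : ℤ) : Wrote E (s.setMem b i z) :=
  ⟨h.ptr, fun j hj => by rw [State.setMem_mem, if_neg hb.symm, h.get j hj]⟩

theorem wp_emit {e : Expr} {Q : State → Prop} (h : Wrote E s) {z : ℤ} (hz : e.eval s = z)
    (hw : 5 + E.length ≤ w) (hzw : z.natAbs ≤ w) (hQ : Q (s.push z)) : wp w (emit e) Q s := by
  simp only [emit, wp, Expr.eval, hz, State.setMem_reg]
  refine ⟨?_, hzw, ?_, hQ⟩
  · rw [h.ptr]; omega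
  · rw [h.ptr]; omega

theorem State.push_reg (s : State) (z : ℤ) {r : ℕ} (hr : r ≠ 14) : (s.push z).reg r = s.reg r := by
  rw [State.push, State.setReg_reg, if_neg hr, State.setMem_reg]

theorem State.push_mem (s : State) (z : ℤ) {b : ℕ} (hb : b ≠ 1) : (s.push z).mem b = s.mem b := by
  rw [State.push, State.setReg_mem, State.setMem_mem, if_neg hb]

theorem Ranked.setReg {t : ℕ} (h : Ranked N d Ls inp nx t s) {r : ℕ} (hr : 4 ≤ r) (hr' : r ≠ 13)
    (z : ℤ) : Ranked N d Ls inp nx t (s.setReg r z) :=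
  ⟨h.marked.setReg hr hr' z, h.rank⟩

theorem Ranked.setMem {t : ℕ} (h : Ranked N d Ls inp nx t s) {b : ℕ} (hb : b = 1 ∨ 11 ≤ b)
    (i z : ℤ) : Ranked N d Ls inp nx t (s.setMem b i z) :=
  ⟨h.marked.setMem (by omega) i z, fun v hv => by
    rw [State.setMem_mem, if_neg (by omega)]; exact h.rank v hv⟩

theorem Ranked.push {t : ℕ} (h : Ranked N d Ls inp nx t s) (z : ℤ) :
    Ranked N d Ls inp nx t (s.push z) :=
  (h.setMem (Or.inl rfl) _ _).setReg (by omega) (by omega) _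

theorem kernel_pointSystem (hj : IsJump d nx) (hs : ∀ v, IsSeed Ls v → v ≤ d) :
    PointSystem d (kernelPoints d Ls nx) (kernelNext d Ls nx) := by
  have := hj.pointSystem hs 0
  rwa [badFrom_zero] at this

/-! ##### Required domains -/

theorem requiredDoms_succ (d : ℕ) (K : Finset ℕ) (f : ℕ → ℕ) (t : ℕ) :
    requiredDoms d K f (t + 1) = requiredDoms d K f t ++
      if d - t ∈ K ∧ f (d - t) ≤ d then [[renameIvl K (d - t, f (d - t) - 1)]] else [] := by
  unfold requiredDoms
  rw [List.range_succ, List.filter_append, List.map_append]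
  congr 1
  by_cases h : d - t ∈ K ∧ f (d - t) ≤ d
  · rw [if_pos h, List.filter_cons_of_pos (by simpa using h)]; rfl
  · rw [if_neg h, List.filter_cons_of_neg (by simpa using h)]; rfl

theorem length_requiredDoms_le_self (d : ℕ) (K : Finset ℕ) (f : ℕ → ℕ) (t : ℕ) :
    (requiredDoms d K f t).length ≤ t := by
  unfold requiredDoms
  rw [List.length_map]
  exact (List.length_filter_le _ _).trans List.length_range.le

theorem length_encode_requiredDoms_le (d : ℕ) (K : Finset ℕ) (f : ℕ → ℕ) (t : ℕ) :
    ((requiredDoms d K f t).flatMap encodeList).length ≤ 3 * t := by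
  induction t with
  | zero => simp [requiredDoms]
  | succ t ih =>
    rw [requiredDoms_succ, List.flatMap_append, List.length_append]
    split_ifs
    · simp [length_encodeList] at ih ⊢; omega
    · simp at ih ⊢; omega

/-- One step of the phase that writes the required domains. -/
def requiredBody : Program := .seqs [
  .ite (.and (.not (.lt (.reg 2) (.load 4 (.reg 10))))
      (.eq (.load 9 (.load 6 (.load 4 (.reg 10)))) (.const 1)))
    (.store 11 (.reg 10) (.load 11 (.load 4 (.reg 10))))
    (.store 11 (.reg 10) (.load 4 (.reg 10))),
  .ite (.and (.and (.eq (.load 5 (.reg 10)) (.const 1))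
        (.eq (.load 9 (.load 6 (.reg 10))) (.const 0)))
      (.not (.lt (.reg 2) (.load 11 (.reg 10)))))
    (.seqs [emit (.const 1), emit (.load 10 (.reg 10)),
      emit (.sub (.load 10 (.load 11 (.reg 10))) (.const 1)),
      .assign 15 (.add (.reg 15) (.const 1))]) .skip,
  .assign 10 (.sub (.reg 10) (.const 1))]

/-- The required domains are written, backwards. -/
def requiredPhase : Program := .seq (.seqs [
    .assign 10 (.reg 2), .assign 14 (.const 4), .assign 15 (.const 0)])
  (.while (.not (.lt (.reg 10) (.const 0))) requiredBody)

/-- The required domains for the points above `d - t` have been written. -/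
structure RequiredWritten (N : ℤ) (d : ℕ) (Ls : List (List (ℕ × ℕ))) (inp : ℤ → ℤ) (nx : ℕ → ℕ)
    (t : ℕ) (s : State) : Prop where
  ranked : Ranked N d Ls inp nx d s
  wrote : Wrote ((requiredDoms d (kernelPoints d Ls nx) (kernelNext d Ls nx) t).flatMap encodeList) s
  count : s.reg 15 = (requiredDoms d (kernelPoints d Ls nx) (kernelNext d Ls nx) t).length

/-- In the backward sweep the entry of bank `11` at `nx v > v` is already known. A jump into a
removable block copies that entry, which is one unfolding of `skipBad`. -/
theorem wp_requiredBody (hj : IsJump d nx) (hs : ∀ v, IsSeed Ls v → v ≤ d) (hw : 4 * d + 20 ≤ w)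
    {t : ℕ} (ht : t ≤ d) (h : RequiredWritten N d Ls inp nx t s) (hv : s.reg 10 = (d : ℤ) - t)
    (hn : ∀ q ≤ d, d < q + t → s.mem 11 q = kernelNext d Ls nx q) :
    wp w requiredBody (fun s => RequiredWritten N d Ls inp nx (t + 1) s ∧
      s.reg 10 = (d : ℤ) - (t + 1 : ℕ) ∧
      ∀ q ≤ d, d < q + (t + 1) → s.mem 11 q = kernelNext d Ls nx q) s := by
  obtain ⟨v, hvt⟩ : ∃ v, v = d - t := ⟨_, rfl⟩
  have hvd : v ≤ d := by omega
  have hv : s.reg 10 = v := by rw [hv]; omega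
  have hps := kernel_pointSystem hj hs
  have hlt := hj.lt v hvd
  have hle := hj.le v hvd
  have hkn : kernelNext d Ls nx v ≤ d + 1 := skipBad_le hj hvd
  unfold requiredBody
  rw [Program.seqs_cons]
  refine wp_seq (R := fun s => RequiredWritten N d Ls inp nx t s ∧ s.reg 10 = v ∧
      ∀ q ≤ d, d < q + (t + 1) → s.mem 11 q = kernelNext d Ls nx q) ?_ ?_
  · have hm := h.ranked.marked
    have h4 := hm.jump v (by omega)
    have hstep : ∀ s' : State, s'.mem 11 = Function.update (s.mem 11) v (kernelNext d Ls nx v) →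
        ∀ q ≤ d, d < q + (t + 1) → s'.mem 11 q = kernelNext d Ls nx q := by
      intro s' hs' q hq hqt
      rw [hs']
      by_cases hqv : q = v
      · rw [hqv, Function.update_self]
      · rw [Function.update_of_ne (by exact_mod_cast hqv)]
        exact hn q hq (by omega)
    have hkeep : ∀ z, RequiredWritten N d Ls inp nx t (s.setMem 11 v z) := fun z =>
      ⟨h.ranked.setMem (by omega) _ _, h.wrote.setMem (by omega) _ _, h.count⟩
    simp only [wp, Test.Holds, Expr.eval, hv, hm.consts.reg2, h4]
    refine ⟨fun hc => ?_, fun hc => ?_⟩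
    · have hnd : nx v ≤ d := by have := hc.1; omega
      have hbad : InRemovable d nx (IsSeed Ls) (nx v) := by
        have := hc.2
        rw [hm.blocks _ hnd, hm.removable.eq_one_iff] at this
        exact this
      have heq : kernelNext d Ls nx v = kernelNext d Ls nx (nx v) := skipBad_of_bad hlt hnd hbad
      rw [hn (nx v) hnd (by omega), ← heq]
      exact ⟨by omega, by omega, hkeep _, hv, hstep _ (by simp)⟩
    · have heq : kernelNext d Ls nx v = nx v := skipBad_of_not_bad fun hnd hbad => hc ⟨by omega, by
        rw [hm.blocks _ hnd, hm.removable.eq_one_iff]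
        exact hbad⟩
      rw [← heq]
      exact ⟨by omega, by omega, hkeep _, hv, hstep _ (by simp)⟩
  · rintro s ⟨h, hv, hn⟩
    have hm := h.ranked.marked
    have h11 := hn v hvd (by omega)
    have hlen := length_encode_requiredDoms_le d (kernelPoints d Ls nx) (kernelNext d Ls nx) t
    have hlen' := length_requiredDoms_le_self d (kernelPoints d Ls nx) (kernelNext d Ls nx) t
    rw [Program.seqs_cons]
    refine wp_seq (R := fun s => RequiredWritten N d Ls inp nx (t + 1) s ∧ s.reg 10 = v ∧
      ∀ q ≤ d, d < q + (t + 1) → s.mem 11 q = kernelNext d Ls nx q) ?_ ?_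
    · simp only [wp, Test.Holds, Expr.eval, hv, hm.consts.reg2, h11, hm.kept_iff hvd]
      have hcond : ((v ∈ kernelPoints d Ls nx) ∧ ¬ ((d : ℤ) < (kernelNext d Ls nx v : ℕ))) ↔
          (d - t ∈ kernelPoints d Ls nx ∧ kernelNext d Ls nx (d - t) ≤ d) := by
        rw [← hvt]; norm_cast; rw [not_lt]
      refine ⟨fun hc => ?_, fun hc => ⟨⟨h.ranked, ?_, ?_⟩, trivial, hn⟩⟩
      · have hsucc := requiredDoms_succ d (kernelPoints d Ls nx) (kernelNext d Ls nx) t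
        rw [if_pos (hcond.1 hc), ← hvt] at hsucc
        obtain ⟨hvK, hvn⟩ := hc
        have hvn : kernelNext d Ls nx v ≤ d := by omega
        have hvlt := hps.lt v hvK
        have hrank := (rank_lt_iff (hps.mem v hvK hvn)).2 hvlt
        have hr1 := rank_le (kernelPoints d Ls nx) v
        have hr2 := rank_le (kernelPoints d Ls nx) (kernelNext d Ls nx v)
        have h10 : s.mem 10 v = rank (kernelPoints d Ls nx) v := h.ranked.rank v hvd
        have h10' := h.ranked.rank _ hvn
        simp only [Program.seqs, wp]
        refine wp_emit (z := 1) h.wrote rfl (by omega) (by simp; omega) ?_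
        refine wp_emit (z := rank (kernelPoints d Ls nx) v) (h.wrote.push _) ?_
          (by simp only [List.length_append, List.length_singleton]; omega) (by omega) ?_
        · simp only [Expr.eval]
          rw [State.push_reg _ _ (by omega), State.push_mem _ _ (by omega), hv, h10]
        refine wp_emit (z := (rank (kernelPoints d Ls nx) (kernelNext d Ls nx v) : ℤ) - 1)
          ((h.wrote.push _).push _) ?_
          (by simp only [List.length_append, List.length_singleton]; omega) (by omega) ?_
        · simp only [Expr.eval]
          rw [State.push_reg _ _ (by omega), State.push_reg _ _ (by omega),
            State.push_mem _ _ (by omega), State.push_mem _ _ (by omega),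
            State.push_mem _ _ (by omega), State.push_mem _ _ (by omega), hv, h11, h10']
        simp only [Expr.eval]
        rw [State.push_reg _ _ (by omega), State.push_reg _ _ (by omega),
          State.push_reg _ _ (by omega), h.count]
        refine ⟨by omega, ⟨?_, ?_, ?_⟩, ?_, ?_⟩
        · exact (((h.ranked.push _).push _).push _).setReg (by omega) (by omega) _
        · have := (((h.wrote.push 1).push (rank (kernelPoints d Ls nx) v)).push
            ((rank (kernelPoints d Ls nx) (kernelNext d Ls nx v) : ℤ) - 1)).setReg (r := 15)
            (by omega) ((requiredDoms d (kernelPoints d Ls nx) (kernelNext d Ls nx) t).length + 1)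
          convert this using 1
          rw [hsucc, List.flatMap_append]
          simp only [List.append_assoc, List.append_cancel_left_eq, List.flatMap_cons,
            List.flatMap_nil, List.append_nil, encodeList, renameIvl, List.length_singleton,
            List.cons_append, List.nil_append]
          -- Both subtractions are genuine: the successor of `v` is positive, and so is its rank.
          rw [Nat.sub_add_cancel (by omega : 1 ≤ kernelNext d Ls nx v)]
          rw [Nat.cast_sub (by omega)]
          simp
        · rw [hsucc]; simp
        · rw [State.setReg_reg, if_neg (by omega), State.push_reg _ _ (by omega),
            State.push_reg _ _ (by omega), State.push_reg _ _ (by omega), hv]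
        · rw [State.setReg_mem, State.push_mem _ _ (by omega), State.push_mem _ _ (by omega),
            State.push_mem _ _ (by omega)]
          exact hn
      · have hsucc := requiredDoms_succ d (kernelPoints d Ls nx) (kernelNext d Ls nx) t
        rw [if_neg fun h => hc (hcond.2 h), List.append_nil] at hsucc
        rw [hsucc]; exact h.wrote
      · have hsucc := requiredDoms_succ d (kernelPoints d Ls nx) (kernelNext d Ls nx) t
        rw [if_neg fun h => hc (hcond.2 h), List.append_nil] at hsucc
        rw [hsucc]; exact h.count
    · rintro s ⟨h, hv, hn⟩
      simp only [Program.seqs, wp, Expr.eval, hv]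
      exact ⟨by omega, ⟨h.ranked.setReg (by omega) (by omega) _, h.wrote.setReg (by omega) _,
        by simpa using h.count⟩, by simp; omega, hn⟩

theorem runs_required (hj : IsJump d nx) (hs : ∀ v, IsSeed Ls v → v ≤ d) (hw : 4 * d + 20 ≤ w)
    (h0 : Ranked N d Ls inp nx d s) :
    Runs w requiredPhase s (100 * (d + 2)) (RequiredWritten N d Ls inp nx (d + 1)) := by
  let Inv : ℕ → State → Prop := fun t s => RequiredWritten N d Ls inp nx t s ∧
    s.reg 10 = (d : ℤ) - t ∧ ∀ q ≤ d, d < q + t → s.mem 11 q = kernelNext d Ls nx q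
  have hpre : Runs w (.seqs [
      .assign 10 (.reg 2), .assign 14 (.const 4), .assign 15 (.const 0)]) s 10 (Inv 0) := by
    refine (runs_of_wp ?_).mono (by simp [Program.seqs, Program.maxCost, Expr.cost]) fun _ => id
    simp only [Program.seqs, wp, Expr.eval, h0.marked.consts.reg2]
    refine ⟨by omega, by simp; omega, by simp, ⟨?_, ⟨by simp [requiredDoms], ?_⟩,
      by simp [requiredDoms]⟩, by simp, fun q h1 h2 => by omega⟩
    · exact ((h0.setReg (by omega) (by omega) _).setReg (by omega) (by omega) _).setReg (by omega)
        (by omega) _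
    · intro i hi
      simp [requiredDoms] at hi
  have hcost : requiredBody.maxCost ≤ 80 := by
    simp [requiredBody, emit, Program.seqs, Program.maxCost, Expr.cost, Test.cost]
  have hloop : ∀ s, Inv 0 s → Runs w (.while (.not (.lt (.reg 10) (.const 0))) requiredBody) s
      ((d + 1 + 1) * 90) (Inv (d + 1)) := by
    intro s h
    refine (runs_while_const Inv (d + 1) h ?_ ?_).mono
      (Nat.mul_le_mul_left _ (by simp [Test.cost, Expr.cost]; omega)) fun _ => id
    · rintro t ht s ⟨h1, h2, h3⟩
      exact ⟨by simp [Test.Holds, Expr.eval, h2]; omega,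
        wp_requiredBody hj hs hw (by omega) h1 h2 h3⟩
    · rintro s ⟨h1, h2, h3⟩
      simp [Test.Holds, Expr.eval, h2]
  exact (hpre.seq hloop).mono (by omega) fun s h => h.1

/-! ##### Optional domains -/

/-- What is written for a domain. -/
def writeDom : Program :=
  .ite (.eq (.reg 6) (.const 1)) .skip
    (.seq (emit (.reg 6)) (.assign 15 (.add (.reg 15) (.const 1))))

/-- What is written for an interval. -/
def writeIvl : Program :=
  .ite (.eq (.reg 6) (.const 1)) .skip
    (.seq (emit (.load 10 (.reg 8)))
      (emit (.sub (.load 10 (.add (.reg 9) (.const 1))) (.const 1))))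

theorem optionalDoms_take_succ (K : Finset ℕ) {x : ℕ} (hx : x < Ls.length) :
    optionalDoms K (Ls.take (x + 1)) = optionalDoms K (Ls.take x) ++
      if Ls[x].length = 1 then [] else [Ls[x].map (renameIvl K)] := by
  unfold optionalDoms
  rw [← List.take_append_getElem hx, List.filter_append, List.map_append]
  congr 1
  by_cases h : Ls[x].length = 1 <;> simp [h]

theorem length_encode_optionalDoms_le (K : Finset ℕ) (Ls : List (List (ℕ × ℕ))) :
    ((optionalDoms K Ls).flatMap encodeList).length ≤ (Ls.flatMap encodeList).length := by
  unfold optionalDoms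
  induction Ls with
  | nil => simp
  | cons L Ls ih =>
    rw [List.flatMap_cons, List.length_append]
    by_cases h : L.length = 1
    · rw [List.filter_cons_of_neg (by simpa using h)]; omega
    · rw [List.filter_cons_of_pos (by simpa using h), List.map_cons, List.flatMap_cons,
        List.length_append, length_encodeList, length_encodeList, List.length_map]
      omega

/-- The part of the output for the first `j` intervals of a domain with holes. -/
def partialEncode (K : Finset ℕ) (L : List (ℕ × ℕ)) (j : ℕ) : List ℤ :=
  (L.length : ℤ) :: (L.take j).flatMap fun p => [((renameIvl K p).1 : ℤ), ((renameIvl K p).2 : ℤ)]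

theorem partialEncode_succ (K : Finset ℕ) (L : List (ℕ × ℕ)) {j : ℕ} (hj : j < L.length) :
    partialEncode K L (j + 1) =
      partialEncode K L j ++ [((renameIvl K L[j]).1 : ℤ)] ++ [((renameIvl K L[j]).2 : ℤ)] := by
  unfold partialEncode
  rw [← List.take_append_getElem hj, List.flatMap_append]
  simp

theorem partialEncode_length (K : Finset ℕ) (L : List (ℕ × ℕ)) :
    partialEncode K L L.length = encodeList (L.map (renameIvl K)) := by
  unfold partialEncode encodeList
  rw [List.take_length, List.flatMap_map, List.length_map]

theorem length_partialEncode_le (K : Finset ℕ) (L : List (ℕ × ℕ)) (j : ℕ) :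
    (partialEncode K L j).length ≤ 1 + 2 * j := by
  unfold partialEncode
  simp [List.length_flatMap]
  omega

/-- The optional domains of the first `x` domains have been written behind `E`. -/
structure OptionalWritten (N : ℤ) (d : ℕ) (Ls : List (List (ℕ × ℕ))) (inp : ℤ → ℤ) (nx : ℕ → ℕ)
    (E : List ℤ) (m x : ℕ) (s : State) : Prop where
  ranked : Ranked N d Ls inp nx d s
  wrote : Wrote (E ++ (optionalDoms (kernelPoints d Ls nx) (Ls.take x)).flatMap encodeList) s
  count : s.reg 15 = m + (optionalDoms (kernelPoints d Ls nx) (Ls.take x)).length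

/-- The optional domains of the first `x` domains, and `j` intervals of the next one, if that is
a domain with holes, have been written behind `E`. -/
structure PartWritten (N : ℤ) (d : ℕ) (Ls : List (List (ℕ × ℕ))) (inp : ℤ → ℤ) (nx : ℕ → ℕ)
    (E : List ℤ) (m x j : ℕ) (s : State) : Prop where
  ranked : Ranked N d Ls inp nx d s
  wrote : Wrote (E ++ (optionalDoms (kernelPoints d Ls nx) (Ls.take x)).flatMap encodeList ++
    if (Ls[x]?.getD []).length = 1 then [] else
      partialEncode (kernelPoints d Ls nx) (Ls[x]?.getD []) j) s
  count : s.reg 15 = m + (optionalDoms (kernelPoints d Ls nx) (Ls.take x)).length +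
    if (Ls[x]?.getD []).length = 1 then 0 else 1

theorem runs_optional (hin : HoldsInput N d Ls inp) (hL : ∀ L ∈ Ls, Separated d L) {m : ℕ}
    (hseed : ∀ v, IsSeed Ls v → v ∈ kernelPoints d Ls nx)
    (hw : 10 + 5 * Ls.length + 2 * holeCount Ls + d + E.length + m ≤ w)
    (h0 : OptionalWritten N d Ls inp nx E m 0 s) :
    Runs w (inputLoop writeDom writeIvl) s
      ((writeDom.maxCost + writeIvl.maxCost + 40) * (2 * Ls.length + holeCount Ls + 1))
      (OptionalWritten N d Ls inp nx E m Ls.length) := by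
  have hLd : ∀ L ∈ Ls, ∀ p ∈ L, p.1 < d ∧ p.2 < d := fun L hL' p hp => by
    have h1 := (hL L hL').le p hp
    have h2 := (hL L hL').lt p hp
    omega
  have hne : ∀ L ∈ Ls, L ≠ [] := fun L h => (hL L h).ne_nil
  -- What is written for the domains read so far is never longer than their input, so the output
  -- pointer stays within the word bound.
  have hlen : ∀ x, 4 + ((optionalDoms (kernelPoints d Ls nx) (Ls.take x)).flatMap encodeList).length
      ≤ inputPos Ls x := fun x => by
    have := length_encode_optionalDoms_le (kernelPoints d Ls nx) (Ls.take x)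
    unfold inputPos; omega
  have hopt : ∀ x, (optionalDoms (kernelPoints d Ls nx) (Ls.take x)).length ≤ Ls.length := fun x => by
    unfold optionalDoms
    rw [List.length_map]
    exact (List.length_filter_le _ _).trans (List.length_take_le' _ _)
  refine (runs_inputLoop hin hne hLd (by omega)
    (O := fun x => OptionalWritten N d Ls inp nx E m x)
    (J := fun x j => PartWritten N d Ls inp nx E m x j)
    (fun x s r z h1 h2 h => ⟨h.ranked.setReg h1 (by omega) z, h.wrote.setReg (by omega) z, by
      rw [State.setReg_reg, if_neg (by omega)]; exact h.count⟩)
    (fun x j s r z h1 h2 h => ⟨h.ranked.setReg h1 (by omega) z, h.wrote.setReg (by omega) z, by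
      rw [State.setReg_reg, if_neg (by omega)]; exact h.count⟩)
    ?_ ?_ ?_ h0 h0.ranked.marked.consts.mem0 h0.ranked.marked.consts.reg1).mono le_rfl
    fun s h => h.2.2
  · intro x hx s hc hO
    have hlx := hlen x
    have hox := hopt x
    have hpx := inputPos_le hne (x + 1)
    rw [inputPos_succ hx] at hpx
    simp only [writeDom, wp, Test.Holds, Expr.eval, hc.reg6]
    refine ⟨fun h1 => ⟨hc, ?_⟩, fun h1 => ?_⟩
    · have h1 : Ls[x].length = 1 := by exact_mod_cast h1
      refine ⟨hO.ranked, ?_, ?_⟩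
      · simpa [List.getElem?_eq_getElem hx, h1] using hO.wrote
      · simpa [List.getElem?_eq_getElem hx, h1] using hO.count
    · have h1 : ¬ Ls[x].length = 1 := by exact_mod_cast h1
      refine wp_emit (z := Ls[x].length) hO.wrote hc.reg6
        (by rw [List.length_append]; omega) (by omega) ?_
      rw [State.push_reg _ _ (by omega), hO.count]
      refine ⟨by omega, ⟨?_, ?_, ?_, ?_, ?_, ?_⟩, ?_, ?_, ?_⟩
      · rw [State.setReg_mem, State.push_mem _ _ (by omega), hc.mem]
      · rw [State.setReg_reg, if_neg (by omega), State.push_reg _ _ (by omega), hc.reg1]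
      · rw [State.setReg_reg, if_neg (by omega), State.push_reg _ _ (by omega), hc.reg4]
      · rw [State.setReg_reg, if_neg (by omega), State.push_reg _ _ (by omega), hc.reg5]
      · rw [State.setReg_reg, if_neg (by omega), State.push_reg _ _ (by omega), hc.reg6]
      · rw [State.setReg_reg, if_neg (by omega), State.push_reg _ _ (by omega), hc.reg7]
      · exact (hO.ranked.push _).setReg (by omega) (by omega) _
      · have := (hO.wrote.push (Ls[x].length : ℤ)).setReg (r := 15) (by omega)
          (m + (optionalDoms (kernelPoints d Ls nx) (Ls.take x)).length + 1)
        simpa [List.getElem?_eq_getElem hx, h1, partialEncode] using this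
      · simp [List.getElem?_eq_getElem hx, h1]
  · intro x hx j hj s hc h8 h9 hJ
    have hlx := hlen x
    have hpx := inputPos_le hne (x + 1)
    rw [inputPos_succ hx] at hpx
    obtain ⟨hJr, hJw, hJc⟩ := hJ
    simp only [List.getElem?_eq_getElem hx, Option.getD_some] at hJw hJc
    simp only [writeIvl, wp, Test.Holds, Expr.eval, hc.reg6]
    refine ⟨fun h1 => ⟨hc, ?_⟩, fun h1 => ?_⟩
    · have h1 : Ls[x].length = 1 := by exact_mod_cast h1
      refine ⟨hJr, ?_, ?_⟩
      · simpa [List.getElem?_eq_getElem hx, h1] using hJw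
      · simpa [List.getElem?_eq_getElem hx, h1] using hJc
    · have h1 : ¬ Ls[x].length = 1 := by exact_mod_cast h1
      obtain ⟨p, hp⟩ : ∃ p, Ls[x][j] = p := ⟨_, rfl⟩
      have hpd := hLd _ (List.getElem_mem hx) _ (List.getElem_mem hj)
      have hple := (hL _ (List.getElem_mem hx)).le _ (List.getElem_mem hj)
      rw [hp] at h8 h9 hpd hple
      have hs2 : p.2 + 1 ∈ kernelPoints d Ls nx :=
        hseed _ ⟨Ls[x], List.getElem_mem hx, h1, p, hp ▸ List.getElem_mem hj, Or.inr rfl⟩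
      have hrank := (rank_lt_iff (u := p.1) hs2).2 (by omega)
      have hr1 := rank_le (kernelPoints d Ls nx) p.1
      have hr2 := rank_le (kernelPoints d Ls nx) (p.2 + 1)
      have h10 := hJr.rank p.1 (by omega)
      have h10' : s.mem 10 ((p.2 : ℤ) + 1) = rank (kernelPoints d Ls nx) (p.2 + 1) := by
        have := hJr.rank (p.2 + 1) (by omega)
        push_cast at this
        exact this
      rw [if_neg h1] at hJw hJc
      have hpl := length_partialEncode_le (kernelPoints d Ls nx) Ls[x] j
      refine wp_emit (z := rank (kernelPoints d Ls nx) p.1) hJw ?_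
        (by simp only [List.length_append]; omega) (by omega) ?_
      · simp only [Expr.eval]; rw [h8, h10]
      refine wp_emit (z := (rank (kernelPoints d Ls nx) (p.2 + 1) : ℤ) - 1) (hJw.push _) ?_
        (by simp only [List.length_append, List.length_singleton]; omega) (by omega) ?_
      · simp only [Expr.eval]
        rw [State.push_reg _ _ (by omega), State.push_mem _ _ (by omega), h9, h10']
      refine ⟨⟨?_, ?_, ?_, ?_, ?_, ?_⟩, (hJr.push _).push _, ?_, ?_⟩
      · rw [State.push_mem _ _ (by omega), State.push_mem _ _ (by omega), hc.mem]
      · rw [State.push_reg _ _ (by omega), State.push_reg _ _ (by omega), hc.reg1]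
      · rw [State.push_reg _ _ (by omega), State.push_reg _ _ (by omega), hc.reg4]
      · rw [State.push_reg _ _ (by omega), State.push_reg _ _ (by omega), hc.reg5]
      · rw [State.push_reg _ _ (by omega), State.push_reg _ _ (by omega), hc.reg6]
      · rw [State.push_reg _ _ (by omega), State.push_reg _ _ (by omega), hc.reg7]
      · have := (hJw.push (rank (kernelPoints d Ls nx) p.1)).push
          ((rank (kernelPoints d Ls nx) (p.2 + 1) : ℤ) - 1)
        simp only [List.getElem?_eq_getElem hx, Option.getD_some, if_neg h1,
          partialEncode_succ _ _ hj, hp]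
        have h2 : ((renameIvl (kernelPoints d Ls nx) p).2 : ℤ) =
            (rank (kernelPoints d Ls nx) (p.2 + 1) : ℤ) - 1 := by
          simp only [renameIvl]; omega
        have h3 : ((renameIvl (kernelPoints d Ls nx) p).1 : ℤ) = rank (kernelPoints d Ls nx) p.1 :=
          rfl
        rw [h2, h3]
        simpa only [List.append_assoc] using this
      · rw [State.push_reg _ _ (by omega), State.push_reg _ _ (by omega), hJc]
        simp [List.getElem?_eq_getElem hx, h1]
  · intro x hx s hJ
    obtain ⟨hJr, hJw, hJc⟩ := hJ
    simp only [List.getElem?_eq_getElem hx, Option.getD_some, partialEncode_length] at hJw hJc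
    refine ⟨hJr, ?_, ?_⟩
    · rw [optionalDoms_take_succ _ hx, List.flatMap_append, ← List.append_assoc]
      convert hJw using 2
      split_ifs <;> simp
    · rw [optionalDoms_take_succ _ hx, hJc]
      split_ifs <;> simp
      ring

/-! ##### The head of the output -/

/-- The program part that writes the head of the output. -/
def headPhase : Program := .seqs [
  .assign 16 (.sub (.reg 0) (.reg 13)),
  .ite (.lt (.load 10 (.reg 2)) (.reg 16)) (.assign 16 (.load 10 (.reg 2))) .skip,
  .ite (.lt (.reg 16) (.const (-1))) (.assign 16 (.const (-1))) .skip,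
  .store 1 (.const 0) (.reg 16),
  .store 1 (.const 1) (.reg 15),
  .store 1 (.const 2) (.load 10 (.reg 2)),
  .store 1 (.const 3) (.reg 3)]

/-- The head is written last because the number of domains is known only then; for this reason the
domains were placed from address `4` on. -/
theorem wp_head {m : ℕ} (h : Ranked N d Ls inp nx d s) (hE : Wrote E s) (hm : s.reg 15 = m)
    (hw : 5 + d + m + N.natAbs + removedFrom d nx (IsSeed Ls) 0 + holeCount Ls ≤ w) :
    wp w headPhase (fun s => s.Outputs ([max (-1) (min (N - removedFrom d nx (IsSeed Ls) 0)
      (rank (kernelPoints d Ls nx) d)), (m : ℤ), (rank (kernelPoints d Ls nx) d : ℤ),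
      (holeCount Ls : ℤ)] ++ E)) s := by
  have hr := rank_le (kernelPoints d Ls nx) d
  have h10 := h.rank d le_rfl
  have h13 := h.marked.removed
  have h0 := h.marked.consts.reg0
  have h2 := h.marked.consts.reg2
  have h3 := h.marked.consts.reg3
  unfold headPhase
  rw [Program.seqs_cons, Program.seqs_cons, Program.seqs_cons]
  refine wp_seq (R := fun s' => s'.mem = s.mem ∧ s'.reg 2 = d ∧ s'.reg 3 = holeCount Ls ∧
    s'.reg 15 = m ∧ s'.reg 16 = N - removedFrom d nx (IsSeed Ls) 0) ?_ ?_
  · simp only [wp, Expr.eval, h0, h13]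
    exact ⟨by omega, rfl, by simpa using h2, by simpa using h3, by simpa using hm, by simp⟩
  rintro s₁ ⟨h4, h5, h6, h7, h8⟩
  refine wp_seq (R := fun s' => s'.mem = s.mem ∧ s'.reg 2 = d ∧ s'.reg 3 = holeCount Ls ∧
    s'.reg 15 = m ∧ s'.reg 16 = min (N - removedFrom d nx (IsSeed Ls) 0)
      (rank (kernelPoints d Ls nx) d)) ?_ ?_
  · simp only [wp, Test.Holds, Expr.eval, h4, h5, h8, h10]
    refine ⟨fun hlt => ⟨by omega, by simp [h4], by simp [h5], by simp [h6], by simp [h7], ?_⟩,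
      fun hlt => ⟨trivial, trivial, h6, h7, ?_⟩⟩
    · simp; omega
    · omega
  rintro s₂ ⟨h4, h5, h6, h7, h8⟩
  refine wp_seq (R := fun s' => s'.mem = s.mem ∧ s'.reg 2 = d ∧ s'.reg 3 = holeCount Ls ∧
    s'.reg 15 = m ∧ s'.reg 16 = max (-1) (min (N - removedFrom d nx (IsSeed Ls) 0)
      (rank (kernelPoints d Ls nx) d))) ?_ ?_
  · simp only [wp, Test.Holds, Expr.eval, h4, h5, h8]
    refine ⟨fun hlt => ⟨by omega, by simp [h4], by simp [h5], by simp [h6], by simp [h7], ?_⟩,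
      fun hlt => ⟨trivial, trivial, h6, h7, ?_⟩⟩
    · simp; omega
    · omega
  rintro s₃ ⟨h4, h5, h6, h7, h8⟩
  simp only [Program.seqs, wp, Expr.eval, State.setMem_reg, h5, h6, h7, h8, State.setMem_mem, h4]
  simp only [if_neg (by decide : (10 : ℕ) ≠ 1), h10]
  refine ⟨by omega, by omega, by omega, by omega, by omega, by omega, by omega, by omega, ?_⟩
  intro i hi
  simp only [State.setMem_mem, if_true, h4]
  match i with
  | 0 => simp
  | 1 => simp
  | 2 => simp
  | 3 => simp
  | i + 4 =>
    have hi' : i < E.length := by simp at hi; omega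
    have hg := hE.get i hi'
    have e : ((i + 4 : ℕ) : ℤ) = 4 + i := by push_cast; ring
    rw [e, Function.update_of_ne (by omega), Function.update_of_ne (by omega),
      Function.update_of_ne (by omega), Function.update_of_ne (by omega), hg]
    simp

end Emit

/-! ### The kernelization -/

/-- The head of the instance is put into registers. -/
def loadPhase : Program := .seqs [
  .assign 0 (.load 0 (.const 0)),
  .assign 1 (.load 0 (.const 1)),
  .assign 2 (.load 0 (.const 2)),
  .assign 3 (.load 0 (.const 3))]

/-- The kernelization. -/
def kernelProgram : Program :=
  .seq loadPhase (.seq (inputLoop .skip readIvl) (.seq jumpPhase (.seq scanPhase (.seq blockPhase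
    (.seq rankPhase (.seq requiredPhase (.seq (inputLoop writeDom writeIvl) headPhase)))))))

/-- The domains of the kernel. -/
noncomputable def kernelLists (d : ℕ) (Ls : List (List (ℕ × ℕ))) (nx : ℕ → ℕ) :
    List (List (ℕ × ℕ)) :=
  requiredDoms d (kernelPoints d Ls nx) (kernelNext d Ls nx) (d + 1) ++
    optionalDoms (kernelPoints d Ls nx) Ls

/-- The number of values that the kernel allows, clipped to the range where it matters. -/
noncomputable def kernelBound (N : ℤ) (d : ℕ) (Ls : List (List (ℕ × ℕ))) (nx : ℕ → ℕ) : ℤ :=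
  max (-1) (min (N - removedFrom d nx (IsSeed Ls) 0) (rank (kernelPoints d Ls nx) d))

section Kernel

variable {N : ℤ} {d w : ℕ} {Ls : List (List (ℕ × ℕ))} {nx : ℕ → ℕ} {s : State}

/-- A removable block contains no seed, so deletion never touches one. -/
theorem mem_kernelPoints_of_isSeed (hL : ∀ L ∈ Ls, Separated d L) {v : ℕ} (hv : IsSeed Ls v) :
    v ∈ kernelPoints d Ls nx := by
  have hvd := IsSeed.le hL v hv
  exact mem_keptPoints.2 ⟨hvd, .seed hv, fun h => blockCount_eq_zero.1 h.2.2.2.1 v hvd hv rfl⟩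

theorem holeCount_kernelLists : holeCount (kernelLists d Ls nx) = holeCount Ls := by
  unfold kernelLists
  rw [holeCount_append, holeCount_requiredDoms, holeCount_optionalDoms, Nat.zero_add]

theorem removedFrom_le (d : ℕ) (nx : ℕ → ℕ) (seed : ℕ → Prop) (j : ℕ) :
    removedFrom d nx seed j ≤ blk nx d + 1 := by
  classical
  exact (Finset.card_filter_le _ _).trans (Finset.card_range _).le

theorem runs_load (hin : HoldsInput N d Ls (s.mem 0)) (hz : ∀ b, b ≠ 0 → ∀ a, s.mem b a = 0)
    (hw : Ls.length + d + holeCount Ls + N.natAbs ≤ w) :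
    Runs w loadPhase s 12
      (Parsed N d Ls (s.mem 0) (fun _ => False) (fun _ => False)) := by
  refine (runs_of_wp ?_).mono (by simp [loadPhase, Program.seqs, Program.maxCost, Expr.cost])
    fun _ => id
  simp only [loadPhase, Program.seqs, wp, Expr.eval, State.setReg_mem, hin.zero, hin.one, hin.two,
    hin.three]
  refine ⟨by omega, by omega, by omega, by omega, ⟨rfl, ?_, ?_, ?_, ?_⟩, fun _ h => h.elim,
    fun a => Or.inl (hz 2 (by omega) _), fun v => Or.inr ⟨hz 3 (by omega) _, id⟩,
    hz 5 (by omega), hz 7 (by omega), hz 8 (by omega), hz 9 (by omega)⟩ <;> simp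

theorem runs_kernelProgram (hL : ∀ L ∈ Ls, Separated d L)
    (hw : 20 * (Ls.length + d + holeCount Ls + N.natAbs + 1) ≤ w) :
    Runs w kernelProgram (State.init ([N, (Ls.length : ℤ), (d : ℤ), (holeCount Ls : ℤ)] ++
        Ls.flatMap encodeList)) (2000 * (Ls.length + d + holeCount Ls + 1))
      (fun s => ∃ nx, NextSpec d Ls nx ∧ s.Outputs ([kernelBound N d Ls nx,
        ((kernelLists d Ls nx).length : ℤ), (rank (kernelPoints d Ls nx) d : ℤ),
        (holeCount (kernelLists d Ls nx) : ℤ)] ++ (kernelLists d Ls nx).flatMap encodeList)) := by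
  have hin := holdsInput_init N d Ls
  have hseed := IsSeed.le hL
  have hcost : readIvl.maxCost ≤ 60 ∧ writeDom.maxCost ≤ 60 ∧ writeIvl.maxCost ≤ 60 ∧
      headPhase.maxCost ≤ 60 := by
    simp [readIvl, writeDom, writeIvl, headPhase, emit, Program.seqs, Program.maxCost, Expr.cost,
      Test.cost]
  obtain ⟨hc1, hc2, hc3, hc4⟩ := hcost
  refine ((runs_load hin (fun b hb a => by simp [State.init, hb]) (by omega)).seq fun s h =>
    (runs_read hin hL (by omega) h).seq fun s h => (runs_jump hL (by omega) h).seq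
      -- The first term pays for the four sweeps over points and blocks, with constants `100`, `50`,
      -- `50` and `100`. The second pays for the pass that writes the domains with holes, the last
      -- for the head.
      (T' := 300 * (d + 2) + 160 * (2 * Ls.length + holeCount Ls + 1) + 60) ?_).mono ?_ fun _ => id
  · rintro s ⟨nx, hnx, h⟩
    have hj := hnx.isJump hL
    refine ((runs_scan hj hseed (by omega) h).seq fun s h => (runs_block hj (by omega) h.1 h.2).seq
      fun s h => (runs_rank (by omega) h).seq fun s h => (runs_required hj hseed (by omega) h).seq
      (T' := 160 * (2 * Ls.length + holeCount Ls + 1) + 60) (Q' := fun s => ∃ nx, NextSpec d Ls nx ∧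
        s.Outputs ([kernelBound N d Ls nx, ((kernelLists d Ls nx).length : ℤ),
          (rank (kernelPoints d Ls nx) d : ℤ), (holeCount (kernelLists d Ls nx) : ℤ)] ++
          (kernelLists d Ls nx).flatMap encodeList))
      fun s h => ?_).mono (by omega) fun _ => id
    have hE := length_encode_requiredDoms_le d (kernelPoints d Ls nx) (kernelNext d Ls nx) (d + 1)
    have hm := length_requiredDoms_le_self d (kernelPoints d Ls nx) (kernelNext d Ls nx) (d + 1)
    have ho := length_optionalDoms_le (Ls := Ls) (kernelPoints d Ls nx) fun L h => (hL L h).ne_nil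
    have hb := hj.blk_le (le_refl d)
    have hr := removedFrom_le d nx (IsSeed Ls) 0
    refine ((runs_optional (E := (requiredDoms d (kernelPoints d Ls nx) (kernelNext d Ls nx)
      (d + 1)).flatMap encodeList) (m := (requiredDoms d (kernelPoints d Ls nx)
      (kernelNext d Ls nx) (d + 1)).length) hin hL (fun v hv => mem_kernelPoints_of_isSeed hL hv)
      (by omega) ⟨h.ranked, by simpa [optionalDoms] using h.wrote,
        by simpa [optionalDoms] using h.count⟩).seq fun s h =>
      (runs_of_wp (wp_head (m := (kernelLists d Ls nx).length) h.ranked h.wrote ?_ ?_)).mono hc4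
        fun s h => ⟨nx, hnx, ?_⟩).mono ?_ fun _ => id
    · rw [h.count, List.take_length, kernelLists, List.length_append, Nat.cast_add]
    · rw [kernelLists, List.length_append]; omega
    · refine Nat.add_le_add_right (Nat.mul_le_mul_right _ ?_) _
      omega
    · rw [holeCount_kernelLists, kernelLists, List.flatMap_append]
      rw [List.take_length] at h
      exact h
  · have : (Program.skip.maxCost + readIvl.maxCost + 40) * (2 * Ls.length + holeCount Ls + 1) ≤
        101 * (2 * Ls.length + holeCount Ls + 1) :=
      Nat.mul_le_mul_right _ (by simp only [Program.maxCost]; omega)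
    omega

/-- The set `S` has at least one and at most `d + 1` elements. So all negative bounds fail alike,
and all bounds from `d` on are void. -/
theorem coverable_clip (N : ℤ) :
    Coverable d Ls (max (-1) (min N d)) ↔ Coverable d Ls N := by
  unfold Coverable
  refine exists_congr fun S => and_congr_right fun hS => and_congr_right fun h0 =>
    and_congr_left' ?_
  have h1 := Finset.card_le_card hS
  have h2 := Finset.card_pos.2 ⟨0, h0⟩
  rw [Finset.card_range] at h1
  omega

theorem NextSpec.coverable_kernel_iff (h : NextSpec d Ls nx) (hL : ∀ L ∈ Ls, Separated d L) (N : ℤ) :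
    Coverable (rank (kernelPoints d Ls nx) d) (kernelLists d Ls nx) (kernelBound N d Ls nx) ↔
      Coverable d Ls N := by
  have hj := h.isJump hL
  have hseed := IsSeed.le hL
  rw [kernelBound, coverable_clip, kernelLists,
    coverable_reduced_iff (kernel_pointSystem hj hseed) fun v => mem_kernelPoints_of_isSeed hL,
    h.coverable_iff hL, ← hj.pierced_badFrom hseed optionalDom_succ (optionalDom_le hL) N 0,
    badFrom_zero]
  rfl

/-- With `s ≤ 4 * k` seeds the number of kept points is at most `s + 3 * s * (1 + s) = 4 * s + 3 * s
^ 2`, which is at most `16 * k + 48 * k ^ 2`. -/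
theorem NextSpec.rank_kernel_le (h : NextSpec d Ls nx) (hL : ∀ L ∈ Ls, Separated d L) :
    rank (kernelPoints d Ls nx) d ≤ 64 * holeCount Ls ^ 2 := by
  have hj := h.isJump hL
  have h1 := hj.card_kept_le (IsSeed.le hL)
  have h2 := seedCount_le d fun L h => (hL L h).ne_nil
  rw [rank_eq_card d (kernel_pointSystem hj (IsSeed.le hL)).le]
  refine h1.trans ?_
  rcases Nat.eq_zero_or_pos (holeCount Ls) with h0 | h0
  · rw [h0] at h2
    rw [Nat.le_zero.1 h2]
    simp
  · have h3 := Nat.mul_le_mul h2 h2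
    nlinarith

end Kernel

theorem exists_kernelProgram (I : Instance) :
    ∃ (I' : Instance) (t : ℕ) (s : State),
      Exec (2000 * (I.size + I.N.natAbs + 1)) kernelProgram (State.init I.encode) t s ∧
      t ≤ 2000 * (I.size + 1) ∧ s.Outputs I'.encode ∧ (I'.Consistent ↔ I.Consistent) ∧
      I'.n ≤ 2000 * I.numHoles ^ 2 ∧ I'.d ≤ 2000 * I.numHoles ^ 2 ∧
      I'.numHoles ≤ 2000 * I.numHoles ^ 2 ∧ I'.N.natAbs ≤ 2000 * I.numHoles ^ 2 + 1 := by
  have hL := I.separated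
  have hlen := I.length_lists
  have hk := I.numHoles_eq
  have hsize : I.size = I.lists.length + I.d + holeCount I.lists := by
    rw [hlen, ← hk, Instance.size]
  obtain ⟨t, s, hrun, ht, nx, hnx, hout⟩ := runs_kernelProgram (N := I.N) hL
    (w := 2000 * (I.size + I.N.natAbs + 1)) (by omega)
  have hs := kernel_pointSystem (hnx.isJump hL) (IsSeed.le hL)
  have hsep : ∀ L ∈ kernelLists I.d I.lists nx,
      Separated (rank (kernelPoints I.d I.lists nx) I.d) L :=
    separated_reduced hs hL fun v => mem_kernelPoints_of_isSeed hL
  have hd := hnx.rank_kernel_le hL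
  -- The domains with holes contribute only linearly in `k` to the number of variables; the rest is
  -- at most twice the number of kept values.
  have hsq : holeCount I.lists ≤ holeCount I.lists ^ 2 := Nat.le_self_pow (by omega) _
  have hreq := length_requiredDoms_le hs
  have hopt := length_optionalDoms_le (kernelPoints I.d I.lists nx) fun L h => (hL L h).ne_nil
  refine ⟨Instance.ofLists _ _ hsep (kernelBound I.N I.d I.lists nx), t, s, ?_, ?_, ?_, ?_, ?_, ?_,
    ?_, ?_⟩
  · rw [I.encode_eq, hk, ← hlen]
    exact hrun
  · rw [hsize]
    exact ht
  · rw [Instance.encode_eq, Instance.numHoles_eq, Instance.lists_ofLists]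
    exact hout
  · rw [Instance.consistent_iff, Instance.consistent_iff, Instance.lists_ofLists]
    exact hnx.coverable_kernel_iff hL I.N
  · rw [hk]
    change (kernelLists I.d I.lists nx).length ≤ _
    rw [kernelLists, List.length_append]
    omega
  · rw [hk]
    change rank (kernelPoints I.d I.lists nx) I.d ≤ _
    omega
  · rw [Instance.numHoles_eq, Instance.lists_ofLists, holeCount_kernelLists, hk]
    omega
  · rw [hk]
    change (kernelBound I.N I.d I.lists nx).natAbs ≤ _
    unfold kernelBound
    omega

end NValueKernel

theorem mainTheorem1 :
    ∃ (P : NValueKernel.Program) (c : ℕ), ∀ I : NValueKernel.Instance,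
      ∃ (I' : NValueKernel.Instance) (t : ℕ) (s : NValueKernel.State),
        -- `P` computes `I'` from `I` in linear time, with words of logarithmic length
        NValueKernel.Exec (c * (I.size + I.N.natAbs + 1)) P
          (NValueKernel.State.init I.encode) t s ∧
        t ≤ c * (I.size + 1) ∧
        s.Outputs I'.encode ∧
        -- `I'` is equivalent to `I`
        (I'.Consistent ↔ I.Consistent) ∧
        -- the size of `I'` is bounded in terms of `k`
        I'.n ≤ c * I.numHoles ^ 2 ∧
        I'.d ≤ c * I.numHoles ^ 2 ∧
        I'.numHoles ≤ c * I.numHoles ^ 2 ∧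
        I'.N.natAbs ≤ c * I.numHoles ^ 2 + 1 :=
  ⟨NValueKernel.kernelProgram, 2000, NValueKernel.exists_kernelProgram⟩
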